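/- Let $\omega=e^{2\pi i/3}$, $\Gamma=4\pi(i\omega\mathbb Z\oplus i\omega^2\mathbb Z)$, $\Gamma^*=\frac1{\sqrt3}(\omega\mathbb Z\oplus\omega^2\mathbb Z)$, and let $U_0(z)=\sum_{k=0}^{2}\omega^k e^{\frac12(z\bar\omega^k-\bar z\omega^k)}$. In the coordinates $z=2i\omega y_1+2i\omega^2y_2$, $y\in\mathbb R^2/2\pi\mathbb Z^2$, on $\mathbb C/\Gamma$, and for $\mathbf k=(\omega^2k_1-\omega k_2)/\sqrt3$ with $(k_1,k_2)\in\mathbb R^2\setminus\mathbb Z^2$, put $$\mathscr D_{\mathbf k}=\omega^2(D_{y_1}+k_1)-\omega(D_{y_2}+k_2),\quad \mathscr V_\pm=\sqrt3\,U_0(\pm z),\quad A_{\mathbf k}=\tfrac13\mathscr D_{\mathbf k}^{-1}\mathscr V_+\mathscr D_{\mathbf k}^{-1}\mathscr V_-,\quad D_{y_j}=\tfrac1i\partial_{y_j},$$ and let $B=3A_{\mathbf k}$ with $\mathbf k=\omega^2/(2\sqrt3)$, acting on $L^2(\mathbb C/\Gamma)$ and componentwise on $L^2(\mathbb C/\Gamma;\mathbb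 C^2)$. Let $\Pi_N$ be the orthogonal projection onto the Fourier modes $e^{i\langle y,n\rangle}$, $n\in\mathbb Z^2$, $|n_1|,|n_2|\le N$, and let $$\rho_j(N,p)=\prod_{\ell=0}^{p-1}\Bigl(1-\frac{2\ell+j}{N}\Bigr)^{-1+\frac{2j}{p}}.$$ Let $L^2_{\mathbf 0}(\mathbb C/\Gamma)$ be the space of $u\in L^2(\mathbb C/\Gamma)$ with $u(z+\mathbf a)=u(z)$ for all $\mathbf a\in\Gamma/3$, and $L^2_{\mathbf 0}(\mathbb C/\Gamma;\mathbb C^2)$ the space of $(u_1,u_2)\in L^2(\mathbb C/\Gamma;\mathbb C^2)$ with $\omega^{a_1+a_2}u_1(z+\mathbf a)=u_1(z)$ and $u_2(z+\mathbf a)=u_2(z)$ for all $\mathbf a=\frac43\pi i(\omega a_1+\omega^2a_2)$, $a_1,a_2\in\mathbb Z$. Then for all integers $N\ge16$, with $\|\cdot\|_{\mathcal L_1}$ the trace norm and $\|\cdot\|_{\mathcal L}$ the operator norm, $$\|B^4-\Pi_NB^4\Pi_N\|_{\mathcal L_1(H)}^{1/6}\le 10.23\,N^{-1}\rho_1(N,8)^{1/6}\quad\text{for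 } H=L^2_{\mathbf 0}(\mathbb C/\Gamma)\text{ and for } H=L^2_{\mathbf 0}(\mathbb C/\Gamma;\mathbb C^2),$$ $$\|B^4-\Pi_NB^4\Pi_N\|_{\mathcal L(L^2(\mathbb C/\Gamma;\mathbb C^2))}\le 6^8\cdot2\,\rho_0(N,8)\,N^{-8}.$$ Moreover, let $U\in C^\infty(\mathbb C;\mathbb C)$ be any potential with $U(z+\frac43\pi i\omega^\ell)=\bar\omega U(z)$, $\ell=1,2$, and $U(\omega z)=\omega U(z)$ (for instance $U=U_0$). For $\alpha\in\mathbb C$ let $$D(\alpha)=\begin{pmatrix}2D_{\bar z}&\alpha U(z)\\ \alpha U(-z)&2D_{\bar z}\end{pmatrix}\ \text{with domain } H^1(\mathbb C/\Gamma;\mathbb C^2),\qquad H_{\mathbf k}(\alpha)=\begin{pmatrix}0&D(\alpha)^*-\bar{\mathbf k}\\D(\alpha)-\mathbf k&0\end{pmatrix},$$ where $D_{\bar z}=\frac1{2i}(\partial_{x_1}+i\partial_{x_2})$, $z=x_1+ix_2$, and for $\mathbf k\notin\Gamma^*$ let $T_{\mathbf k}=(2D_{\bar z}-\mathbf k)^{-1}\begin{pmatrix}0&U(z)\\U(-z)&0\end{pmatrix}$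 on $L^2(\mathbb C/\Gamma;\mathbb C^2)$. Let $\mathcal A$ be the set of all $1/\lambda$ with $0\ne\lambda\in\operatorname{Spec}(T_{\mathbf k})$ for some $\mathbf k\notin\Gamma^*$. Then for every $\alpha\in\mathcal A$ the Hamiltonian $H(\alpha)$ has at least $18$ flat bands at energy $0$, counted with multiplicity: $\dim\ker_{L^2(\mathbb C/\Gamma;\mathbb C^4)}H_{\mathbf k}(\alpha)\ge18$ for every $\mathbf k\in\mathbb C$. -/

import Mathlib

open MeasureTheory
open scoped ENNReal ComplexConjugate InnerProductSpace

noncomputable section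

namespace TBG

/-! ### Geometry -/

/-- `ω = e^{2πi/3}`. -/
def ω : ℂ := Complex.exp (2 * Real.pi * Complex.I / 3)

theorem ω_pow_three : ω ^ 3 = 1 := by
  rw [ω, ← Complex.exp_nat_mul]
  have : ((3 : ℕ) : ℂ) * (2 * Real.pi * Complex.I / 3) = 2 * Real.pi * Complex.I := by
    push_cast; ring
  rw [this, Complex.exp_two_pi_mul_I]

theorem ω_eq : ω = -1 / 2 + (Real.sqrt 3 / 2 : ℝ) * Complex.I := by
  have h : (2 * Real.pi * Complex.I / 3 : ℂ)
      = ((Real.pi - Real.pi / 3 : ℝ) : ℂ) * Complex.I := by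
    push_cast; ring
  rw [ω, h, Complex.exp_mul_I, ← Complex.ofReal_cos, ← Complex.ofReal_sin,
    Real.cos_pi_sub, Real.sin_pi_sub, Real.cos_pi_div_three, Real.sin_pi_div_three]
  push_cast; ring

theorem ω_sq_add : ω ^ 2 = -1 - ω := by
  have h3 : ((Real.sqrt 3 : ℝ) : ℂ) ^ 2 = 3 := by
    rw [← Complex.ofReal_pow, Real.sq_sqrt (by norm_num)]; norm_num
  rw [ω_eq]
  push_cast
  linear_combination (1 / 4 : ℂ) * ((Real.sqrt 3 : ℝ) : ℂ) ^ 2 * Complex.I_sq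
    - (1 / 4 : ℂ) * h3

theorem conj_ω : conj ω = ω ^ 2 := by
  rw [ω_sq_add, ω_eq]
  simp only [map_add, map_mul, map_div₀, map_neg, map_one, Complex.conj_ofReal, Complex.conj_I,
    map_ofNat]
  ring

/-- The dual lattice `Γ* = (ω ℤ ⊕ ω² ℤ) / √3` of `Γ = 4π (iω ℤ ⊕ iω² ℤ)`. -/
def dualLattice : Set ℂ :=
  {k | ∃ a b : ℤ, k = (a * ω + b * ω ^ 2) / (Real.sqrt 3 : ℝ)}

/-- The torus `ℂ/Γ`, in the coordinates `t ∈ (ℝ/ℤ)²` for which `z = 4πi (ω t₀ + ω² t₁)`,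
i.e. `t = y / 2π` with `z = 2iω y₀ + 2iω² y₁`. -/
abbrev Torus : Type := UnitAddTorus (Fin 2)

/-- The invariant probability measure on the torus. -/
abbrev torusMeasure : Measure Torus := Measure.pi fun _ => AddCircle.haarAddCircle

/-- The representative `z = 4πi (ω s₀ + ω² s₁)`, `s ∈ [0,1)²`, of a point of `ℂ/Γ`. -/
def torusRep (x : Torus) : ℂ :=
  4 * Real.pi * Complex.I *
    (ω * ((AddCircle.equivIco (1 : ℝ) 0 (x 0) : ℝ) : ℂ)
      + ω ^ 2 * ((AddCircle.equivIco (1 : ℝ) 0 (x 1) : ℝ) : ℂ))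

/-- The space `L²(ℂ/Γ; ℂ)`. -/
abbrev L2 : Type := Lp ℂ 2 torusMeasure

/-- The space `L²(ℂ/Γ; ℂ²)`. -/
abbrev L2Two : Type := PiLp 2 fun _ : Fin 2 => L2

/-- The orthonormal basis `e^{i⟨y,n⟩} = e^{2πi⟨t,n⟩}`, `n ∈ ℤ²`, of `L²(ℂ/Γ; ℂ)`. -/
def fourierBasis : HilbertBasis (Fin 2 → ℤ) ℂ L2 := UnitAddTorus.mFourierBasis

/-! ### Potentials -/

/-- Smooth potentials with the symmetries `U(z + a) = ω̄ U(z)` for `a = (4/3)πiω^ℓ`, `ℓ = 1, 2`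
(so that `U` is `Γ`-periodic), and `U(ωz) = ω U(z)`. -/
structure Potential where
  toFun : ℂ → ℂ
  smooth : ContDiff ℝ (⊤ : ℕ∞) toFun
  translation : ∀ ℓ : ℕ, ℓ = 1 ∨ ℓ = 2 → ∀ z,
    toFun (z + 4 / 3 * Real.pi * Complex.I * ω ^ ℓ) = conj ω * toFun z
  rotation : ∀ z, toFun (ω * z) = ω * toFun z

/-- `z ↦ U(z)` as a continuous function. -/
def Potential.plus (U : Potential) : C(ℂ, ℂ) := ⟨U.toFun, U.smooth.continuous⟩

/-- `z ↦ U(-z)` as a continuous function. -/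
def Potential.minus (U : Potential) : C(ℂ, ℂ) :=
  ⟨fun z => U.toFun (-z), U.smooth.continuous.comp continuous_neg⟩

/-- The function `∑_{k=0}^{2} ω^k exp((z ω̄^k - z̄ ω^k)/2)`. -/
def standardFun (z : ℂ) : ℂ :=
  ∑ k ∈ Finset.range 3, ω ^ k * Complex.exp ((z * conj ω ^ k - conj z * ω ^ k) / 2)

theorem standardFun_contDiff : ContDiff ℝ (⊤ : ℕ∞) standardFun := by
  unfold standardFun
  refine ContDiff.sum fun k _ => contDiff_const.mul ?_
  refine Complex.contDiff_exp.comp ?_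
  refine ContDiff.div_const ?_ _
  refine (contDiff_id.mul contDiff_const).sub (ContDiff.mul ?_ contDiff_const)
  exact Complex.conjCLE.contDiff

theorem exp_neg_ω : Complex.exp (-(2 * Real.pi * Complex.I / 3)) = ω ^ 2 := by
  rw [Complex.exp_neg, ← ω]
  refine inv_eq_of_mul_eq_one_right ?_
  rw [← ω_pow_three]; ring

theorem exp_two_ω : Complex.exp (2 * (2 * Real.pi * Complex.I / 3)) = ω ^ 2 := by
  rw [two_mul, Complex.exp_add, ← ω]; ring

theorem standardFun_translation (ℓ : ℕ) (hℓ : ℓ = 1 ∨ ℓ = 2) (z : ℂ) :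
    standardFun (z + 4 / 3 * Real.pi * Complex.I * ω ^ ℓ) = conj ω * standardFun z := by
  have h3 := ω_pow_three
  have h2 := ω_sq_add
  have key : ∀ k ∈ Finset.range 3, Complex.exp
      (((z + 4 / 3 * Real.pi * Complex.I * ω ^ ℓ) * conj ω ^ k
        - conj (z + 4 / 3 * Real.pi * Complex.I * ω ^ ℓ) * ω ^ k) / 2)
      = ω ^ 2 * Complex.exp ((z * conj ω ^ k - conj z * ω ^ k) / 2) := by
    intro k hk
    have hsplit : ((z + 4 / 3 * Real.pi * Complex.I * ω ^ ℓ) * conj ω ^ k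
        - conj (z + 4 / 3 * Real.pi * Complex.I * ω ^ ℓ) * ω ^ k) / 2
        = (2 * Real.pi * Complex.I / 3) * (ω ^ (ℓ + 2 * k) + ω ^ (2 * ℓ + k))
          + (z * conj ω ^ k - conj z * ω ^ k) / 2 := by
      simp only [map_add, map_mul, map_div₀, map_pow, map_ofNat, Complex.conj_ofReal,
        Complex.conj_I, conj_ω]
      ring
    rw [hsplit, Complex.exp_add]
    congr 1
    have hk3 : k < 3 := Finset.mem_range.mp hk
    have h4 : ω ^ 4 = ω := by rw [show (4 : ℕ) = 3 + 1 from rfl, pow_add, h3]; ring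
    have h5 : ω ^ 5 = ω ^ 2 := by rw [show (5 : ℕ) = 3 + 2 from rfl, pow_add, h3]; ring
    have h6 : ω ^ 6 = 1 := by rw [show (6 : ℕ) = 3 * 2 from rfl, pow_mul, h3]; ring
    have case1 : ∀ w : ℂ, w = -1 →
        Complex.exp ((2 * Real.pi * Complex.I / 3) * w) = ω ^ 2 := by
      rintro w rfl
      rw [mul_neg_one, exp_neg_ω]
    have case2 : ∀ w : ℂ, w = 2 →
        Complex.exp ((2 * Real.pi * Complex.I / 3) * w) = ω ^ 2 := by
      rintro w rfl
      rw [mul_comm, exp_two_ω]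
    rcases hℓ with rfl | rfl <;> interval_cases k <;> norm_num [h3, h4, h5, h6] <;>
      first
      | (apply case1; rw [h2]; ring)
      | (apply case2; norm_num)
  unfold standardFun
  rw [Finset.mul_sum]
  refine Finset.sum_congr rfl fun k hk => ?_
  rw [key k hk, conj_ω]; ring

theorem standardFun_rotation (z : ℂ) : standardFun (ω * z) = ω * standardFun z := by
  have h3 := ω_pow_three
  have h4 : ω ^ 4 = ω := by rw [show (4 : ℕ) = 3 + 1 from rfl, pow_add, h3]; ring
  unfold standardFun
  simp only [Finset.sum_range_succ, Finset.sum_range_zero, map_mul, conj_ω]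
  have e0 : (ω * z * (ω ^ 2) ^ 0 - ω ^ 2 * conj z * ω ^ 0) / 2
      = (z * (ω ^ 2) ^ 2 - conj z * ω ^ 2) / 2 := by
    linear_combination (-z * ω / 2) * h3
  have e1 : (ω * z * (ω ^ 2) ^ 1 - ω ^ 2 * conj z * ω ^ 1) / 2
      = (z * (ω ^ 2) ^ 0 - conj z * ω ^ 0) / 2 := by
    linear_combination (z / 2 - conj z / 2) * h3
  have e2 : (ω * z * (ω ^ 2) ^ 2 - ω ^ 2 * conj z * ω ^ 2) / 2
      = (z * (ω ^ 2) ^ 1 - conj z * ω ^ 1) / 2 := by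
    linear_combination (z * ω ^ 2 / 2 - conj z * ω / 2) * h3
  rw [e0, e1, e2]
  linear_combination (-Complex.exp ((z * (ω ^ 2) ^ 2 - conj z * ω ^ 2) / 2)) * h3

/-- The potential `U(z) = ∑_{k=0}^{2} ω^k exp((z ω̄^k - z̄ ω^k)/2)`. -/
def standardPotential : Potential where
  toFun := standardFun
  smooth := standardFun_contDiff
  translation := standardFun_translation
  rotation := standardFun_rotation

/-! ### Bounded operators on `L²(ℂ/Γ)` -/

theorem norm_ω : ‖ω‖ = 1 := by
  have h : ‖ω‖ ^ 3 = 1 := by rw [← norm_pow, ω_pow_three, norm_one]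
  exact (pow_eq_one_iff_of_nonneg (norm_nonneg _) (by norm_num)).mp h

theorem torusRep_measurable : Measurable torusRep := by
  have h : Measurable fun x : UnitAddCircle => ((AddCircle.equivIco (1 : ℝ) 0 x : ℝ) : ℂ) :=
    Complex.measurable_ofReal.comp
      (measurable_subtype_coe.comp (AddCircle.measurableEquivIco (1 : ℝ) 0).measurable)
  have hj : ∀ j : Fin 2, Measurable fun x : Torus =>
      ((AddCircle.equivIco (1 : ℝ) 0 (x j) : ℝ) : ℂ) :=
    fun j => h.comp (measurable_pi_apply (X := fun _ : Fin 2 => UnitAddCircle) j)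
  exact (((hj 0).const_mul ω).add ((hj 1).const_mul (ω ^ 2))).const_mul
    (4 * Real.pi * Complex.I)

theorem torusRep_norm_le (x : Torus) : ‖torusRep x‖ ≤ 4 * Real.pi * 2 := by
  have hs : ∀ y : UnitAddCircle, ‖((AddCircle.equivIco (1 : ℝ) 0 y : ℝ) : ℂ)‖ ≤ 1 := by
    intro y
    have := (AddCircle.equivIco (1 : ℝ) 0 y).2
    rw [Complex.norm_real, Real.norm_of_nonneg this.1]
    linarith [this.2]
  unfold torusRep
  rw [norm_mul]
  have h1 : ‖(4 * Real.pi * Complex.I : ℂ)‖ = 4 * Real.pi := by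
    simp [Real.pi_pos.le]
  rw [h1]
  refine mul_le_mul_of_nonneg_left ?_ (by positivity)
  refine (norm_add_le _ _).trans ?_
  rw [norm_mul, norm_mul, norm_pow, norm_ω, one_pow, one_mul, one_mul]
  linarith [hs (x 0), hs (x 1)]

theorem torusFun_memLp (f : C(ℂ, ℂ)) : MemLp (fun x => f (torusRep x)) ∞ torusMeasure := by
  obtain ⟨C, hC⟩ := (isCompact_closedBall (0 : ℂ) (4 * Real.pi * 2)).exists_bound_of_continuousOn
    f.continuous.continuousOn
  refine memLp_top_of_bound
    (f.continuous.measurable.comp torusRep_measurable).aestronglyMeasurable C ?_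
  exact Filter.Eventually.of_forall fun x => hC _ (by simpa using torusRep_norm_le x)

/-- Multiplication by (the function on `ℂ/Γ` given by) `f`. -/
def mulOp (f : C(ℂ, ℂ)) : L2 →L[ℂ] L2 :=
  (ContinuousLinearMap.lsmul ℂ ℂ).holderL torusMeasure ∞ 2 2 (torusFun_memLp f).toLp

theorem memℓp_mul (m : (Fin 2 → ℤ) → ℂ) (C : ℝ) (hC : ∀ n, ‖m n‖ ≤ C)
    (v : lp (fun _ : Fin 2 → ℤ => ℂ) 2) : Memℓp (fun n => m n * v n) 2 := by
  refine ((lp.memℓp v).const_smul (C : ℂ)).mono' fun n => ?_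
  rw [Pi.smul_apply, smul_eq_mul, norm_mul, norm_mul, Complex.norm_real]
  exact mul_le_mul_of_nonneg_right ((hC n).trans (le_abs_self C)) (norm_nonneg _)

/-- The Fourier multiplier with bounded symbol `m`. -/
def fourierMul (m : (Fin 2 → ℤ) → ℂ) (hm : ∃ C : ℝ, ∀ n, ‖m n‖ ≤ C) : L2 →L[ℂ] L2 :=
  LinearMap.mkContinuousOfExistsBound
    { toFun := fun u => fourierBasis.repr.symm
        ⟨fun n => m n * fourierBasis.repr u n, memℓp_mul m hm.choose hm.choose_spec _⟩
      map_add' := fun u v => by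
        rw [← map_add]
        congr 1
        ext n
        rw [lp.coeFn_add, Pi.add_apply]
        simp [mul_add]
      map_smul' := fun c u => by
        rw [RingHom.id_apply, ← map_smul]
        congr 1
        ext n
        simp [mul_left_comm] }
    (by
      obtain ⟨C, hC⟩ := id hm
      refine ⟨‖(C : ℂ)‖, fun u => ?_⟩
      have h0 : ‖u‖ = ‖fourierBasis.repr u‖ := (LinearIsometryEquiv.norm_map _ _).symm
      rw [LinearMap.coe_mk, AddHom.coe_mk, LinearIsometryEquiv.norm_map, h0, ← norm_smul]
      refine lp.norm_mono (by norm_num) fun n => ?_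
      rw [lp.coeFn_smul, Pi.smul_apply, smul_eq_mul, norm_mul, norm_mul, Complex.norm_real]
      exact mul_le_mul_of_nonneg_right ((hC n).trans (le_abs_self C)) (norm_nonneg _))

/-- The symbol of `2 D_{z̄} = (ω² D_{y₀} - ω D_{y₁}) / √3`. -/
def dbarSymbol (n : Fin 2 → ℤ) : ℂ := (ω ^ 2 * n 0 - ω * n 1) / (Real.sqrt 3 : ℝ)

theorem normSq_ω_comb (a b : ℝ) : ‖ω ^ 2 * a - ω * b‖ ^ 2 = a ^ 2 + a * b + b ^ 2 := by
  have h3 : Real.sqrt 3 ^ 2 = 3 := Real.sq_sqrt (by norm_num)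
  rw [← Complex.normSq_eq_norm_sq, ω_sq_add, ω_eq, Complex.normSq_apply]
  simp
  nlinarith [h3]

theorem norm_dbarSymbol_sq (n : Fin 2 → ℤ) :
    ‖dbarSymbol n‖ ^ 2 = ((n 0 : ℝ) ^ 2 + n 0 * n 1 + (n 1 : ℝ) ^ 2) / 3 := by
  have h := normSq_ω_comb (n 0) (n 1)
  push_cast at h
  rw [dbarSymbol, norm_div, div_pow, h, Complex.norm_real, Real.norm_of_nonneg (by positivity),
    Real.sq_sqrt (by norm_num)]

/-- As the values of the symbol form a lattice, the inverse of the shifted symbol is bounded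
(also when the convention `0⁻¹ = 0` is used at a lattice point). -/
theorem resolventSymbol_bounded (k : ℂ) : ∃ C : ℝ, ∀ n, ‖(dbarSymbol n - k)⁻¹‖ ≤ C := by
  have hfin : {n : Fin 2 → ℤ | ‖dbarSymbol n - k‖ < 1}.Finite := by
    obtain ⟨M, hM⟩ := exists_nat_gt (6 * (1 + ‖k‖) ^ 2)
    refine (Set.Finite.pi' (t := fun _ : Fin 2 => Set.Icc (-(M : ℤ)) M)
      fun _ => Set.finite_Icc _ _).subset fun n hn => ?_
    have h1 : ‖dbarSymbol n‖ ≤ 1 + ‖k‖ := by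
      have := norm_le_norm_sub_add (dbarSymbol n) k
      have hn' : ‖dbarSymbol n - k‖ < 1 := hn
      linarith
    have h2 : ‖dbarSymbol n‖ ^ 2 ≤ (1 + ‖k‖) ^ 2 := by gcongr
    rw [norm_dbarSymbol_sq] at h2
    have key : ∀ j : Fin 2, (n j : ℝ) ^ 2 < M := by
      intro j
      fin_cases j
      · simp only [Fin.zero_eta]
        nlinarith [sq_nonneg ((n 0 : ℝ) + n 1), sq_nonneg (n 1 : ℝ)]
      · simp only [Fin.mk_one]
        nlinarith [sq_nonneg ((n 0 : ℝ) + n 1), sq_nonneg (n 0 : ℝ)]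
    intro j
    have hj : (n j) ^ 2 < (M : ℤ) := by exact_mod_cast key j
    exact ⟨by nlinarith, by nlinarith⟩
  obtain ⟨C, hC⟩ := (hfin.image fun n => ‖(dbarSymbol n - k)⁻¹‖).bddAbove
  refine ⟨max C 1, fun n => ?_⟩
  by_cases hn : ‖dbarSymbol n - k‖ < 1
  · exact (hC ⟨n, hn, rfl⟩).trans (le_max_left _ _)
  · rw [norm_inv]
    exact (inv_le_one_of_one_le₀ (not_lt.mp hn)).trans (le_max_right _ _)

/-- `(2 D_{z̄} - k)⁻¹` on `L²(ℂ/Γ; ℂ)`, for `k ∉ Γ*`. -/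
def resolvent (k : ℂ) : L2 →L[ℂ] L2 :=
  fourierMul (fun n => (dbarSymbol n - k)⁻¹) (resolventSymbol_bounded k)

/-- The operator on `L²(ℂ/Γ; ℂ²)` given by a `2 × 2` matrix of operators on `L²(ℂ/Γ; ℂ)`. -/
def matOp (A : Matrix (Fin 2) (Fin 2) (L2 →L[ℂ] L2)) : L2Two →L[ℂ] L2Two :=
  (PiLp.continuousLinearEquiv 2 ℂ fun _ : Fin 2 => L2).symm.toContinuousLinearMap ∘L
    (ContinuousLinearMap.pi fun i =>
      ∑ j, A i j ∘L PiLp.proj (𝕜 := ℂ) 2 (fun _ : Fin 2 => L2) j)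

/-- The operator acting as `A` on each of the two components. -/
def diagOp (A : L2 →L[ℂ] L2) : L2Two →L[ℂ] L2Two := matOp !![A, 0; 0, A]

/-- Multiplication by the matrix `(0, U(z); U(-z), 0)`. -/
def potentialOp (U : Potential) : L2Two →L[ℂ] L2Two :=
  matOp !![0, mulOp U.plus; mulOp U.minus, 0]

/-- `T_k = (2 D_{z̄} - k)⁻¹ (0, U(z); U(-z), 0)`, for `k ∉ Γ*`. -/
def Top (U : Potential) (k : ℂ) : L2Two →L[ℂ] L2Two := diagOp (resolvent k) ∘L potentialOp U

/-- The set `𝒜` of all `1/λ`, `λ` a nonzero element of the spectrum of `T_k` on `L²(ℂ/Γ; ℂ²)`,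
`k ∉ Γ*`. -/
def magicSet (U : Potential) : Set ℂ :=
  {α | ∃ k ∉ dualLattice, ∃ lam ∈ spectrum ℂ (Top U k), lam ≠ 0 ∧ α = 1 / lam}

/-! ### The unbounded operators `D(α)` and `H_k(α)` -/

/-- The weight `⟨n⟩ = (1 + |n|²)^{1/2}`. -/
def japanese (n : Fin 2 → ℤ) : ℝ := Real.sqrt (1 + (n 0 : ℝ) ^ 2 + (n 1 : ℝ) ^ 2)

/-- The Sobolev space `H¹(ℂ/Γ; ℂ)`: all `u` with `∑ₙ (1 + |n|²) |ûₙ|² < ∞`. -/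
def sobolevH1 : Submodule ℂ L2 where
  carrier := {u | Memℓp (fun n => (japanese n : ℂ) * fourierBasis.repr u n) 2}
  zero_mem' := by
    have e : (fun n => (japanese n : ℂ) * fourierBasis.repr (0 : L2) n) = 0 := by
      funext n
      simp
    change Memℓp _ 2
    rw [e]
    exact zero_memℓp
  add_mem' := fun {u v} hu hv => by
    have e : (fun n => (japanese n : ℂ) * fourierBasis.repr (u + v) n)
        = (fun n => (japanese n : ℂ) * fourierBasis.repr u n)
          + fun n => (japanese n : ℂ) * fourierBasis.repr v n := by
      funext n
      simp [mul_add]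
    change Memℓp _ 2
    rw [e]
    exact Memℓp.add hu hv
  smul_mem' := fun c u hu => by
    have e : (fun n => (japanese n : ℂ) * fourierBasis.repr (c • u) n)
        = c • fun n => (japanese n : ℂ) * fourierBasis.repr u n := by
      funext n
      simp [mul_left_comm]
    change Memℓp _ 2
    rw [e]
    exact Memℓp.const_smul hu c

theorem dbar_memℓp (u : sobolevH1) :
    Memℓp (fun n => dbarSymbol n * fourierBasis.repr (u : L2) n) 2 := by
  refine Memℓp.mono' u.2 fun n => ?_
  rw [norm_mul, norm_mul]
  refine mul_le_mul_of_nonneg_right ?_ (norm_nonneg _)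
  rw [Complex.norm_real, japanese, Real.norm_of_nonneg (Real.sqrt_nonneg _)]
  refine Real.le_sqrt_of_sq_le ?_
  rw [norm_dbarSymbol_sq]
  nlinarith [sq_nonneg ((n 0 : ℝ) - n 1), sq_nonneg (n 0 : ℝ), sq_nonneg (n 1 : ℝ)]

/-- `2 D_{z̄} : H¹(ℂ/Γ; ℂ) → L²(ℂ/Γ; ℂ)`. -/
def dbar : sobolevH1 →ₗ[ℂ] L2 where
  toFun u := fourierBasis.repr.symm ⟨fun n => dbarSymbol n * fourierBasis.repr (u : L2) n,
    dbar_memℓp u⟩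
  map_add' u v := by
    rw [← map_add]
    congr 1
    ext n
    rw [lp.coeFn_add, Pi.add_apply]
    simp [mul_add]
  map_smul' c u := by
    rw [RingHom.id_apply, ← map_smul]
    congr 1
    ext n
    simp [mul_left_comm]

/-- `H¹(ℂ/Γ; ℂ²)`. -/
def sobolevH1Two : Submodule ℂ L2Two where
  carrier := {u | ∀ i, u i ∈ sobolevH1}
  zero_mem' _ := sobolevH1.zero_mem
  add_mem' hu hv i := sobolevH1.add_mem (hu i) (hv i)
  smul_mem' c _ hu i := sobolevH1.smul_mem c (hu i)

/-- `D(α) = (2 D_{z̄}, α U(z); α U(-z), 2 D_{z̄})` as an unbounded operator on `L²(ℂ/Γ; ℂ²)` with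
domain `H¹(ℂ/Γ; ℂ²)`. -/
def D (U : Potential) (α : ℂ) : L2Two →ₗ.[ℂ] L2Two where
  domain := sobolevH1Two
  toFun :=
    { toFun := fun u =>
        WithLp.toLp 2 (fun i => dbar ⟨(u : L2Two) i, u.2 i⟩) + α • potentialOp U (u : L2Two)
      map_add' := fun u v => by
        have h : (WithLp.toLp 2 fun i => dbar ⟨((u + v : sobolevH1Two) : L2Two) i, (u + v).2 i⟩ :
            L2Two) = WithLp.toLp 2 (fun i => dbar ⟨(u : L2Two) i, u.2 i⟩)
              + WithLp.toLp 2 (fun i => dbar ⟨(v : L2Two) i, v.2 i⟩) := by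
          rw [← WithLp.toLp_add]
          congr 1
          funext i
          exact dbar.map_add ⟨(u : L2Two) i, u.2 i⟩ ⟨(v : L2Two) i, v.2 i⟩
        rw [h, Submodule.coe_add, map_add, smul_add]
        abel
      map_smul' := fun c u => by
        have h : (WithLp.toLp 2 fun i => dbar ⟨((c • u : sobolevH1Two) : L2Two) i, (c • u).2 i⟩ :
            L2Two) = c • WithLp.toLp 2 (fun i => dbar ⟨(u : L2Two) i, u.2 i⟩) := by
          rw [← WithLp.toLp_smul]
          congr 1
          funext i
          exact dbar.map_smul c ⟨(u : L2Two) i, u.2 i⟩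
        rw [h, Submodule.coe_smul, map_smul, RingHom.id_apply, smul_add, smul_comm α c] }

/-- The Bloch Hamiltonian `H_k(α) = (0, D(α)* - k̄; D(α) - k, 0)` on
`L²(ℂ/Γ; ℂ⁴) = L²(ℂ/Γ; ℂ²) ⊕ L²(ℂ/Γ; ℂ²)`, where `D(α)*` is the Hilbert space adjoint. -/
def blochHamiltonian (U : Potential) (α k : ℂ) :
    WithLp 2 (L2Two × L2Two) →ₗ.[ℂ] WithLp 2 (L2Two × L2Two) where
  domain := ((D U α).domain.prod (D U α).adjoint.domain).comap
    (WithLp.linearEquiv 2 ℂ (L2Two × L2Two)).toLinearMap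
  toFun :=
    { toFun := fun w => WithLp.toLp 2
        ((D U α).adjoint ⟨w.1.snd, w.2.2⟩ - conj k • w.1.snd,
          D U α ⟨w.1.fst, w.2.1⟩ - k • w.1.fst)
      map_add' := fun w w' => by
        have h1 := (D U α).map_add ⟨w.1.fst, w.2.1⟩ ⟨w'.1.fst, w'.2.1⟩
        have h2 := (D U α).adjoint.map_add ⟨w.1.snd, w.2.2⟩ ⟨w'.1.snd, w'.2.2⟩
        rw [← WithLp.toLp_add, Prod.mk_add_mk]
        congr 2
        · rw [sub_add_sub_comm, ← h2, ← smul_add]; rfl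
        · rw [sub_add_sub_comm, ← h1, ← smul_add]; rfl
      map_smul' := fun c w => by
        have h1 := (D U α).map_smul c ⟨w.1.fst, w.2.1⟩
        have h2 := (D U α).adjoint.map_smul c ⟨w.1.snd, w.2.2⟩
        refine Eq.trans ?_ (WithLp.toLp_smul 2 c _)
        refine congrArg (WithLp.toLp 2) (Prod.ext ?_ ?_)
        · refine Eq.trans ?_ (smul_sub c _ _).symm
          rw [← h2, smul_comm c]; rfl
        · refine Eq.trans ?_ (smul_sub c _ _).symm
          rw [← h1, smul_comm c]; rfl }

/-- `H(α)` has at least `m` flat bands (at energy `0`), counted with multiplicity: `0` is an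
eigenvalue of multiplicity at least `m` of `H_k(α)` for every quasi-momentum `k`. -/
def HasFlatBands (U : Potential) (α : ℂ) (m : ℕ) : Prop :=
  ∀ k : ℂ, (m : Cardinal) ≤ Module.rank ℂ (LinearMap.ker (blochHamiltonian U α k).toFun)

/-! ### The operator `B` and its truncation -/

/-- The symbol of `𝒟_k = ω² (D_{y₀} + k₀) - ω (D_{y₁} + k₁) = √3 (2 D_{z̄} + k)`, where
`k = (ω² k₀ - ω k₁)/√3`. -/
def calDSymbol (k₀ k₁ : ℝ) (n : Fin 2 → ℤ) : ℂ := ω ^ 2 * (n 0 + k₀) - ω * (n 1 + k₁)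

theorem calDSymbol_eq (k₀ k₁ : ℝ) (n : Fin 2 → ℤ) : calDSymbol k₀ k₁ n =
    (Real.sqrt 3 : ℝ) * (dbarSymbol n - -((ω ^ 2 * k₀ - ω * k₁) / (Real.sqrt 3 : ℝ))) := by
  have h : ((Real.sqrt 3 : ℝ) : ℂ) ≠ 0 := by
    exact_mod_cast (Real.sqrt_pos.mpr (by norm_num : (0 : ℝ) < 3)).ne'
  rw [calDSymbol, dbarSymbol]
  field_simp
  ring

theorem calDSymbol_inv_bounded (k₀ k₁ : ℝ) : ∃ C : ℝ, ∀ n, ‖(calDSymbol k₀ k₁ n)⁻¹‖ ≤ C := by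
  obtain ⟨C, hC⟩ := resolventSymbol_bounded (-((ω ^ 2 * k₀ - ω * k₁) / (Real.sqrt 3 : ℝ)))
  refine ⟨‖((Real.sqrt 3 : ℝ) : ℂ)⁻¹‖ * C, fun n => ?_⟩
  rw [calDSymbol_eq, mul_inv, norm_mul]
  exact mul_le_mul_of_nonneg_left (hC n) (norm_nonneg _)

/-- `𝒟_k⁻¹`, for `(k₀, k₁) ∉ ℤ²`. -/
def calDInv (k₀ k₁ : ℝ) : L2 →L[ℂ] L2 :=
  fourierMul (fun n => (calDSymbol k₀ k₁ n)⁻¹) (calDSymbol_inv_bounded k₀ k₁)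

/-- `𝒱₊ = √3 U(z)`, for the standard potential. -/
def calVPlus : L2 →L[ℂ] L2 := ((Real.sqrt 3 : ℝ) : ℂ) • mulOp standardPotential.plus

/-- `𝒱₋ = √3 U(-z)`, for the standard potential. -/
def calVMinus : L2 →L[ℂ] L2 := ((Real.sqrt 3 : ℝ) : ℂ) • mulOp standardPotential.minus

/-- `A_k = (1/3) 𝒟_k⁻¹ 𝒱₊ 𝒟_k⁻¹ 𝒱₋`, where `k = (ω² k₀ - ω k₁)/√3`. -/
def A (k₀ k₁ : ℝ) : L2 →L[ℂ] L2 :=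
  (1 / 3 : ℂ) • (calDInv k₀ k₁ * calVPlus * calDInv k₀ k₁ * calVMinus)

/-- `B = 3 A_k` for `k = ω²/(2√3)`, that is `(k₀, k₁) = (1/2, 0)`. -/
def B : L2 →L[ℂ] L2 := (3 : ℂ) • A (1 / 2) 0

/-- The orthogonal projection `Π_N` onto the Fourier modes `n` with `|n₀|, |n₁| ≤ N`. -/
def fourierProj (N : ℕ) : L2 →L[ℂ] L2 :=
  fourierMul (fun n => if ∀ j, |n j| ≤ (N : ℤ) then 1 else 0)
    ⟨1, fun n => by split_ifs <;> simp⟩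

/-- `B⁴ - Π_N B⁴ Π_N`. -/
def truncError (N : ℕ) : L2 →L[ℂ] L2 := B ^ 4 - fourierProj N * B ^ 4 * fourierProj N

/-! ### Translations and symmetry-reduced spaces -/

/-- The point of the torus that corresponds to `(4/3)πi (a₀ ω + a₁ ω²)`. -/
def shiftPoint (a : Fin 2 → ℤ) : Torus := fun j => ((a j / 3 : ℝ) : UnitAddCircle)

/-- `(L_a u)(z) = u(z + (4/3)πi (a₀ ω + a₁ ω²))`. -/
def translation (a : Fin 2 → ℤ) : L2 →L[ℂ] L2 :=
  (Lp.compMeasurePreservingₗᵢ ℂ (fun x : Torus => x + shiftPoint a)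
    (measurePreserving_add_right torusMeasure (shiftPoint a))).toContinuousLinearMap

/-- `𝓛_a = (ω^{a₀+a₁} L_a, 0; 0, L_a)` on `L²(ℂ/Γ; ℂ²)`. -/
def translationTwo (a : Fin 2 → ℤ) : L2Two →L[ℂ] L2Two :=
  matOp !![ω ^ (a 0 + a 1) • translation a, 0; 0, translation a]

/-- `L²₀(ℂ/Γ) = {u ∈ L²(ℂ/Γ; ℂ) : u(z + γ) = u(z) for all γ ∈ Γ/3}`. -/
def reducedL2 : Submodule ℂ L2 := ⨅ a : Fin 2 → ℤ, (translation a - 1).ker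

/-- `L²₀(ℂ/Γ; ℂ²) = {u ∈ L²(ℂ/Γ; ℂ²) : 𝓛_a u = u for all a}`. -/
def reducedL2Two : Submodule ℂ L2Two := ⨅ a : Fin 2 → ℤ, (translationTwo a - 1).ker

instance : CompleteSpace reducedL2 := by
  refine IsClosed.completeSpace_coe (s := (reducedL2 : Set L2)) (hs := ?_)
  rw [reducedL2, Submodule.coe_iInf]
  exact isClosed_iInter fun a => (translation a - 1).isClosed_ker

instance : CompleteSpace reducedL2Two := by
  refine IsClosed.completeSpace_coe (s := (reducedL2Two : Set L2Two)) (hs := ?_)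
  rw [reducedL2Two, Submodule.coe_iInf]
  exact isClosed_iInter fun a => (translationTwo a - 1).isClosed_ker

/-- The operator that `X` induces on a closed subspace `K`, as `P_K X|_K`; this is `X|_K` when
`X K ⊆ K`. -/
def restrictTo {E : Type*} [NormedAddCommGroup E] [InnerProductSpace ℂ E] (K : Submodule ℂ E)
    [CompleteSpace K] (X : E →L[ℂ] E) : K →L[ℂ] K :=
  K.orthogonalProjectionOnto ∘L X ∘L K.subtypeL

/-- The trace norm `tr |X| ∈ [0, ∞]`, `|X| = (X* X)^{1/2}`, which is the sum of the singular values
of `X`. The trace of the positive operator `|X|` is the supremum over all finite orthonormal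
families of the sums of `⟨e_i, |X| e_i⟩`, and so the sum over any orthonormal basis. -/
def traceNorm {E : Type*} [NormedAddCommGroup E] [InnerProductSpace ℂ E] [CompleteSpace E]
    (X : E →L[ℂ] E) : ℝ≥0∞ :=
  ⨆ (m : ℕ) (e : Fin m → E) (_ : Orthonormal ℂ e),
    ∑ i, ENNReal.ofReal (⟪e i, CFC.abs X (e i)⟫_ℂ).re

/-- `ρ_j(N, p) = ∏_{ℓ=0}^{p-1} (1 - (2ℓ + j)/N)^{-1 + 2j/p}`. -/
def rho (j N p : ℕ) : ℝ :=
  ∏ l ∈ Finset.range p, (1 - (2 * l + j : ℝ) / N) ^ (-1 + 2 * j / p : ℝ)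

end TBG

end

noncomputable section

namespace TBG

/-! ### Trace norm estimates -/

section TraceNorm

variable {H : Type*} [NormedAddCommGroup H] [InnerProductSpace ℂ H] [CompleteSpace H]

/-! The truncation bounds and the flat bands are independent.

Truncation. In Fourier space, multiplication by U₀(±z) moves a mode by one of three hopping vectors,
and 𝒟⁻¹ multiplies a nonzero mode m by a number of size at most (2/√3)/(|m| - 1/2), where |m| is the
sup-norm. Hence B and B* gain two inverse powers of the frequency and lower the sup-norm of a mode
by at most 3 (`FarBound`); four factors give the degree 8 product `hopProd`. The error is B⁴(1 -
Π_N) + (1 - Π_N)B⁴Π_N, and the operator norms of both summands follow at once. For the trace norm,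
`traceNorm_add_le` sums over a basis the norms of the images under the first summand and under the
adjoint of the second; both vanish on modes of sup-norm at most N. On a single mode the constant
improves, since the nine double hops have few coinciding end points. The reduced spaces only contain
one residue class mod 3 per component, so a shell of radius m has at most (8m + 12)/3 modes. The
resulting sum, of order m · m⁻⁸, telescopes against (N - 8)⁻⁶, which `rho_one_ge` compares with ρ₁.

Flat bands. Compactness of T_k turns α ∈ 𝒜 into a nonzero solution of (D(α) - k)u = 0 for some k ∉
Γ*. The equation decouples over nine sectors of modes (residues mod 3), and multiplication by a
character moves one sector to another while shifting k by an element of Γ*, so the sector 0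
suffices. The set of k that are solvable there is closed, by Fredholm theory. It is open off Γ*:
comparison of u(z) with u(ωz) shows that a solution has a zero z₀ (`IsSolution.exists_common_zero`),
and multiplication by a function with simple poles on z₀ + Γ/3 gives a solution for nearby k
(`IsSolution.conv_poleCoeff`). As ℂ ∖ Γ* is connected and dense, every k is solvable in every
sector. This gives nine orthogonal elements of the kernel of D(α) - k and, by transposition, nine of
the kernel of D(α)* - k̄. -/

theorem norm_abs_apply (X : H →L[ℂ] H) (v : H) : ‖CFC.abs X v‖ = ‖X v‖ := by
  have hsa : IsSelfAdjoint (CFC.abs X) := (CFC.abs_nonneg X).isSelfAdjoint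
  have h : ⟪CFC.abs X v, CFC.abs X v⟫_ℂ = ⟪X v, X v⟫_ℂ := by
    have h1 : CFC.abs X (CFC.abs X v) = (ContinuousLinearMap.adjoint X) (X v) := by
      have := congrArg (fun T : H →L[ℂ] H => T v) (CFC.abs_mul_abs X)
      simpa [ContinuousLinearMap.star_eq_adjoint] using this
    calc ⟪CFC.abs X v, CFC.abs X v⟫_ℂ = ⟪v, CFC.abs X (CFC.abs X v)⟫_ℂ := by
          rw [← ContinuousLinearMap.adjoint_inner_right, ← ContinuousLinearMap.star_eq_adjoint,
            hsa.star_eq]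
      _ = ⟪X v, X v⟫_ℂ := by rw [h1, ContinuousLinearMap.adjoint_inner_right]
  rw [inner_self_eq_norm_sq_to_K, inner_self_eq_norm_sq_to_K] at h
  have h' : ‖CFC.abs X v‖ ^ 2 = ‖X v‖ ^ 2 := by exact_mod_cast h
  exact (sq_eq_sq₀ (norm_nonneg _) (norm_nonneg _)).mp h'

open scoped ComplexOrder in
/-- Approximate polar decomposition: `|X|` is within `ε` of `W* X` for a contraction `W`, in the
sense of diagonal matrix elements. -/
theorem exists_contraction_abs (X : H →L[ℂ] H) {ε : ℝ} (hε : 0 < ε) :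
    ∃ W : H →L[ℂ] H, (∀ v, ‖W v‖ ≤ ‖v‖) ∧
      ∀ v, (⟪v, CFC.abs X v⟫_ℂ).re ≤ (⟪W v, X v⟫_ℂ).re + ε * ‖v‖ ^ 2 := by
  set h := CFC.abs X with hh
  have h0 : 0 ≤ h := CFC.abs_nonneg X
  have hsa : IsSelfAdjoint h := h0.isSelfAdjoint
  have hadj : ContinuousLinearMap.adjoint h = h := by
    rw [← ContinuousLinearMap.star_eq_adjoint, hsa.star_eq]
  have hpos : ∀ v, 0 ≤ (⟪v, h v⟫_ℂ).re := fun v =>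
    ((ContinuousLinearMap.nonneg_iff_isPositive h).mp h0).re_inner_nonneg_right v
  -- The spectrum of |X| is nonnegative, so -ε lies outside it.
  have hunit : IsUnit (h + (ε : ℂ) • 1) := by
    have : ¬ (-(ε : ℂ)) ∈ spectrum ℂ h := by
      intro hmem
      have := spectrum_nonneg_of_nonneg h0 hmem
      rw [Complex.le_def] at this
      simp at this
      linarith [this]
    rw [spectrum.notMem_iff] at this
    rw [← IsUnit.neg_iff]
    convert this using 1
    ext v
    simp [Algebra.algebraMap_eq_smul_one]
    abel
  obtain ⟨u, hu⟩ := hunit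
  set R : H →L[ℂ] H := ((u⁻¹ : (H →L[ℂ] H)ˣ) : H →L[ℂ] H)
  have hR : ∀ v, h (R v) + (ε : ℂ) • R v = v := fun v => by
    have := congrArg (fun T : H →L[ℂ] H => T v) (u.mul_inv)
    rw [hu] at this
    simpa using this
  have hnorm : ∀ v, ‖h (R v)‖ ≤ ‖v‖ := by
    intro v
    refine (sq_le_sq₀ (norm_nonneg _) (norm_nonneg _)).mp ?_
    conv_rhs => rw [← hR v]
    rw [@norm_add_sq ℂ]
    have h1 : 0 ≤ RCLike.re ⟪h (R v), (ε : ℂ) • R v⟫_ℂ := by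
      rw [inner_smul_right, ← ContinuousLinearMap.adjoint_inner_right, hadj]
      have := hpos (R v)
      simp
      positivity
    nlinarith [sq_nonneg ‖(ε : ℂ) • R v‖]
  -- W = X(|X| + ε)⁻¹ replaces the partial isometry of the polar decomposition. In v = |X|Rv + εRv
  -- the cross term is nonnegative, so ‖Wv‖ = ‖|X|Rv‖ ≤ ‖v‖. The same splitting of the left entry of
  -- ⟨v, |X|v⟩ gives ⟨Wv, Xv⟩ and the error ε⟨|X|Rv, v⟩.
  refine ⟨X ∘L R, fun v => ?_, fun v => ?_⟩
  · rw [ContinuousLinearMap.comp_apply, ← norm_abs_apply]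
    exact hnorm v
  · have e1 : ⟪X (R v), X v⟫_ℂ = ⟪h (R v), h v⟫_ℂ := by
      have h1 : h (h v) = (ContinuousLinearMap.adjoint X) (X v) := by
        have := congrArg (fun T : H →L[ℂ] H => T v) (CFC.abs_mul_abs X)
        simpa [ContinuousLinearMap.star_eq_adjoint] using this
      rw [← ContinuousLinearMap.adjoint_inner_right, ← h1,
        ← ContinuousLinearMap.adjoint_inner_right h, hadj]
    have e2 : ⟪v, h v⟫_ℂ = ⟪h (R v), h v⟫_ℂ + (ε : ℂ) * ⟪R v, h v⟫_ℂ := by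
      conv_lhs => rw [← hR v]
      rw [inner_add_left, inner_smul_left]
      simp only [Complex.conj_ofReal]
      rw [hR v]
    have e3 : ⟪R v, h v⟫_ℂ = ⟪h (R v), v⟫_ℂ := by
      rw [← ContinuousLinearMap.adjoint_inner_left, hadj]
    rw [ContinuousLinearMap.comp_apply, e1, e2, e3, Complex.add_re, Complex.re_ofReal_mul]
    have h4 : (⟪h (R v), v⟫_ℂ).re ≤ ‖v‖ ^ 2 := by
      refine (Complex.re_le_norm _).trans ((norm_inner_le_norm _ _).trans ?_)
      rw [sq]
      exact mul_le_mul_of_nonneg_right (hnorm v) (norm_nonneg _)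
    nlinarith

theorem enorm_le_tsum_of_hasSum {ι : Type*} {f : ι → ℂ} {s : ℂ} (hf : HasSum f s) {g : ι → ℝ}
    (hg : ∀ n, ‖f n‖ ≤ g n) : ENNReal.ofReal s.re ≤ ∑' n, ENNReal.ofReal (g n) := by
  by_cases htop : ∑' n, ENNReal.ofReal (g n) = ∞
  · rw [htop]; exact le_top
  have hg0 : ∀ n, 0 ≤ g n := fun n => (norm_nonneg _).trans (hg n)
  have hs : Summable g := by
    have := ENNReal.summable_toReal htop
    exact this.congr fun n => ENNReal.toReal_ofReal (hg0 n)
  rw [← ENNReal.ofReal_tsum_of_nonneg hg0 hs]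
  refine ENNReal.ofReal_le_ofReal ((Complex.re_le_norm s).trans ?_)
  rw [← hf.tsum_eq]
  exact tsum_of_norm_bounded hs.hasSum hg

theorem norm_sum_mul_le {m : ℕ} (a b : Fin m → ℂ) {s t : ℝ} (hs : 0 ≤ s) (ht : 0 ≤ t)
    (ha : ∑ i, ‖a i‖ ^ 2 ≤ s ^ 2) (hb : ∑ i, ‖b i‖ ^ 2 ≤ t ^ 2) : ‖∑ i, a i * b i‖ ≤ s * t := by
  refine (norm_sum_le _ _).trans ?_
  simp only [norm_mul]
  refine (Real.sum_mul_le_sqrt_mul_sqrt _ _ _).trans ?_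
  exact mul_le_mul (Real.sqrt_le_iff.mpr ⟨hs, ha⟩) (Real.sqrt_le_iff.mpr ⟨ht, hb⟩)
    (Real.sqrt_nonneg _) hs

/-- If `(b n)` consists of vectors of norm at most one that reproduce the space, then the trace
norm of `X + Y` is at most `∑ ‖X b_n‖ + ∑ ‖Y* b_n‖`. -/
theorem traceNorm_add_le {ι : Type*} (X Y : H →L[ℂ] H) (b : ι → H) (hb1 : ∀ n, ‖b n‖ ≤ 1)
    (hb : ∀ v, HasSum (fun n => ⟪b n, v⟫_ℂ • b n) v) :
    traceNorm (X + Y) ≤ ∑' n, ENNReal.ofReal ‖X (b n)‖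
      + ∑' n, ENNReal.ofReal ‖ContinuousLinearMap.adjoint Y (b n)‖ := by
  refine iSup_le fun m => iSup_le fun e => iSup_le fun he => ?_
  have hbessel : ∀ x, ∑ i, ‖⟪e i, x⟫_ℂ‖ ^ 2 ≤ ‖x‖ ^ 2 := fun x =>
    he.sum_inner_products_le x (s := Finset.univ)
  refine ENNReal.le_of_forall_pos_le_add fun ε hε _ => ?_
  -- Each of the m vectors costs this much, so the total stays below ε, also for m = 0.
  have hδ : (0 : ℝ) < ε / (m + 1) := by positivity
  obtain ⟨W, hW1, hW⟩ := exists_contraction_abs (X + Y) hδ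
  have hWadj : ∀ v, ‖ContinuousLinearMap.adjoint W v‖ ≤ ‖v‖ := by
    intro v
    have hWn : ‖W‖ ≤ 1 := W.opNorm_le_bound zero_le_one fun v => by rw [one_mul]; exact hW1 v
    have := (ContinuousLinearMap.adjoint W).le_opNorm v
    rw [LinearIsometryEquiv.norm_map] at this
    nlinarith [norm_nonneg v]
  -- X is expanded at its input e_i and Y at its output Y e_i. After Cauchy–Schwarz and Bessel over
  -- i, the first sees only X b_n and the second only Y* b_n.
  have hsX : HasSum (fun n => ∑ i, ⟪b n, e i⟫_ℂ * ⟪W (e i), X (b n)⟫_ℂ)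
      (∑ i, ⟪W (e i), X (e i)⟫_ℂ) := by
    refine hasSum_sum fun i _ => ?_
    refine HasSum.congr_fun ((hb (e i)).mapL ((innerSL ℂ (W (e i))) ∘L X)) fun n => ?_
    simp
  have hsY : HasSum (fun n => ∑ i, ⟪W (e i), b n⟫_ℂ * ⟪b n, Y (e i)⟫_ℂ)
      (∑ i, ⟪W (e i), Y (e i)⟫_ℂ) := by
    refine hasSum_sum fun i _ => ?_
    refine HasSum.congr_fun ((hb (Y (e i))).mapL (innerSL ℂ (W (e i)))) fun n => ?_
    simp [mul_comm]
  have bX : ∀ n, ‖∑ i, ⟪b n, e i⟫_ℂ * ⟪W (e i), X (b n)⟫_ℂ‖ ≤ ‖X (b n)‖ := by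
    intro n
    rw [← one_mul ‖X (b n)‖]
    refine norm_sum_mul_le _ _ zero_le_one (norm_nonneg _) ?_ ?_
    · simp_rw [norm_inner_symm (b n)]
      refine (hbessel _).trans ?_
      have := hb1 n
      gcongr
    · simp_rw [← ContinuousLinearMap.adjoint_inner_right W]
      refine (hbessel _).trans ?_
      have := hWadj (X (b n))
      gcongr
  have bY : ∀ n, ‖∑ i, ⟪W (e i), b n⟫_ℂ * ⟪b n, Y (e i)⟫_ℂ‖
      ≤ ‖ContinuousLinearMap.adjoint Y (b n)‖ := by
    intro n
    rw [← one_mul ‖ContinuousLinearMap.adjoint Y (b n)‖]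
    refine norm_sum_mul_le _ _ zero_le_one (norm_nonneg _) ?_ ?_
    · simp_rw [← ContinuousLinearMap.adjoint_inner_right W]
      refine (hbessel _).trans ?_
      have := (hWadj (b n)).trans (hb1 n)
      gcongr
    · simp_rw [← ContinuousLinearMap.adjoint_inner_left Y, norm_inner_symm _ (e _)]
      exact hbessel _
  have key : ∑ i, (⟪e i, CFC.abs (X + Y) (e i)⟫_ℂ).re
      ≤ (∑ i, ⟪W (e i), X (e i)⟫_ℂ).re + (∑ i, ⟪W (e i), Y (e i)⟫_ℂ).re + ε := by
    have h1 : ∀ i, (⟪e i, CFC.abs (X + Y) (e i)⟫_ℂ).re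
        ≤ (⟪W (e i), X (e i)⟫_ℂ).re + (⟪W (e i), Y (e i)⟫_ℂ).re + ε / (m + 1) := by
      intro i
      have := hW (e i)
      rw [he.1 i, add_apply, inner_add_right, Complex.add_re] at this
      linarith
    refine (Finset.sum_le_sum fun i _ => h1 i).trans ?_
    rw [Finset.sum_add_distrib, Finset.sum_add_distrib, Complex.re_sum, Complex.re_sum]
    gcongr
    simp only [Finset.sum_const, Finset.card_univ, Fintype.card_fin, nsmul_eq_mul]
    rw [mul_div_assoc', div_le_iff₀ (by positivity)]
    have : (0 : ℝ) ≤ ε := ε.2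
    nlinarith
  have hnn : ∀ i, 0 ≤ (⟪e i, CFC.abs (X + Y) (e i)⟫_ℂ).re := fun i =>
    ((ContinuousLinearMap.nonneg_iff_isPositive _).mp
      (CFC.abs_nonneg (X + Y))).re_inner_nonneg_right _
  rw [← ENNReal.ofReal_sum_of_nonneg fun i _ => hnn i]
  refine (ENNReal.ofReal_le_ofReal key).trans ?_
  refine ENNReal.ofReal_add_le.trans ?_
  rw [ENNReal.ofReal_coe_nnreal]
  gcongr
  refine ENNReal.ofReal_add_le.trans ?_
  gcongr
  · exact enorm_le_tsum_of_hasSum hsX bX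
  · exact enorm_le_tsum_of_hasSum hsY bY

/-- Compression to K does not increase norms and commutes with taking adjoints, so a reproducing
family of K alone is enough. Invariance of K plays no role. -/
theorem traceNorm_restrictTo_add_le {ι : Type*} (K : Submodule ℂ H) [CompleteSpace K]
    (X Y : H →L[ℂ] H) (b : ι → H) (hb1 : ∀ n, ‖b n‖ ≤ 1) (hbK : ∀ n, b n ∈ K)
    (hb : ∀ v ∈ K, HasSum (fun n => ⟪b n, v⟫_ℂ • b n) v) :
    traceNorm (restrictTo K (X + Y)) ≤ ∑' n, ENNReal.ofReal ‖X (b n)‖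
      + ∑' n, ENNReal.ofReal ‖ContinuousLinearMap.adjoint Y (b n)‖ := by
  have h : restrictTo K (X + Y) = restrictTo K X + restrictTo K Y := by
    ext v
    simp [restrictTo]
  have hadj : ContinuousLinearMap.adjoint (restrictTo K Y)
      = restrictTo K (ContinuousLinearMap.adjoint Y) := by
    rw [restrictTo, ContinuousLinearMap.adjoint_comp, ContinuousLinearMap.adjoint_comp,
      Submodule.adjoint_subtypeL, Submodule.adjoint_orthogonalProjectionOnto, restrictTo]
    rfl
  have hle : ∀ (Z : H →L[ℂ] H) (n : ι), ‖restrictTo K Z ⟨b n, hbK n⟩‖ ≤ ‖Z (b n)‖ := by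
    intro Z n
    exact K.norm_orthogonalProjectionOnto_apply_le _
  rw [h]
  refine (traceNorm_add_le (restrictTo K X) (restrictTo K Y) (fun n => ⟨b n, hbK n⟩) hb1
    fun v => ?_).trans ?_
  · have := hb v v.2
    rw [← Topology.IsInducing.subtypeVal.hasSum_iff
      (g := K.subtype) (f := fun n => ⟪(⟨b n, hbK n⟩ : K), v⟫_ℂ • (⟨b n, hbK n⟩ : K)) ]
    exact this
  · rw [hadj]
    gcongr
    · exact hle _ _
    · exact hle _ _

end TraceNorm

/-! ### Fourier coefficients -/

/-- The character `z ↦ exp (i Re (d z̄))` of `ℂ`. -/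
def expChar (d z : ℂ) : ℂ := Complex.exp (((d * conj z).re : ℝ) * Complex.I)

theorem expChar_add_left (d d' z : ℂ) : expChar (d + d') z = expChar d z * expChar d' z := by
  rw [expChar, expChar, expChar, ← Complex.exp_add]
  congr 1
  rw [add_mul, Complex.add_re]
  push_cast
  ring

theorem expChar_add_right (d z z' : ℂ) : expChar d (z + z') = expChar d z * expChar d z' := by
  rw [expChar, expChar, expChar, ← Complex.exp_add]
  congr 1
  rw [map_add, mul_add, Complex.add_re]
  push_cast
  ring

theorem expChar_zero_left (z : ℂ) : expChar 0 z = 1 := by simp [expChar]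

theorem expChar_zero_right (d : ℂ) : expChar d 0 = 1 := by simp [expChar]

theorem norm_expChar (d z : ℂ) : ‖expChar d z‖ = 1 := Complex.norm_exp_ofReal_mul_I _

/-- The real-linear extension of the symbol of `2 D_{z̄}`. -/
def dbarReal (x y : ℝ) : ℂ := (ω ^ 2 * x - ω * y) / (Real.sqrt 3 : ℝ)

/-- The point `4πi (ω s + ω² t)` of `ℂ`. -/
def latticePoint (s t : ℝ) : ℂ := 4 * Real.pi * Complex.I * (ω * s + ω ^ 2 * t)

theorem dbarSymbol_eq (n : Fin 2 → ℤ) : dbarSymbol n = dbarReal (n 0) (n 1) := by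
  simp [dbarSymbol, dbarReal]

theorem sqrt_three_ne_zero : ((Real.sqrt 3 : ℝ) : ℂ) ≠ 0 := by
  exact_mod_cast (Real.sqrt_pos.mpr (by norm_num : (0 : ℝ) < 3)).ne'

/-- This is the duality between the coordinates of z and those of the symbol: it identifies the
Fourier mode n with the character of ℂ whose frequency is the eigenvalue of 2 D_{z̄} on it. -/
theorem re_dbarReal_mul_conj (x y s t : ℝ) :
    (dbarReal x y * conj (latticePoint s t)).re = 2 * Real.pi * (x * s + y * t) := by
  have h3 := ω_pow_three
  have e : dbarReal x y * conj (latticePoint s t)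
      = ((-(4 * Real.pi) / Real.sqrt 3 : ℝ) : ℂ) * (Complex.I * (ω * ((x * s : ℝ) : ℂ)
        + (ω + 1) * ((y * t : ℝ) : ℂ) + ((x * t - y * s : ℝ) : ℂ))) := by
    have hs := sqrt_three_ne_zero
    have h4 : ω ^ 4 = ω := by rw [show (4 : ℕ) = 3 + 1 from rfl, pow_add, h3]; ring
    have h2 : ω + 1 = -ω ^ 2 := by rw [ω_sq_add]; ring
    rw [dbarReal, latticePoint, h2]
    simp only [map_mul, map_add, map_pow, conj_ω, Complex.conj_ofReal, Complex.conj_I, map_ofNat]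
    push_cast
    field_simp
    linear_combination (-(x : ℂ) * s * ω - x * t + y * s + ω ^ 2 * y * t - x * t * ω ^ 3) * h3
  have hpos : (0 : ℝ) < Real.sqrt 3 := Real.sqrt_pos.mpr (by norm_num)
  rw [e, Complex.re_ofReal_mul, ω_eq]
  simp
  field_simp
  ring

theorem expChar_dbarReal (x y s t : ℝ) : expChar (dbarReal x y) (latticePoint s t)
    = Complex.exp (2 * Real.pi * Complex.I * (x * s + y * t)) := by
  rw [expChar, re_dbarReal_mul_conj]
  congr 1
  push_cast
  ring

theorem torusRep_eq (x : Torus) : torusRep x = latticePoint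
    (AddCircle.equivIco (1 : ℝ) 0 (x 0) : ℝ) (AddCircle.equivIco (1 : ℝ) 0 (x 1) : ℝ) := rfl

theorem mFourier_coe (n : Fin 2 → ℤ) (s : Fin 2 → ℝ) :
    UnitAddTorus.mFourier n (fun j => (s j : UnitAddCircle))
      = Complex.exp (2 * Real.pi * Complex.I * (n 0 * s 0 + n 1 * s 1)) := by
  simp only [UnitAddTorus.mFourier, ContinuousMap.coe_mk, Fin.prod_univ_two, fourier_coe_apply]
  rw [← Complex.exp_add]
  congr 1
  push_cast
  ring

theorem mFourier_eq (n : Fin 2 → ℤ) (x : Torus) :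
    UnitAddTorus.mFourier n x = expChar (dbarSymbol n) (torusRep x) := by
  have hx : x = fun j => (((AddCircle.equivIco (1 : ℝ) 0 (x j) : ℝ)) : UnitAddCircle) := by
    funext j
    exact ((AddCircle.equivIco (1 : ℝ) 0).symm_apply_apply (x j)).symm
  rw [torusRep_eq, dbarSymbol_eq, expChar_dbarReal]
  conv_lhs => rw [hx]
  rw [mFourier_coe]
  push_cast
  rfl

theorem norm_mFourier_apply (n : Fin 2 → ℤ) (x : Torus) : ‖UnitAddTorus.mFourier n x‖ = 1 := by
  rw [mFourier_eq, norm_expChar]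

theorem repr_eq_integral (u : L2) (n : Fin 2 → ℤ) :
    fourierBasis.repr u n = ∫ x, UnitAddTorus.mFourier (-n) x * u x ∂torusMeasure :=
  UnitAddTorus.mFourierBasis_repr u n

theorem ext_repr {u v : L2} (h : ∀ n, fourierBasis.repr u n = fourierBasis.repr v n) : u = v :=
  fourierBasis.repr.injective (by ext n; exact h n)

theorem repr_fourierMul (m : (Fin 2 → ℤ) → ℂ) (hm : ∃ C : ℝ, ∀ n, ‖m n‖ ≤ C) (u : L2)
    (n : Fin 2 → ℤ) :
    fourierBasis.repr (fourierMul m hm u) n = m n * fourierBasis.repr u n := by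
  change fourierBasis.repr (fourierBasis.repr.symm _) n = _
  rw [LinearIsometryEquiv.apply_symm_apply]

theorem hasSum_norm_sq_repr (u : L2) : HasSum (fun n => ‖fourierBasis.repr u n‖ ^ 2) (‖u‖ ^ 2) := by
  have h := lp.hasSum_norm (p := 2) (by norm_num) (fourierBasis.repr u)
  simpa using h

theorem norm_repr_le (u : L2) (n : Fin 2 → ℤ) : ‖fourierBasis.repr u n‖ ≤ ‖u‖ := by
  have h := lp.norm_apply_le_norm (p := 2) (by norm_num) (fourierBasis.repr u) n
  simpa using h

/-- Comparison of norms through Fourier coefficients. -/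
theorem norm_le_of_repr_le {u v : L2} {C : ℝ} (hC : 0 ≤ C)
    (h : ∀ n, ‖fourierBasis.repr u n‖ ≤ C * ‖fourierBasis.repr v n‖) : ‖u‖ ≤ C * ‖v‖ := by
  have h1 := hasSum_norm_sq_repr u
  have h2 := (hasSum_norm_sq_repr v).mul_left (C ^ 2)
  have := hasSum_le (fun n => by
    have := h n
    calc ‖fourierBasis.repr u n‖ ^ 2 ≤ (C * ‖fourierBasis.repr v n‖) ^ 2 := by gcongr
      _ = C ^ 2 * ‖fourierBasis.repr v n‖ ^ 2 := by ring) h1 h2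
  rw [← mul_pow] at this
  exact (sq_le_sq₀ (norm_nonneg _) (by positivity)).mp this

theorem inner_eq_tsum (u v : L2) : HasSum
    (fun n => conj (fourierBasis.repr u n) * fourierBasis.repr v n) ⟪u, v⟫_ℂ := by
  have h := fourierBasis.hasSum_inner_mul_inner u v
  refine h.congr_fun fun n => ?_
  rw [fourierBasis.repr_apply_apply, fourierBasis.repr_apply_apply, inner_conj_symm]

theorem coeFn_mulOp (f : C(ℂ, ℂ)) (u : L2) :
    mulOp f u =ᵐ[torusMeasure] fun x => f (torusRep x) * u x := by
  have h1 := (ContinuousLinearMap.lsmul ℂ ℂ).coeFn_holder (μ := torusMeasure) (r := 2)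
    ((torusFun_memLp f).toLp) u
  have h2 := (torusFun_memLp f).coeFn_toLp
  filter_upwards [h1, h2] with x hx1 hx2
  refine hx1.trans ?_
  rw [hx2]
  rfl

theorem integrable_L2 (u : L2) : Integrable u torusMeasure :=
  (Lp.memLp u).integrable (by norm_num)

theorem mFourier_sub_apply (n m : Fin 2 → ℤ) (x : Torus) : UnitAddTorus.mFourier (n - m) x
    = UnitAddTorus.mFourier n x * UnitAddTorus.mFourier (-m) x := by
  rw [sub_eq_add_neg, UnitAddTorus.mFourier_add]

/-- Multiplication by an absolutely convergent Fourier series is convolution with its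
coefficients. -/
theorem hasSum_repr_mulOp {ι : Type*} [Countable ι] (f : C(ℂ, ℂ)) {a : ι → ℂ}
    (p : ι → Fin 2 → ℤ) (ha : Summable fun n => ‖a n‖)
    (hf : ∀ x : Torus, HasSum (fun n => a n * UnitAddTorus.mFourier (p n) x) (f (torusRep x)))
    (u : L2) (m : Fin 2 → ℤ) :
    HasSum (fun n => a n * fourierBasis.repr u (m - p n)) (fourierBasis.repr (mulOp f u) m) := by
  have hint : ∀ n, Integrable (fun x => a n * (UnitAddTorus.mFourier (p n - m) x * u x))
      torusMeasure := fun n =>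
    ((integrable_L2 u).bdd_mul (c := 1)
      (UnitAddTorus.mFourier (p n - m)).continuous.measurable.aestronglyMeasurable
      (Filter.Eventually.of_forall fun x => (norm_mFourier_apply _ x).le)).const_mul _
  have h := hasSum_integral_of_summable_integral_norm hint (by
    simp only [norm_mul, norm_mFourier_apply, one_mul, integral_const_mul]
    exact ha.mul_right _)
  have e : ∫ x, ∑' n, a n * (UnitAddTorus.mFourier (p n - m) x * u x) ∂torusMeasure
      = fourierBasis.repr (mulOp f u) m := by
    rw [repr_eq_integral]
    refine integral_congr_ae ?_
    filter_upwards [coeFn_mulOp f u] with x hx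
    rw [hx]
    refine HasSum.tsum_eq ?_
    rw [show UnitAddTorus.mFourier (-m) x * (f (torusRep x) * u x)
      = f (torusRep x) * (UnitAddTorus.mFourier (-m) x * u x) by ring]
    refine ((hf x).mul_right (UnitAddTorus.mFourier (-m) x * u x)).congr_fun fun n => ?_
    rw [mFourier_sub_apply]
    ring
  rw [e] at h
  refine h.congr_fun fun n => ?_
  rw [integral_const_mul, repr_eq_integral, neg_sub]

theorem repr_star (u : L2) (n : Fin 2 → ℤ) :
    fourierBasis.repr (star u) n = conj (fourierBasis.repr u (-n)) := by
  rw [repr_eq_integral, repr_eq_integral, ← integral_conj]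
  refine integral_congr_ae ?_
  filter_upwards [Lp.coeFn_star u] with x hx
  rw [hx, Pi.star_apply, map_mul, neg_neg, UnitAddTorus.mFourier_neg]
  rfl

theorem mFourier_add_apply (n : Fin 2 → ℤ) (x y : Torus) : UnitAddTorus.mFourier n (x + y)
    = UnitAddTorus.mFourier n x * UnitAddTorus.mFourier n y := by
  simp only [UnitAddTorus.mFourier, ContinuousMap.coe_mk, Pi.add_apply, fourier_apply, smul_add,
    AddCircle.toCircle_add, Circle.coe_mul, Finset.prod_mul_distrib]

/-- The Fourier coefficients of a translate. -/
theorem integral_mFourier_translate (f : Torus → ℂ) (n : Fin 2 → ℤ) (s : Torus) :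
    ∫ x, UnitAddTorus.mFourier (-n) x * f (x + s) ∂torusMeasure
      = UnitAddTorus.mFourier n s * ∫ x, UnitAddTorus.mFourier (-n) x * f x ∂torusMeasure := by
  rw [← integral_add_right_eq_self (μ := torusMeasure)
    (fun x => UnitAddTorus.mFourier (-n) x * f x) s, ← integral_const_mul]
  refine integral_congr_ae (Filter.Eventually.of_forall fun x => ?_)
  have h : UnitAddTorus.mFourier n s * UnitAddTorus.mFourier (-n) s = 1 := by
    rw [← UnitAddTorus.mFourier_add, add_neg_cancel, UnitAddTorus.mFourier_zero]; rfl
  simp only [mFourier_add_apply]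
  linear_combination (-UnitAddTorus.mFourier (-n) x * f (x + s)) * h

theorem mFourier_shiftPoint (n a : Fin 2 → ℤ) :
    UnitAddTorus.mFourier n (shiftPoint a) = ω ^ (n 0 * a 0 + n 1 * a 1) := by
  refine (mFourier_coe n fun j => (a j : ℝ) / 3).trans ?_
  rw [ω, ← Complex.exp_int_mul]
  congr 1
  push_cast
  ring

theorem repr_translation (a : Fin 2 → ℤ) (u : L2) (n : Fin 2 → ℤ) :
    fourierBasis.repr (translation a u) n
      = ω ^ (n 0 * a 0 + n 1 * a 1) * fourierBasis.repr u n := by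
  rw [repr_eq_integral, repr_eq_integral, ← mFourier_shiftPoint, ← integral_mFourier_translate]
  refine integral_congr_ae ?_
  filter_upwards [Lp.coeFn_compMeasurePreserving u
    (measurePreserving_add_right torusMeasure (shiftPoint a))] with x hx
  congr 1

/-! ### Reduced spaces as residue classes of Fourier modes -/

theorem matOp_apply (M : Matrix (Fin 2) (Fin 2) (L2 →L[ℂ] L2)) (u : L2Two) (i : Fin 2) :
    matOp M u i = M i 0 (u 0) + M i 1 (u 1) := by
  simp [matOp, Fin.sum_univ_two]

theorem diagOp_apply (X : L2 →L[ℂ] L2) (u : L2Two) (i : Fin 2) : diagOp X u i = X (u i) := by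
  rw [diagOp, matOp_apply]
  fin_cases i <;> simp

theorem ω_zpow_eq_one_iff (k : ℤ) : ω ^ k = 1 ↔ (3 : ℤ) ∣ k := by
  have hp : IsPrimitiveRoot ω 3 := by
    have := Complex.isPrimitiveRoot_exp 3 (by norm_num)
    simpa [ω] using this
  simpa using hp.zpow_eq_one_iff_dvd k

/-- Translation by a multiplies the mode n by ω^{n·a}; testing with the two generators kills every
mode outside 3ℤ². -/
theorem mem_reducedL2_iff (u : L2) : u ∈ reducedL2 ↔
    ∀ n, ¬ (3 ∣ n 0 ∧ 3 ∣ n 1) → fourierBasis.repr u n = 0 := by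
  have key : u ∈ reducedL2 ↔ ∀ a n : Fin 2 → ℤ, ω ^ (n 0 * a 0 + n 1 * a 1) * fourierBasis.repr u n
      = fourierBasis.repr u n := by
    simp only [reducedL2, Submodule.mem_iInf]
    refine forall_congr' fun a => ?_
    have : u ∈ (translation a - 1).ker ↔ translation a u = u := by
      change (translation a - 1) u = 0 ↔ _
      rw [sub_apply, one_apply_eq_self, sub_eq_zero]
    rw [this]
    refine ⟨fun h n => ?_, fun h => ext_repr fun n => ?_⟩
    · rw [← repr_translation, h]
    · rw [repr_translation, h]
  rw [key]
  refine ⟨fun h n hn => ?_, fun h a n => ?_⟩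
  · by_contra hne
    refine hn ⟨?_, ?_⟩
    · have := h ![1, 0] n
      rw [mul_eq_right₀ hne, ω_zpow_eq_one_iff] at this
      simpa using this
    · have := h ![0, 1] n
      rw [mul_eq_right₀ hne, ω_zpow_eq_one_iff] at this
      simpa using this
  · by_cases hn : 3 ∣ n 0 ∧ 3 ∣ n 1
    · rw [(ω_zpow_eq_one_iff _).mpr (dvd_add (hn.1.mul_right _) (hn.2.mul_right _)), one_mul]
    · rw [h n hn, mul_zero]

/-- The residue class mod `3` of the Fourier modes of the `i`-th component of elements of
`L²₀(ℂ/Γ; ℂ²)`. -/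
def residue (i : Fin 2) : ℤ := if i = 0 then -1 else 0

/-- The extra factor ω^{a₀+a₁} on the first component moves its admissible residue class from 0 to
-1; the second component is unaffected. -/
theorem mem_reducedL2Two_iff (u : L2Two) : u ∈ reducedL2Two ↔
    ∀ i n, ¬ (3 ∣ n 0 - residue i ∧ 3 ∣ n 1 - residue i) → fourierBasis.repr (u i) n = 0 := by
  have key : u ∈ reducedL2Two ↔ ∀ (a : Fin 2 → ℤ) i (n : Fin 2 → ℤ),
      ω ^ ((n 0 - residue i) * a 0 + (n 1 - residue i) * a 1) * fourierBasis.repr (u i) n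
      = fourierBasis.repr (u i) n := by
    simp only [reducedL2Two, Submodule.mem_iInf]
    refine forall_congr' fun a => ?_
    have h1 : u ∈ (translationTwo a - 1).ker ↔ translationTwo a u = u := by
      change (translationTwo a - 1) u = 0 ↔ _
      rw [sub_apply, one_apply_eq_self, sub_eq_zero]
    have hω : ω ≠ 0 := Complex.exp_ne_zero _
    have h2 : ∀ i n, fourierBasis.repr (translationTwo a u i) n
        = ω ^ ((n 0 - residue i) * a 0 + (n 1 - residue i) * a 1)
          * fourierBasis.repr (u i) n := by
      intro i n
      rw [translationTwo, matOp_apply]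
      fin_cases i
      · simp [residue]
        rw [repr_translation, ← mul_assoc, ← zpow_add₀ hω]
        congr 2
        ring
      · simp [residue]
        rw [repr_translation]
    rw [h1]
    refine ⟨fun h i n => ?_, fun h => ?_⟩
    · rw [← h2, h]
    · ext1 i
      exact ext_repr fun n => by rw [h2, h]
  rw [key]
  refine ⟨fun h i n hn => ?_, fun h a i n => ?_⟩
  · by_contra hne
    refine hn ⟨?_, ?_⟩
    · have := h ![1, 0] i n
      rw [mul_eq_right₀ hne, ω_zpow_eq_one_iff] at this
      simpa using this
    · have := h ![0, 1] i n
      rw [mul_eq_right₀ hne, ω_zpow_eq_one_iff] at this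
      simpa using this
  · by_cases hn : 3 ∣ n 0 - residue i ∧ 3 ∣ n 1 - residue i
    · rw [(ω_zpow_eq_one_iff _).mpr (dvd_add (hn.1.mul_right _) (hn.2.mul_right _)), one_mul]
    · rw [h i n hn, mul_zero]

/-! ### The standard potential and the operator `B` in Fourier space -/

/-- The Fourier modes of the standard potential. -/
def hopVec : Fin 3 → Fin 2 → ℤ := ![![-1, -1], ![2, -1], ![-1, 2]]

/-- The exponent (zω̄^k - z̄ω^k)/2 equals i Re(iω^k z̄), so the k-th term of U₀ is the Fourier mode
with symbol iω^k. -/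
theorem dbarSymbol_hopVec (k : Fin 3) : dbarSymbol (hopVec k) = Complex.I * ω ^ (k : ℕ) := by
  have h3 : ((Real.sqrt 3 : ℝ) : ℂ) * ((Real.sqrt 3 : ℝ) : ℂ) = 3 := by
    rw [← Complex.ofReal_mul, Real.mul_self_sqrt (by norm_num)]; norm_num
  have hω : ω - ω ^ 2 = Complex.I * (Real.sqrt 3 : ℝ) := by
    rw [ω_sq_add, ω_eq]; push_cast; ring
  have hp := ω_pow_three
  have h2 := ω_sq_add
  rw [dbarSymbol, div_eq_iff sqrt_three_ne_zero, mul_right_comm, ← hω]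
  fin_cases k
  · simp [hopVec]; ring
  · simp [hopVec]; linear_combination hp + h2
  · simp [hopVec]; linear_combination (ω - 1) * hp - h2

theorem standardFun_torusRep (x : Torus) : standardFun (torusRep x)
    = ∑ k : Fin 3, ω ^ (k : ℕ) * UnitAddTorus.mFourier (hopVec k) x := by
  rw [standardFun, Finset.sum_range]
  refine Finset.sum_congr rfl fun k _ => ?_
  rw [mFourier_eq, dbarSymbol_hopVec, expChar]
  congr 2
  rw [Complex.re_eq_add_conj]
  simp only [map_mul, map_pow, Complex.conj_I, Complex.conj_conj]
  linear_combination ((torusRep x) * conj ω ^ (k : ℕ) - conj (torusRep x) * ω ^ (k : ℕ)) / 2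
    * Complex.I_sq

theorem standardFun_neg_torusRep (x : Torus) : standardFun (-torusRep x)
    = ∑ k : Fin 3, ω ^ (k : ℕ) * UnitAddTorus.mFourier (-hopVec k) x := by
  rw [standardFun, Finset.sum_range]
  refine Finset.sum_congr rfl fun k _ => ?_
  rw [UnitAddTorus.mFourier_neg, mFourier_eq, dbarSymbol_hopVec, expChar, ← Complex.exp_conj]
  congr 2
  rw [map_mul, Complex.conj_I, Complex.conj_ofReal, Complex.re_eq_add_conj]
  simp only [map_mul, map_pow, Complex.conj_I, Complex.conj_conj, map_neg]
  linear_combination (-(torusRep x) * conj ω ^ (k : ℕ) + conj (torusRep x) * ω ^ (k : ℕ)) / 2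
    * Complex.I_sq

/-- `Q` is a sum of three weighted shifts along `-σ` times the hopping vectors. -/
def IsHop (σ : ℤ) (Q : L2 →L[ℂ] L2) : Prop :=
  ∃ c : Fin 3 → ℂ, (∀ k, ‖c k‖ ≤ 1) ∧ ∀ u m, fourierBasis.repr (Q u) m
    = (Real.sqrt 3 : ℝ) * ∑ k, c k * fourierBasis.repr u (m + σ • hopVec k)

/-- `M` is a Fourier multiplier with a symbol of the size of that of `𝒟⁻¹`. -/
def IsInvMul (M : L2 →L[ℂ] L2) : Prop :=
  ∃ μ : (Fin 2 → ℤ) → ℂ, (∀ m, ‖μ m‖ = ‖calDSymbol (1 / 2) 0 m‖⁻¹) ∧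
    ∀ u m, fourierBasis.repr (M u) m = μ m * fourierBasis.repr u m

theorem norm_ω_pow (k : ℕ) : ‖ω ^ k‖ = 1 := by rw [norm_pow, norm_ω, one_pow]

theorem isHop_calVPlus : IsHop (-1) calVPlus := by
  refine ⟨fun k => ω ^ (k : ℕ), fun k => (norm_ω_pow _).le, fun u m => ?_⟩
  have h := hasSum_repr_mulOp standardPotential.plus (a := fun k : Fin 3 => ω ^ (k : ℕ)) hopVec
    (Summable.of_finite) (fun x => by
      have := hasSum_fintype (fun k : Fin 3 => ω ^ (k : ℕ) * UnitAddTorus.mFourier (hopVec k) x)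
      rw [← standardFun_torusRep] at this
      exact this) u m
  have h' := h.unique (hasSum_fintype _)
  have e : calVPlus u = ((Real.sqrt 3 : ℝ) : ℂ) • mulOp standardPotential.plus u := rfl
  rw [e, map_smul, lp.coeFn_smul, Pi.smul_apply, smul_eq_mul, h']
  simp [sub_eq_add_neg]

theorem isHop_calVMinus : IsHop 1 calVMinus := by
  refine ⟨fun k => ω ^ (k : ℕ), fun k => (norm_ω_pow _).le, fun u m => ?_⟩
  have h := hasSum_repr_mulOp standardPotential.minus (a := fun k : Fin 3 => ω ^ (k : ℕ))
    (fun k => -hopVec k) (Summable.of_finite) (fun x => by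
      have := hasSum_fintype (fun k : Fin 3 => ω ^ (k : ℕ) * UnitAddTorus.mFourier (-hopVec k) x)
      rw [← standardFun_neg_torusRep] at this
      exact this) u m
  have h' := h.unique (hasSum_fintype _)
  have e : calVMinus u = ((Real.sqrt 3 : ℝ) : ℂ) • mulOp standardPotential.minus u := rfl
  rw [e, map_smul, lp.coeFn_smul, Pi.smul_apply, smul_eq_mul, h']
  simp

theorem repr_basis (n m : Fin 2 → ℤ) :
    fourierBasis.repr (fourierBasis n) m = if m = n then 1 else 0 := by
  classical
  rw [HilbertBasis.repr_self, lp.single_apply, Pi.single_apply]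

theorem isHop_apply_basis {σ : ℤ} {Q : L2 →L[ℂ] L2} {c : Fin 3 → ℂ}
    (hQ : ∀ u m, fourierBasis.repr (Q u) m
      = (Real.sqrt 3 : ℝ) * ∑ k, c k * fourierBasis.repr u (m + σ • hopVec k))
    (n : Fin 2 → ℤ) :
    Q (fourierBasis n) = ∑ k, ((Real.sqrt 3 : ℝ) * c k) • fourierBasis (n - σ • hopVec k) := by
  refine ext_repr fun m => ?_
  rw [hQ, map_sum, lp.coeFn_sum, Finset.sum_apply, Finset.mul_sum]
  refine Finset.sum_congr rfl fun k _ => ?_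
  rw [map_smul, lp.coeFn_smul, Pi.smul_apply, smul_eq_mul, repr_basis, repr_basis, ← mul_assoc]
  simp only [eq_sub_iff_add_eq]

/-- Taking adjoints reverses the hops and conjugates the weights. Since `IsHop` and `IsInvMul` only
record sizes, B* obeys the same kind of estimates, with its factors in the opposite order. -/
theorem IsHop.adjoint {σ : ℤ} {Q : L2 →L[ℂ] L2} (hQ : IsHop σ Q) :
    IsHop (-σ) (ContinuousLinearMap.adjoint Q) := by
  obtain ⟨c, hc, hQ⟩ := hQ
  refine ⟨fun k => conj (c k), fun k => by rw [RCLike.norm_conj]; exact hc k, fun u m => ?_⟩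
  rw [fourierBasis.repr_apply_apply, ContinuousLinearMap.adjoint_inner_right,
    isHop_apply_basis hQ, sum_inner, Finset.mul_sum]
  refine Finset.sum_congr rfl fun k _ => ?_
  rw [inner_smul_left, ← fourierBasis.repr_apply_apply, map_mul, Complex.conj_ofReal, mul_assoc,
    neg_smul, sub_eq_add_neg]

theorem isInvMul_calDInv : IsInvMul (calDInv (1 / 2) 0) :=
  ⟨fun m => (calDSymbol (1 / 2) 0 m)⁻¹, fun _ => norm_inv _, fun u m => repr_fourierMul _ _ u m⟩

theorem IsInvMul.adjoint {M : L2 →L[ℂ] L2} (hM : IsInvMul M) :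
    IsInvMul (ContinuousLinearMap.adjoint M) := by
  obtain ⟨μ, hμ, hM⟩ := hM
  refine ⟨fun m => conj (μ m), fun m => by rw [RCLike.norm_conj, hμ], fun u m => ?_⟩
  have e : M (fourierBasis m) = μ m • fourierBasis m := by
    refine ext_repr fun n => ?_
    rw [hM, map_smul, lp.coeFn_smul, Pi.smul_apply, smul_eq_mul, repr_basis]
    split_ifs with h
    · rw [h]
    · simp
  rw [fourierBasis.repr_apply_apply, ContinuousLinearMap.adjoint_inner_right, e, inner_smul_left,
    ← fourierBasis.repr_apply_apply]

theorem B_eq : B = calDInv (1 / 2) 0 * calVPlus * calDInv (1 / 2) 0 * calVMinus := by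
  rw [B, A, smul_smul]
  norm_num

/-! ### Localization in Fourier space -/

/-- The modes of sup-norm at least `r`. -/
def farModes (r : ℤ) : Set (Fin 2 → ℤ) := {m | ∃ j, r ≤ |m j|}

/-- The Fourier coefficients of `u` are supported in `S`. -/
def SuppIn (S : Set (Fin 2 → ℤ)) (u : L2) : Prop := ∀ m ∉ S, fourierBasis.repr u m = 0

/-- The form a² + ab + b² is at least (3/4) max(a², b²), by completing the square. Here a = m₀ + 1/2
and b = m₁, so the half-integer shift costs at most 1/2 in r. -/
theorem norm_calDSymbol_ge {r : ℤ} (hr : 1 ≤ r) {m : Fin 2 → ℤ} (hm : m ∈ farModes r) :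
    Real.sqrt 3 / 2 * (r - 1 / 2) ≤ ‖calDSymbol (1 / 2) 0 m‖ := by
  have h := normSq_ω_comb (m 0 + 1 / 2) (m 1)
  have e : ‖calDSymbol (1 / 2) 0 m‖ ^ 2
      = ((m 0 : ℝ) + 1 / 2) ^ 2 + ((m 0 : ℝ) + 1 / 2) * m 1 + (m 1 : ℝ) ^ 2 := by
    rw [← h, calDSymbol]
    push_cast
    simp
  have hr' : (1 : ℝ) ≤ r := by exact_mod_cast hr
  refine (sq_le_sq₀ (mul_nonneg (by positivity) (by linarith)) (norm_nonneg _)).mp ?_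
  rw [e, mul_pow, div_pow, Real.sq_sqrt (by norm_num)]
  obtain ⟨j, hj⟩ := hm
  have hj' : (r : ℝ) ≤ |(m j : ℝ)| := by exact_mod_cast hj
  have hsq : ∀ t : ℝ, r - 1 / 2 ≤ |t| → ((r : ℝ) - 1 / 2) ^ 2 ≤ t ^ 2 := fun t ht => by
    rw [← sq_abs t]
    exact pow_le_pow_left₀ (by linarith) ht 2
  fin_cases j
  · have h1 := hsq ((m 0 : ℝ) + 1 / 2) (by
      have := abs_sub_abs_le_abs_sub ((m 0 : ℝ)) (-(1 / 2))
      rw [abs_neg, abs_of_pos (by norm_num : (0 : ℝ) < 1 / 2), sub_neg_eq_add] at this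
      simp only [Fin.zero_eta] at hj'
      linarith)
    nlinarith [sq_nonneg ((m 0 : ℝ) + 1 / 2 + 2 * m 1)]
  · have h1 := hsq (m 1 : ℝ) (by simp only [Fin.mk_one] at hj'; linarith)
    nlinarith [sq_nonneg (2 * ((m 0 : ℝ) + 1 / 2) + m 1)]

theorem norm_calDSymbol_inv_le {r : ℤ} (hr : 1 ≤ r) {m : Fin 2 → ℤ} (hm : m ∈ farModes r) :
    ‖calDSymbol (1 / 2) 0 m‖⁻¹ ≤ 2 / Real.sqrt 3 / (r - 1 / 2) := by
  have hr' : (1 : ℝ) ≤ r := by exact_mod_cast hr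
  have h3 : (0 : ℝ) < Real.sqrt 3 := Real.sqrt_pos.mpr (by norm_num)
  have h := norm_calDSymbol_ge hr hm
  have hpos : 0 < Real.sqrt 3 / 2 * (r - 1 / 2) := mul_pos (by positivity) (by linarith)
  refine (inv_anti₀ hpos h).trans (le_of_eq ?_)
  have : (r : ℝ) - 1 / 2 ≠ 0 := by linarith
  field_simp

theorem hopVec_abs_le (k : Fin 3) (j : Fin 2) : |hopVec k j| ≤ 2 := by
  revert k j; decide

/-- One application of B makes two hops with opposite signs. Together they change a coordinate by at
most 3, rather than the 4 that two single hops would allow, so the sup-norm drops by at most 3 per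
factor B. -/
theorem hopVec_sub_abs_le (k l : Fin 3) (j : Fin 2) : |hopVec k j - hopVec l j| ≤ 3 := by
  revert k l j; decide

theorem farModes_hop {r : ℤ} {m v : Fin 2 → ℤ} {d : ℤ} (hv : ∀ j, |v j| ≤ d)
    (h : m + v ∈ farModes r) : m ∈ farModes (r - d) := by
  obtain ⟨j, hj⟩ := h
  refine ⟨j, ?_⟩
  have := abs_add_le (m j) (v j)
  have := hv j
  simp only [Pi.add_apply] at hj
  linarith

/-- Each of the three shifts is an isometry on Fourier coefficients; Cauchy–Schwarz over the three
terms and the prefactor √3 give 3√3. -/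
theorem IsHop.norm_le {σ : ℤ} {Q : L2 →L[ℂ] L2} (hQ : IsHop σ Q) (u : L2) :
    ‖Q u‖ ≤ 3 * Real.sqrt 3 * ‖u‖ := by
  obtain ⟨c, hc, hQ⟩ := hQ
  refine (sq_le_sq₀ (norm_nonneg _) (by positivity)).mp ?_
  rw [mul_pow, mul_pow, Real.sq_sqrt (by norm_num)]
  have h1 := hasSum_norm_sq_repr (Q u)
  have h2 : ∀ k : Fin 3, HasSum (fun m => ‖fourierBasis.repr u (m + σ • hopVec k)‖ ^ 2)
      (‖u‖ ^ 2) := fun k =>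
    (Equiv.addRight (σ • hopVec k)).hasSum_iff.mpr (hasSum_norm_sq_repr u)
  have h3 := (hasSum_sum (s := Finset.univ) fun k _ => h2 k).mul_left 9
  have := hasSum_le (fun m => ?_) h1 h3
  · rw [Finset.sum_const, Finset.card_univ, Fintype.card_fin, nsmul_eq_mul] at this
    push_cast at this
    linarith
  · rw [hQ, norm_mul, mul_pow, Complex.norm_real, Real.norm_of_nonneg (Real.sqrt_nonneg _),
      Real.sq_sqrt (by norm_num)]
    have h4 : ‖∑ k, c k * fourierBasis.repr u (m + σ • hopVec k)‖
        ≤ ∑ k, ‖fourierBasis.repr u (m + σ • hopVec k)‖ := by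
      refine (norm_sum_le _ _).trans (Finset.sum_le_sum fun k _ => ?_)
      rw [norm_mul]
      exact mul_le_of_le_one_left (norm_nonneg _) (hc k)
    have h5 := sq_sum_le_card_mul_sum_sq (s := Finset.univ)
      (f := fun k => ‖fourierBasis.repr u (m + σ • hopVec k)‖)
    rw [Finset.card_univ, Fintype.card_fin] at h5
    push_cast at h5
    have h6 := pow_le_pow_left₀ (norm_nonneg _) h4 2
    linarith

theorem IsInvMul.norm_le {M : L2 →L[ℂ] L2} (hM : IsInvMul M) {r : ℤ} (hr : 1 ≤ r) {u : L2}
    (hu : SuppIn (farModes r) u) : ‖M u‖ ≤ 2 / Real.sqrt 3 / (r - 1 / 2) * ‖u‖ := by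
  obtain ⟨μ, hμ, hM⟩ := hM
  have hr' : (1 : ℝ) ≤ r := by exact_mod_cast hr
  refine norm_le_of_repr_le (div_nonneg (by positivity) (by linarith)) fun n => ?_
  rw [hM, norm_mul, hμ]
  by_cases hn : n ∈ farModes r
  · exact mul_le_mul_of_nonneg_right (norm_calDSymbol_inv_le hr hn) (norm_nonneg _)
  · rw [hu n hn]; simp

theorem IsInvMul.suppIn {M : L2 →L[ℂ] L2} (hM : IsInvMul M) {S : Set (Fin 2 → ℤ)} {u : L2}
    (hu : SuppIn S u) : SuppIn S (M u) := by
  obtain ⟨μ, -, hM⟩ := hM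
  intro n hn
  rw [hM, hu n hn, mul_zero]

theorem IsHop.suppIn {σ : ℤ} {Q : L2 →L[ℂ] L2} (hQ : IsHop σ Q) {S T : Set (Fin 2 → ℤ)} {u : L2}
    (hu : SuppIn S u) (h : ∀ m k, m + σ • hopVec k ∈ S → m ∈ T) : SuppIn T (Q u) := by
  obtain ⟨c, -, hQ⟩ := hQ
  intro n hn
  rw [hQ, Finset.sum_eq_zero, mul_zero]
  intro k _
  rw [hu _ fun hk => hn (h n k hk), mul_zero]

/-- The modes reached from `farModes r` by one hop. -/
def hopModes (r : ℤ) : Set (Fin 2 → ℤ) := {m | ∃ k, m + hopVec k ∈ farModes r}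

theorem hopModes_subset (r : ℤ) : hopModes r ⊆ farModes (r - 2) := fun _ ⟨k, hk⟩ =>
  farModes_hop (hopVec_abs_le k) hk

theorem farModes_of_hopModes {r : ℤ} {m : Fin 2 → ℤ} {k : Fin 3}
    (h : m + (-1 : ℤ) • hopVec k ∈ hopModes r) : m ∈ farModes (r - 3) := by
  obtain ⟨l, hl⟩ := h
  refine farModes_hop (v := (-1 : ℤ) • hopVec k + hopVec l) (fun j => ?_) (by rwa [← add_assoc])
  have := hopVec_sub_abs_le l k j
  simpa [neg_add_eq_sub] using this

theorem SuppIn.mono {S T : Set (Fin 2 → ℤ)} (h : S ⊆ T) {u : L2} (hu : SuppIn S u) :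
    SuppIn T u := fun m hm => hu m fun hS => hm (h hS)

/-- The estimates for `B` and `B*` away from the low Fourier modes. -/
structure FarBound (X : L2 →L[ℂ] L2) : Prop where
  norm_le : ∀ r : ℤ, 4 ≤ r → ∀ u, SuppIn (farModes r) u →
    ‖X u‖ ≤ 36 / ((r - 5 / 2) * (r - 7 / 2)) * ‖u‖
  suppIn : ∀ r : ℤ, ∀ u, SuppIn (farModes r) u → SuppIn (farModes (r - 3)) (X u)
  norm_basis_le : ∀ r : ℤ, 4 ≤ r → ∀ n ∈ farModes r,
    ‖X (fourierBasis n)‖ ≤ 4 * Real.sqrt 15 / ((r - 5 / 2) * (r - 7 / 2))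

/-- In the expanded square only pairs of indices with coinciding modes survive. Counting these
replaces the number of terms by the square root of the number of coincidences. -/
theorem norm_sum_smul_basis_le {ι : Type*} [Fintype ι] (a : ι → ℂ) (p : ι → Fin 2 → ℤ) {K : ℝ}
    (hK : 0 ≤ K) (ha : ∀ i, ‖a i‖ ≤ K) {N : ℕ}
    (hN : (Finset.univ.filter fun q : ι × ι => p q.1 = p q.2).card ≤ N) :
    ‖∑ i, a i • fourierBasis (p i)‖ ≤ K * Real.sqrt N := by
  refine (sq_le_sq₀ (norm_nonneg _) (by positivity)).mp ?_
  rw [mul_pow, Real.sq_sqrt (by positivity)]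
  have h : ((‖∑ i, a i • fourierBasis (p i)‖ : ℂ)) ^ 2
      = ∑ q : ι × ι, conj (a q.1) * a q.2 * if p q.1 = p q.2 then 1 else 0 := by
    have := inner_self_eq_norm_sq_to_K (𝕜 := ℂ) (∑ i, a i • fourierBasis (p i))
    refine Eq.trans this.symm ?_
    rw [sum_inner, Fintype.sum_prod_type]
    refine Finset.sum_congr rfl fun i _ => ?_
    rw [inner_sum]
    refine Finset.sum_congr rfl fun j _ => ?_
    rw [inner_smul_left, inner_smul_right,
      orthonormal_iff_ite.mp fourierBasis.orthonormal, mul_assoc]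
  have h' : ‖∑ i, a i • fourierBasis (p i)‖ ^ 2
      = ‖∑ q : ι × ι, conj (a q.1) * a q.2 * if p q.1 = p q.2 then 1 else 0‖ := by
    rw [← h, norm_pow, Complex.norm_real, norm_norm]
  rw [h']
  calc _ ≤ ∑ q : ι × ι, K ^ 2 * if p q.1 = p q.2 then 1 else 0 := by
        refine (norm_sum_le _ _).trans (Finset.sum_le_sum fun q _ => ?_)
        rw [norm_mul, norm_mul, RCLike.norm_conj, sq]
        have : ‖(if p q.1 = p q.2 then 1 else 0 : ℂ)‖ = if p q.1 = p q.2 then 1 else 0 := by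
          split_ifs <;> simp
        rw [this]
        gcongr
        · exact ha _
        · exact ha _
    _ = K ^ 2 * ((Finset.univ.filter fun q : ι × ι => p q.1 = p q.2).card : ℝ) := by
        rw [← Finset.mul_sum, Finset.sum_boole]
    _ ≤ _ := by gcongr

/-- The six nonzero differences of hopping vectors are distinct and the zero difference occurs three
times: 6 + 3² = 15. -/
theorem card_hop_pairs : (Finset.univ.filter fun q : (Fin 3 × Fin 3) × (Fin 3 × Fin 3) =>
    hopVec q.1.1 - hopVec q.1.2 = hopVec q.2.1 - hopVec q.2.2).card = 15 := by
  decide +kernel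

theorem inv_mul_basis {M : L2 →L[ℂ] L2} {μ : (Fin 2 → ℤ) → ℂ}
    (hM : ∀ u m, fourierBasis.repr (M u) m = μ m * fourierBasis.repr u m) (n : Fin 2 → ℤ) :
    M (fourierBasis n) = μ n • fourierBasis n := by
  refine ext_repr fun m => ?_
  rw [hM, map_smul, lp.coeFn_smul, Pi.smul_apply, smul_eq_mul, repr_basis]
  split_ifs with h
  · rw [h]
  · simp

/-- A double hop with weights `w` at the end point and intermediate point of size at most `K`. -/
theorem norm_double_hop_le (n : Fin 2 → ℤ) (c c' : Fin 3 → ℂ) (hc : ∀ k, ‖c k‖ ≤ 1)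
    (hc' : ∀ k, ‖c' k‖ ≤ 1) (w : Fin 3 → Fin 3 → ℂ) {K : ℝ} (hK : 0 ≤ K)
    (hw : ∀ j k, ‖w j k‖ ≤ K) :
    ‖∑ k, ∑ j, (((Real.sqrt 3 : ℝ) * c' k) * (((Real.sqrt 3 : ℝ) * c j) * w j k)) •
      fourierBasis (n - (1 : ℤ) • hopVec k - (-1 : ℤ) • hopVec j)‖
      ≤ 3 * K * Real.sqrt 15 := by
  have h := norm_sum_smul_basis_le
    (fun q : Fin 3 × Fin 3 => ((Real.sqrt 3 : ℝ) * c' q.2) * (((Real.sqrt 3 : ℝ) * c q.1)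
      * w q.1 q.2))
    (fun q => n - (1 : ℤ) • hopVec q.2 - (-1 : ℤ) • hopVec q.1) (K := 3 * K) (by positivity)
    (fun q => by
      have h3 : Real.sqrt 3 * Real.sqrt 3 = 3 := Real.mul_self_sqrt (by norm_num)
      simp only [norm_mul, Complex.norm_real, Real.norm_of_nonneg (Real.sqrt_nonneg _)]
      calc _ = (Real.sqrt 3 * Real.sqrt 3) * (‖c' q.2‖ * ‖c q.1‖ * ‖w q.1 q.2‖) := by ring
        _ ≤ 3 * (1 * 1 * K) := by
          rw [h3]
          have := hc' q.2
          have := hc q.1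
          have := hw q.1 q.2
          gcongr
        _ = 3 * K := by ring)
    (N := 15) (by
      rw [← card_hop_pairs]
      refine Finset.card_le_card fun q hq => ?_
      simp only [Finset.mem_filter, Finset.mem_univ, true_and] at hq ⊢
      have := congrArg (fun v => v - n) hq
      simp only [one_smul, neg_smul] at this
      rw [sub_eq_sub_iff_add_eq_add] at this ⊢
      funext i
      have := congrFun this i
      simp only [Pi.add_apply, Pi.sub_apply, Pi.neg_apply] at this ⊢
      linarith)
  rw [Fintype.sum_prod_type, Finset.sum_comm] at h
  exact_mod_cast h

/-- The inverses act after one hop (sup-norm at least r - 2) and after two (at least r - 3), which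
gives the denominators r - 5/2 and r - 7/2. The constants are (3√3)²(2/√3)² = 36 for general
functions and 3 · (2/√3)² · √15 = 4√15 for a single mode. -/
theorem farBound_of_inv_hop_inv_hop {M Q Q' : L2 →L[ℂ] L2} (hM : IsInvMul M) (hQ : IsHop (-1) Q)
    (hQ' : IsHop 1 Q') : FarBound (M * Q * M * Q') := by
  have h3 : Real.sqrt 3 * Real.sqrt 3 = 3 := Real.mul_self_sqrt (by norm_num)
  have h3' : (0 : ℝ) < Real.sqrt 3 := Real.sqrt_pos.mpr (by norm_num)
  have supp : ∀ r : ℤ, ∀ u, SuppIn (farModes r) u → SuppIn (hopModes r) (M (Q' u)) ∧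
      SuppIn (farModes (r - 3)) (Q (M (Q' u))) := by
    intro r u hu
    have h1 : SuppIn (hopModes r) (M (Q' u)) :=
      hM.suppIn (hQ'.suppIn hu fun m k h => ⟨k, by rwa [one_smul] at h⟩)
    exact ⟨h1, hQ.suppIn h1 fun m k h => farModes_of_hopModes h⟩
  refine ⟨fun r hr u hu => ?_, fun r u hu => hM.suppIn (supp r u hu).2, fun r hr n hn => ?_⟩
  · have hr' : (4 : ℝ) ≤ r := by exact_mod_cast hr
    have hq' : SuppIn (farModes (r - 2)) (Q' u) :=
      (hQ'.suppIn hu fun m k h => (⟨k, by rwa [one_smul] at h⟩ : m ∈ hopModes r)).mono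
        (hopModes_subset r)
    have e1 := hM.norm_le (by linarith) (supp r u hu).2
    have e2 := hQ.norm_le (M (Q' u))
    have e3 := hM.norm_le (by linarith) hq'
    have e4 := hQ'.norm_le u
    push_cast at e1 e3
    have p1 : 0 < (r : ℝ) - 3 - 1 / 2 := by linarith
    have p2 : 0 < (r : ℝ) - 2 - 1 / 2 := by linarith
    calc ‖M (Q (M (Q' u)))‖
        ≤ 2 / Real.sqrt 3 / (r - 3 - 1 / 2) * (3 * Real.sqrt 3 *
          (2 / Real.sqrt 3 / (r - 2 - 1 / 2) * (3 * Real.sqrt 3 * ‖u‖))) := by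
          refine e1.trans ?_
          gcongr
          refine e2.trans ?_
          gcongr
          refine e3.trans ?_
          gcongr
      _ = 36 / ((r - 5 / 2) * (r - 7 / 2)) * ‖u‖ := by
          have q1 : (r : ℝ) - 5 / 2 ≠ 0 := by linarith
          have q2 : (r : ℝ) - 7 / 2 ≠ 0 := by linarith
          rw [show (r : ℝ) - 3 - 1 / 2 = r - 7 / 2 by ring,
            show (r : ℝ) - 2 - 1 / 2 = r - 5 / 2 by ring]
          field_simp
          norm_num
          ring
  · have hr' : (4 : ℝ) ≤ r := by exact_mod_cast hr
    obtain ⟨μ, hμ, hM⟩ := hM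
    obtain ⟨c, hc, hQ⟩ := hQ
    obtain ⟨c', hc', hQ'⟩ := hQ'
    have e : (M * Q * M * Q') (fourierBasis n)
        = ∑ k, ∑ j, (((Real.sqrt 3 : ℝ) * c' k) * (((Real.sqrt 3 : ℝ) * c j) *
          (μ (n - (1 : ℤ) • hopVec k) * μ (n - (1 : ℤ) • hopVec k - (-1 : ℤ) • hopVec j)))) •
          fourierBasis (n - (1 : ℤ) • hopVec k - (-1 : ℤ) • hopVec j) := by
      change M (Q (M (Q' (fourierBasis n)))) = _
      rw [isHop_apply_basis hQ', map_sum, map_sum, map_sum]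
      refine Finset.sum_congr rfl fun k _ => ?_
      rw [map_smul, inv_mul_basis hM, map_smul, map_smul, map_smul, isHop_apply_basis hQ, map_smul,
        map_sum, Finset.smul_sum, Finset.smul_sum]
      refine Finset.sum_congr rfl fun j _ => ?_
      rw [map_smul, inv_mul_basis hM, smul_smul, smul_smul, smul_smul]
      congr 1
      ring
    have p1 : 0 < (r : ℝ) - 7 / 2 := by linarith
    have p2 : 0 < (r : ℝ) - 5 / 2 := by linarith
    rw [e]
    refine (norm_double_hop_le n c c' hc hc' (fun j k => μ (n - (1 : ℤ) • hopVec k)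
      * μ (n - (1 : ℤ) • hopVec k - (-1 : ℤ) • hopVec j))
      (K := 4 / 3 / ((r - 5 / 2) * (r - 7 / 2))) (by positivity) fun j k => ?_).trans
      (le_of_eq (by ring))
    have hk : n - (1 : ℤ) • hopVec k ∈ hopModes r := ⟨k, by simpa using hn⟩
    have h1 := norm_calDSymbol_inv_le (by linarith) (hopModes_subset r hk)
    have h2 := norm_calDSymbol_inv_le (r := r - 3) (by linarith)
      (m := n - (1 : ℤ) • hopVec k - (-1 : ℤ) • hopVec j)
      (farModes_of_hopModes (k := j) (by simpa using hk))
    push_cast at h1 h2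
    rw [norm_mul, hμ, hμ]
    rw [show (r : ℝ) - 2 - 1 / 2 = r - 5 / 2 by ring] at h1
    rw [show (r : ℝ) - 3 - 1 / 2 = r - 7 / 2 by ring] at h2
    calc _ ≤ 2 / Real.sqrt 3 / (r - 5 / 2) * (2 / Real.sqrt 3 / (r - 7 / 2)) := by gcongr
      _ = _ := by
        have q1 : (r : ℝ) - 5 / 2 ≠ 0 := by linarith
        have q2 : (r : ℝ) - 7 / 2 ≠ 0 := by linarith
        field_simp
        rw [Real.sq_sqrt (by norm_num)]
        norm_num

/-- This is the order of factors in B*. Its first inverse acts before any hop and would give r -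
1/2; this is weakened to r - 7/2, so that B and B* share one bound. -/
theorem farBound_of_hop_inv_hop_inv {M Q Q' : L2 →L[ℂ] L2} (hM : IsInvMul M) (hQ : IsHop (-1) Q)
    (hQ' : IsHop 1 Q') : FarBound (Q * (M * (Q' * M))) := by
  have h3 : Real.sqrt 3 * Real.sqrt 3 = 3 := Real.mul_self_sqrt (by norm_num)
  have h3' : (0 : ℝ) < Real.sqrt 3 := Real.sqrt_pos.mpr (by norm_num)
  have supp : ∀ r : ℤ, ∀ u, SuppIn (farModes r) u → SuppIn (hopModes r) (Q' (M u)) :=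
    fun r u hu => hQ'.suppIn (hM.suppIn hu) fun m k h => ⟨k, by rwa [one_smul] at h⟩
  refine ⟨fun r hr u hu => ?_, fun r u hu => hQ.suppIn (hM.suppIn (supp r u hu))
    fun m k h => farModes_of_hopModes h, fun r hr n hn => ?_⟩
  · have hr' : (4 : ℝ) ≤ r := by exact_mod_cast hr
    have e1 := hQ.norm_le (M (Q' (M u)))
    have e2 := hM.norm_le (by linarith) ((supp r u hu).mono (hopModes_subset r))
    have e3 := hQ'.norm_le (M u)
    have e4 := hM.norm_le (by linarith) hu
    push_cast at e2
    have p1 : 0 < (r : ℝ) - 7 / 2 := by linarith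
    have p2 : 0 < (r : ℝ) - 5 / 2 := by linarith
    have p3 : (r : ℝ) - 2 - 1 / 2 = r - 5 / 2 := by ring
    rw [p3] at e2
    calc ‖Q (M (Q' (M u)))‖
        ≤ 3 * Real.sqrt 3 * (2 / Real.sqrt 3 / (r - 5 / 2) * (3 * Real.sqrt 3 *
          (2 / Real.sqrt 3 / (r - 7 / 2) * ‖u‖))) := by
          refine e1.trans ?_
          gcongr
          refine e2.trans ?_
          gcongr
          refine e3.trans ?_
          gcongr
          refine e4.trans ?_
          gcongr
          linarith
      _ = 36 / ((r - 5 / 2) * (r - 7 / 2)) * ‖u‖ := by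
          have q1 : (r : ℝ) - 5 / 2 ≠ 0 := by linarith
          have q2 : (r : ℝ) - 7 / 2 ≠ 0 := by linarith
          field_simp
          norm_num
          ring
  · have hr' : (4 : ℝ) ≤ r := by exact_mod_cast hr
    obtain ⟨μ, hμ, hM⟩ := hM
    obtain ⟨c, hc, hQ⟩ := hQ
    obtain ⟨c', hc', hQ'⟩ := hQ'
    have e : (Q * (M * (Q' * M))) (fourierBasis n)
        = ∑ k, ∑ j, (((Real.sqrt 3 : ℝ) * c' k) * (((Real.sqrt 3 : ℝ) * c j) *
          (μ n * μ (n - (1 : ℤ) • hopVec k)))) •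
          fourierBasis (n - (1 : ℤ) • hopVec k - (-1 : ℤ) • hopVec j) := by
      change Q (M (Q' (M (fourierBasis n)))) = _
      rw [inv_mul_basis hM, map_smul, isHop_apply_basis hQ', map_smul, map_smul, map_sum, map_sum,
        Finset.smul_sum]
      refine Finset.sum_congr rfl fun k _ => ?_
      rw [map_smul, inv_mul_basis hM, map_smul, map_smul, isHop_apply_basis hQ,
        Finset.smul_sum, Finset.smul_sum, Finset.smul_sum]
      refine Finset.sum_congr rfl fun j _ => ?_
      rw [smul_smul, smul_smul, smul_smul]
      congr 1
      ring
    have p1 : 0 < (r : ℝ) - 7 / 2 := by linarith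
    have p2 : 0 < (r : ℝ) - 5 / 2 := by linarith
    rw [e]
    refine (norm_double_hop_le n c c' hc hc' (fun j k => μ n * μ (n - (1 : ℤ) • hopVec k))
      (K := 4 / 3 / ((r - 5 / 2) * (r - 7 / 2))) (by positivity) fun j k => ?_).trans
      (le_of_eq (by ring))
    have hk : n - (1 : ℤ) • hopVec k ∈ hopModes r := ⟨k, by simpa using hn⟩
    have h1 := norm_calDSymbol_inv_le (by linarith) (hopModes_subset r hk)
    have h2 := norm_calDSymbol_inv_le (r := r) (by linarith) hn
    push_cast at h1 h2
    rw [norm_mul, hμ, hμ]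
    rw [show (r : ℝ) - 2 - 1 / 2 = r - 5 / 2 by ring] at h1
    calc _ ≤ 2 / Real.sqrt 3 / (r - 7 / 2) * (2 / Real.sqrt 3 / (r - 5 / 2)) := by
          gcongr
          refine h2.trans ?_
          gcongr
          linarith
      _ = _ := by
        have q1 : (r : ℝ) - 5 / 2 ≠ 0 := by linarith
        have q2 : (r : ℝ) - 7 / 2 ≠ 0 := by linarith
        field_simp
        rw [Real.sq_sqrt (by norm_num)]
        norm_num

theorem farBound_B : FarBound B := by
  rw [B_eq]
  exact farBound_of_inv_hop_inv_hop isInvMul_calDInv isHop_calVPlus isHop_calVMinus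

theorem farBound_adjoint_B : FarBound (ContinuousLinearMap.adjoint B) := by
  have h := farBound_of_hop_inv_hop_inv isInvMul_calDInv.adjoint isHop_calVMinus.adjoint
    (Q' := ContinuousLinearMap.adjoint calVPlus) (by simpa using isHop_calVPlus.adjoint)
  rw [B_eq]
  simpa only [← ContinuousLinearMap.star_eq_adjoint, star_mul] using h

/-- The product of the lower bounds for `𝒟` along four steps from sup-norm `r`. -/
def hopProd (r : ℝ) : ℝ :=
  ((r - 5 / 2) * (r - 7 / 2)) * (((r - 11 / 2) * (r - 13 / 2)) *
    (((r - 17 / 2) * (r - 19 / 2)) * ((r - 23 / 2) * (r - 25 / 2))))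

/-- The four factors act at sup-norm at least r, r - 3, r - 6 and r - 9, and the last must be at
least 4, whence r ≥ 13. For a basis vector only the first factor uses the constant 4√15, because its
image is no longer a single mode; the others contribute 36³ = 6⁶. -/
theorem FarBound.pow_four {X : L2 →L[ℂ] L2} (hX : FarBound X) {r : ℤ} (hr : 13 ≤ r) :
    (∀ u, SuppIn (farModes r) u → ‖(X ^ 4) u‖ ≤ 6 ^ 8 / hopProd r * ‖u‖) ∧
    ∀ n ∈ farModes r, ‖(X ^ 4) (fourierBasis n)‖ ≤ 6 ^ 6 * (4 * Real.sqrt 15) / hopProd r := by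
  have e : ∀ u, (X ^ 4) u = X (X (X (X u))) := fun u => rfl
  have hr' : (13 : ℝ) ≤ r := by exact_mod_cast hr
  have p1 : 0 < (r : ℝ) - 5 / 2 := by linarith
  have p2 : 0 < (r : ℝ) - 7 / 2 := by linarith
  have p3 : 0 < (r : ℝ) - 11 / 2 := by linarith
  have p4 : 0 < (r : ℝ) - 13 / 2 := by linarith
  have p5 : 0 < (r : ℝ) - 17 / 2 := by linarith
  have p6 : 0 < (r : ℝ) - 19 / 2 := by linarith
  have p7 : 0 < (r : ℝ) - 23 / 2 := by linarith
  have p8 : 0 < (r : ℝ) - 25 / 2 := by linarith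
  have key : ∀ u, SuppIn (farModes r) u → ‖(X ^ 4) u‖ ≤
      36 / ((r - 23 / 2) * (r - 25 / 2)) * (36 / ((r - 17 / 2) * (r - 19 / 2)) *
        (36 / ((r - 11 / 2) * (r - 13 / 2)) * ‖X u‖)) := by
    intro u hu
    have s1 := hX.suppIn r u hu
    have s2 := hX.suppIn _ _ s1
    have s3 := hX.suppIn _ _ s2
    have b1 := hX.norm_le _ (by linarith) _ s1
    have b2 := hX.norm_le _ (by linarith) _ s2
    have b3 := hX.norm_le _ (by linarith) _ s3
    push_cast at b1 b2 b3
    rw [show (r : ℝ) - 3 - 5 / 2 = r - 11 / 2 by ring,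
      show (r : ℝ) - 3 - 7 / 2 = r - 13 / 2 by ring] at b1
    rw [show (r : ℝ) - 3 - 3 - 5 / 2 = r - 17 / 2 by ring,
      show (r : ℝ) - 3 - 3 - 7 / 2 = r - 19 / 2 by ring] at b2
    rw [show (r : ℝ) - 3 - 3 - 3 - 5 / 2 = r - 23 / 2 by ring,
      show (r : ℝ) - 3 - 3 - 3 - 7 / 2 = r - 25 / 2 by ring] at b3
    rw [e]
    refine b3.trans ?_
    gcongr
    refine b2.trans ?_
    gcongr
  refine ⟨fun u hu => (key u hu).trans ?_, fun n hn => (key _ fun m hm => ?_).trans ?_⟩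
  · have := hX.norm_le r (by linarith) u hu
    calc _ ≤ 36 / ((r - 23 / 2) * (r - 25 / 2)) * (36 / ((r - 17 / 2) * (r - 19 / 2)) *
        (36 / ((r - 11 / 2) * (r - 13 / 2)) * (36 / ((r - 5 / 2) * (r - 7 / 2)) * ‖u‖))) := by
          gcongr
      _ = _ := by
        rw [hopProd]
        simp only [div_eq_mul_inv, mul_inv]
        ring
  · rw [repr_basis, if_neg]
    rintro rfl
    exact hm hn
  · have := hX.norm_basis_le r (by linarith) n hn
    calc _ ≤ 36 / ((r - 23 / 2) * (r - 25 / 2)) * (36 / ((r - 17 / 2) * (r - 19 / 2)) *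
        (36 / ((r - 11 / 2) * (r - 13 / 2)) * (4 * Real.sqrt 15 / ((r - 5 / 2) * (r - 7 / 2)))))
          := by gcongr
      _ = _ := by
        rw [hopProd]
        simp only [div_eq_mul_inv, mul_inv]
        ring

/-! ### Counting Fourier modes -/

/-- The sup-norm of a Fourier mode. -/
def supNorm (n : Fin 2 → ℤ) : ℕ := max (n 0).natAbs (n 1).natAbs

/-- The modes of sup-norm `m` with both coordinates congruent to `s` mod `3` (for
`s ∈ {0, -1}`). -/
def residueShell (s : ℤ) (m : ℕ) : Finset (Fin 2 → ℤ) :=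
  ((({(m : ℤ), -(m : ℤ)} : Finset ℤ).filter fun x => 3 ∣ x - s) ×ˢ
    (Finset.Icc (-((m + s) / 3)) ((m - s) / 3) ×ˢ (Finset.univ : Finset Bool))).image
    fun q => if q.2.2 then ![q.1, 3 * q.2.1 + s] else ![3 * q.2.1 + s, q.1]

theorem mem_residueShell {s : ℤ} {n : Fin 2 → ℤ} (h0 : 3 ∣ n 0 - s) (h1 : 3 ∣ n 1 - s) :
    n ∈ residueShell s (supNorm n) := by
  have hn0 : (n 0).natAbs ≤ supNorm n := le_max_left _ _
  have hn1 : (n 1).natAbs ≤ supNorm n := le_max_right _ _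
  have hor : (n 0).natAbs = supNorm n ∨ (n 1).natAbs = supNorm n := by
    rcases max_choice (n 0).natAbs (n 1).natAbs with h | h
    · exact Or.inl h.symm
    · exact Or.inr h.symm
  generalize supNorm n = m at *
  rw [residueShell, Finset.mem_image]
  obtain ⟨a, ha⟩ := h0
  obtain ⟨b, hb⟩ := h1
  rcases hor with h | h
  · refine ⟨(n 0, b, true), ?_, ?_⟩
    · simp only [Finset.mem_product, Finset.mem_filter, Finset.mem_insert, Finset.mem_singleton,
        Finset.mem_Icc, Finset.mem_univ, and_true]
      refine ⟨⟨?_, ⟨a, ha⟩⟩, ?_, ?_⟩ <;> omega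
    · ext j
      fin_cases j
      · rfl
      · simp; linarith
  · refine ⟨(n 1, a, false), ?_, ?_⟩
    · simp only [Finset.mem_product, Finset.mem_filter, Finset.mem_insert, Finset.mem_singleton,
        Finset.mem_Icc, Finset.mem_univ, and_true]
      refine ⟨⟨?_, ⟨b, hb⟩⟩, ?_, ?_⟩ <;> omega
    · ext j
      fin_cases j
      · simp; linarith
      · rfl

theorem card_residueShell_le (s : ℤ) (m : ℕ) : (residueShell s m).card ≤
    (({(m : ℤ), -(m : ℤ)} : Finset ℤ).filter fun x => 3 ∣ x - s).card *
      ((((m - s) / 3 + 1 + (m + s) / 3 : ℤ).toNat) * 2) := by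
  refine Finset.card_image_le.trans ?_
  rw [Finset.card_product, Finset.card_product, Int.card_Icc, Finset.card_univ, Fintype.card_bool,
    sub_neg_eq_add]

/-- The two residue classes never share a shell. If 3 ∣ m only class 0 occurs, with either sign of
the extremal coordinate; otherwise only class -1 occurs, and exactly one of ±m is congruent to -1.
Thus one bound serves both the scalar space and the two-component space, and so does the constant
10.23. -/
theorem card_residueShell_add_le {m : ℕ} (hm : 1 ≤ m) :
    3 * ((residueShell 0 m).card + (residueShell (-1) m).card) ≤ 8 * m + 12 := by
  have h0 := card_residueShell_le 0 m
  have h1 := card_residueShell_le (-1) m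
  have c0 : (({(m : ℤ), -(m : ℤ)} : Finset ℤ).filter fun x => 3 ∣ x - 0).card
      ≤ if 3 ∣ (m : ℤ) then 2 else 0 := by
    split_ifs with h
    · exact (Finset.card_filter_le _ _).trans Finset.card_le_two
    · rw [Nat.le_zero, Finset.card_eq_zero, Finset.filter_eq_empty_iff]
      intro x hx
      simp only [Finset.mem_insert, Finset.mem_singleton] at hx
      omega
  have c1 : (({(m : ℤ), -(m : ℤ)} : Finset ℤ).filter fun x => 3 ∣ x - (-1)).card
      ≤ if 3 ∣ (m : ℤ) then 0 else 1 := by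
    split_ifs with h
    · rw [Nat.le_zero, Finset.card_eq_zero, Finset.filter_eq_empty_iff]
      intro x hx
      simp only [Finset.mem_insert, Finset.mem_singleton] at hx
      omega
    · rw [Finset.card_le_one]
      intro x hx y hy
      simp only [Finset.mem_filter, Finset.mem_insert, Finset.mem_singleton] at hx hy
      omega
  have h0' := h0.trans (Nat.mul_le_mul_right _ c0)
  have h1' := h1.trans (Nat.mul_le_mul_right _ c1)
  split_ifs at h0' h1' <;> omega

/-- The modes are grouped by sup-norm. Only an upper bound by shell sizes is needed, so the index
family may miss some modes. -/
theorem tsum_residue_le {ι : Type*} (s : ℤ) (n : ι → Fin 2 → ℤ) (hn : Function.Injective n)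
    (hs : ∀ i, 3 ∣ n i 0 - s ∧ 3 ∣ n i 1 - s) (g : ℕ → ℝ≥0∞) :
    ∑' i, g (supNorm (n i)) ≤ ∑' m, ((residueShell s m).card : ℝ≥0∞) * g m := by
  have h1 : ∀ i, g (supNorm (n i)) = ∑' m, if m = supNorm (n i) then g m else 0 := fun i => by
    rw [tsum_ite_eq]
  simp_rw [h1]
  rw [ENNReal.tsum_comm]
  refine ENNReal.tsum_le_tsum fun m => ?_
  calc ∑' i, (if m = supNorm (n i) then g m else 0)
      ≤ ∑' i, (fun v => if v ∈ residueShell s m then g m else 0) (n i) := by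
        refine ENNReal.tsum_le_tsum fun i => ?_
        split_ifs with h
        · simp only
          rw [if_pos (by rw [h]; exact mem_residueShell (hs i).1 (hs i).2)]
        · exact zero_le
    _ ≤ ∑' v, if v ∈ residueShell s m then g m else 0 :=
        ENNReal.tsum_comp_le_tsum_of_injective hn _
    _ = _ := by
        rw [tsum_eq_sum (s := residueShell s m) fun v hv => if_neg hv,
          Finset.sum_congr rfl fun v hv => if_pos hv, Finset.sum_const, nsmul_eq_mul]

/-! ### Tail sums -/

theorem hopProd_pos {r : ℝ} (hr : 13 ≤ r) : 0 < hopProd r := by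
  have p1 : 0 < (r : ℝ) - 5 / 2 := by linarith
  have p2 : 0 < (r : ℝ) - 7 / 2 := by linarith
  have p3 : 0 < (r : ℝ) - 11 / 2 := by linarith
  have p4 : 0 < (r : ℝ) - 13 / 2 := by linarith
  have p5 : 0 < (r : ℝ) - 17 / 2 := by linarith
  have p6 : 0 < (r : ℝ) - 19 / 2 := by linarith
  have p7 : 0 < (r : ℝ) - 23 / 2 := by linarith
  have p8 : 0 < (r : ℝ) - 25 / 2 := by linarith
  unfold hopProd
  positivity

theorem sqrt_fifteen_le : Real.sqrt 15 ≤ 3.873 := by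
  rw [Real.sqrt_le_left (by norm_num)]
  norm_num

theorem shell_poly_le {r : ℝ} (hr : 17 ≤ r) :
    (8 * r + 12) * (2 / 3 * (6 ^ 6 * (4 * 3.873))) * ((r - 9) ^ 6 * (r - 8) ^ 6)
      ≤ 10.23 ^ 6 * hopProd r * ((r - 8) ^ 6 - (r - 9) ^ 6) := by
  have h1 : 0 ≤ hopProd r * ((r - 8) ^ 6 - (r - 9) ^ 6) := by
    refine mul_nonneg (hopProd_pos (by linarith)).le ?_
    have : (r - 9) ^ 6 ≤ (r - 8) ^ 6 := pow_le_pow_left₀ (by linarith) (by linarith) 6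
    linarith
  -- 1146000 is a rational lower bound for 10.23⁶.
  have h2 : (8 * r + 12) * (2 / 3 * (6 ^ 6 * (4 * 3.873))) * ((r - 9) ^ 6 * (r - 8) ^ 6)
      ≤ 1146000 * (hopProd r * ((r - 8) ^ 6 - (r - 9) ^ 6)) := by
    -- After expansion around 17 the difference of both sides is a polynomial in y with nonnegative
    -- coefficients.
    obtain ⟨y, rfl⟩ : ∃ y, r = 17 + y := ⟨r - 17, by ring⟩
    have hy : 0 ≤ y := by linarith
    rw [← sub_nonneg, hopProd]
    ring_nf
    positivity
  nlinarith

/-- A shell has at most (8r + 12)/3 modes, each counted for the two tails with a weight of order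
r⁻⁸. This order r⁻⁷ is dominated by a difference of sixth inverse powers. The shifts 9 and 8 make
the tail starting at r = N + 1 telescope to (N - 8)⁻⁶. -/
theorem shell_term_le {r : ℝ} (hr : 17 ≤ r) :
    (8 * r + 12) / 3 * (2 * (6 ^ 6 * (4 * Real.sqrt 15) / hopProd r))
      ≤ 10.23 ^ 6 * ((r - 9) ^ 6)⁻¹ - 10.23 ^ 6 * ((r - 8) ^ 6)⁻¹ := by
  have hp := hopProd_pos (r := r) (by linarith)
  have h9 : 0 < (r - 9) ^ 6 := pow_pos (by linarith) 6
  have h8 : 0 < (r - 8) ^ 6 := pow_pos (by linarith) 6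
  have h := shell_poly_le hr
  have h15 := sqrt_fifteen_le
  have e : 10.23 ^ 6 * ((r - 9) ^ 6)⁻¹ - 10.23 ^ 6 * ((r - 8) ^ 6)⁻¹
      = 10.23 ^ 6 * ((r - 8) ^ 6 - (r - 9) ^ 6) / ((r - 9) ^ 6 * (r - 8) ^ 6) := by
    rw [← mul_sub, inv_sub_inv h9.ne' h8.ne', mul_div_assoc]
  rw [e, le_div_iff₀ (by positivity)]
  calc _ ≤ (8 * r + 12) / 3 * (2 * (6 ^ 6 * (4 * 3.873) / hopProd r))
        * ((r - 9) ^ 6 * (r - 8) ^ 6) := by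
        gcongr
    _ = (8 * r + 12) * (2 / 3 * (6 ^ 6 * (4 * 3.873))) * ((r - 9) ^ 6 * (r - 8) ^ 6)
        / hopProd r := by ring
    _ ≤ _ := by
        rw [div_le_iff₀ hp]
        linarith

/-- The bound for the norm of the image of a basis vector of sup-norm `m` under the truncated
operator. -/
def tailWeight (N m : ℕ) : ℝ := if N < m then 6 ^ 6 * (4 * Real.sqrt 15) / hopProd m else 0

theorem tailWeight_nonneg {N : ℕ} (hN : 16 ≤ N) (m : ℕ) : 0 ≤ tailWeight N m := by
  unfold tailWeight
  split_ifs with h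
  · have : (13 : ℝ) ≤ m := by
      have : 13 ≤ m := by omega
      exact_mod_cast this
    have := hopProd_pos this
    positivity
  · rfl

theorem tsum_tailWeight_le {N : ℕ} (hN : 16 ≤ N) {c : ℕ → ℕ}
    (hc : ∀ m, 1 ≤ m → 3 * c m ≤ 8 * m + 12) :
    ∑' m, (c m : ℝ≥0∞) * ENNReal.ofReal (2 * tailWeight N m)
      ≤ ENNReal.ofReal (10.23 ^ 6 * (((N : ℝ) - 8) ^ 6)⁻¹) := by
  -- The maximum freezes t up to N + 1, so the telescoping bound reads 0 ≤ 0 on the shells with no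
  -- weight.
  set t : ℕ → ℝ := fun m => 10.23 ^ 6 * ((((max m (N + 1) : ℕ) : ℝ) - 9) ^ 6)⁻¹ with ht
  have hterm : ∀ m, (c m : ℝ) * (2 * tailWeight N m) ≤ t m - t (m + 1) := by
    intro m
    by_cases h : N < m
    · have h1 : max m (N + 1) = m := max_eq_left h
      have h2 : max (m + 1) (N + 1) = m + 1 := max_eq_left (by omega)
      have hm : (17 : ℝ) ≤ m := by
        have : 17 ≤ m := by omega
        exact_mod_cast this
      simp only [ht, h1, h2, tailWeight, if_pos h]
      have hcm : (c m : ℝ) ≤ (8 * m + 12) / 3 := by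
        have := hc m (by omega)
        rw [le_div_iff₀ (by norm_num)]
        have h' : ((3 * c m : ℕ) : ℝ) ≤ ((8 * m + 12 : ℕ) : ℝ) := by exact_mod_cast this
        push_cast at h'
        linarith
      have hp := hopProd_pos (r := m) (by linarith)
      refine (mul_le_mul_of_nonneg_right hcm (by positivity)).trans ((shell_term_le hm).trans ?_)
      push_cast
      rw [show (m : ℝ) + 1 - 9 = m - 8 by ring]
    · have h1 : max m (N + 1) = N + 1 := max_eq_right (by omega)
      have h2 : max (m + 1) (N + 1) = N + 1 := max_eq_right (by omega)
      simp only [ht, h1, h2, tailWeight, if_neg h]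
      simp
  rw [ENNReal.tsum_eq_iSup_nat]
  refine iSup_le fun k => ?_
  have e : ∀ m, (c m : ℝ≥0∞) * ENNReal.ofReal (2 * tailWeight N m)
      = ENNReal.ofReal ((c m : ℝ) * (2 * tailWeight N m)) := fun m => by
    rw [ENNReal.ofReal_mul (Nat.cast_nonneg _), ENNReal.ofReal_natCast]
  simp_rw [e]
  rw [← ENNReal.ofReal_sum_of_nonneg fun m _ => mul_nonneg (Nat.cast_nonneg _)
    (mul_nonneg (by norm_num) (tailWeight_nonneg hN m))]
  refine ENNReal.ofReal_le_ofReal ?_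
  refine (Finset.sum_le_sum fun m _ => hterm m).trans ?_
  rw [Finset.sum_range_sub']
  have h0 : t 0 = 10.23 ^ 6 * (((N : ℝ) - 8) ^ 6)⁻¹ := by
    simp only [ht, Nat.zero_max]
    push_cast
    rw [show (N : ℝ) + 1 - 9 = N - 8 by ring]
  have hk : 0 ≤ t k := by
    simp only [ht]
    have : (0 : ℝ) ≤ (((max k (N + 1) : ℕ) : ℝ) - 9) ^ 6 := Even.pow_nonneg (by decide) _
    positivity
  linarith

/-- The numbers N - 1, N - 3, …, N - 15 are symmetric about N - 8, so their product is at most (N -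
8)⁸. The exponent -1 + 2/8 = -3/4 turns this into ρ₁ ≥ (N/(N - 8))⁶, and the sixth root converts
1/(N - 8) into N⁻¹ρ₁^{1/6}. All factors are positive because N > 15. -/
theorem rho_one_ge {N : ℕ} (hN : 16 ≤ N) :
    (10.23 ^ 6 * (((N : ℝ) - 8) ^ 6)⁻¹) ^ (1 / 6 : ℝ)
      ≤ 10.23 * (N : ℝ)⁻¹ * rho 1 N 8 ^ (1 / 6 : ℝ) := by
  have hN' : (16 : ℝ) ≤ N := by exact_mod_cast hN
  have hN0 : (0 : ℝ) < N := by linarith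
  have hpos : ∀ l ∈ Finset.range 8, 0 < (1 - (2 * l + (1 : ℕ) : ℝ) / N) := by
    intro l hl
    have hl8 : l < 8 := Finset.mem_range.mp hl
    have hl' : (l : ℝ) ≤ 7 := by
      have : l ≤ 7 := by omega
      exact_mod_cast this
    rw [sub_pos, div_lt_one hN0]
    push_cast
    linarith
  have hrho : rho 1 N 8 = (∏ l ∈ Finset.range 8, (1 - (2 * l + (1 : ℕ) : ℝ) / N)) ^ (-(3 / 4) : ℝ) := by
    rw [rho, ← Real.finsetProd_rpow _ _ fun l hl => (hpos l hl).le]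
    norm_num
  have hprod : ∏ l ∈ Finset.range 8, (1 - (2 * l + (1 : ℕ) : ℝ) / N) ≤ ((N - 8) / N) ^ 8 := by
    have h2 : ∏ l ∈ Finset.range 8, (1 - (2 * l + (1 : ℕ) : ℝ) / N)
        = ((N - 8) ^ 2 - 49) * (((N - 8) ^ 2 - 25) * (((N - 8) ^ 2 - 9) * ((N - 8) ^ 2 - 1)))
          / (N : ℝ) ^ 8 := by
      simp only [Finset.prod_range_succ, Finset.prod_range_zero]
      field_simp
      push_cast
      ring
    rw [h2, div_pow]
    gcongr
    have hx : (64 : ℝ) ≤ ((N : ℝ) - 8) ^ 2 := by nlinarith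
    set x := ((N : ℝ) - 8) ^ 2
    calc _ ≤ x * (x * (x * x)) := by
          have a1 : 0 ≤ x - 1 := by linarith
          have a2 : 0 ≤ x - 9 := by linarith
          have a3 : 0 ≤ x - 25 := by linarith
          gcongr <;> linarith
      _ = _ := by simp only [x]; ring
  have h8 : (0 : ℝ) < ((N : ℝ) - 8) / N := div_pos (by linarith) hN0
  have hge : (((N : ℝ) - 8) / N) ^ (-6 : ℝ) ≤ rho 1 N 8 := by
    rw [hrho]
    refine le_trans (le_of_eq ?_) (Real.rpow_le_rpow_of_nonpos (Finset.prod_pos hpos) hprod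
      (by norm_num))
    rw [← Real.rpow_natCast, ← Real.rpow_mul h8.le]
    norm_num
  have hfin : (((N : ℝ) - 8) / N)⁻¹ ≤ rho 1 N 8 ^ (1 / 6 : ℝ) := by
    refine le_trans (le_of_eq ?_) (Real.rpow_le_rpow (by positivity) hge (by norm_num))
    rw [← Real.rpow_mul h8.le, ← Real.rpow_neg_one]
    norm_num
  have hlhs : (10.23 ^ 6 * (((N : ℝ) - 8) ^ 6)⁻¹) ^ (1 / 6 : ℝ) = 10.23 * ((N : ℝ) - 8)⁻¹ := by
    have h9 : (0 : ℝ) ≤ 10.23 * ((N : ℝ) - 8)⁻¹ :=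
      mul_nonneg (by norm_num) (inv_nonneg.mpr (by linarith))
    rw [← inv_pow, ← mul_pow, one_div]
    exact_mod_cast Real.pow_rpow_inv_natCast h9 (n := 6) (by norm_num)
  rw [hlhs]
  calc 10.23 * ((N : ℝ) - 8)⁻¹ = 10.23 * (N : ℝ)⁻¹ * (((N : ℝ) - 8) / N)⁻¹ := by
        have : (N : ℝ) - 8 ≠ 0 := by linarith
        field_simp
    _ ≤ _ := by gcongr

/-- Here ρ₀N⁻⁸ is the inverse of N(N - 2)⋯(N - 14). Pairing outermost factors with outermost ones,
each pair from `hopProd` has the larger sum 2N - 13 (against 2N - 14) and the smaller spread, hence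
the larger product. -/
theorem rho_zero_ge {N : ℕ} (hN : 16 ≤ N) :
    (hopProd ((N : ℝ) + 1))⁻¹ ≤ rho 0 N 8 * ((N : ℝ) ^ 8)⁻¹ := by
  have hN' : (16 : ℝ) ≤ N := by exact_mod_cast hN
  have hN0 : (0 : ℝ) < N := by linarith
  have a1 : 0 < (N : ℝ) - 14 := by linarith
  have a2 : 0 < (N : ℝ) - 12 := by linarith
  have a3 : 0 < (N : ℝ) - 10 := by linarith
  have a4 : 0 < (N : ℝ) - 8 := by linarith
  have a5 : 0 < (N : ℝ) - 6 := by linarith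
  have a6 : 0 < (N : ℝ) - 4 := by linarith
  have a7 : 0 < (N : ℝ) - 2 := by linarith
  have h : rho 0 N 8 * ((N : ℝ) ^ 8)⁻¹ = (((N : ℝ) * (N - 14)) * ((N - 2) * (N - 12)) *
      (((N - 4) * (N - 10)) * ((N - 6) * (N - 8) : ℝ)))⁻¹ := by
    rw [rho]
    have e : ∀ l : ℕ, (1 - (2 * l + (0 : ℕ) : ℝ) / N) ^ (-1 + 2 * (0 : ℕ) / (8 : ℕ) : ℝ)
        = N / (N - 2 * l) := by
      intro l
      rw [show (-1 + 2 * (0 : ℕ) / (8 : ℕ) : ℝ) = -1 by norm_num, Real.rpow_neg_one,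
        show (1 - (2 * l + (0 : ℕ) : ℝ) / N) = (N - 2 * l) / N by push_cast; field_simp; ring,
        inv_div]
    rw [Finset.prod_congr rfl fun l _ => e l]
    simp only [Finset.prod_range_succ, Finset.prod_range_zero]
    norm_num
    field_simp
  rw [h]
  refine inv_anti₀ (by positivity) ?_
  rw [hopProd]
  calc _ ≤ (((N : ℝ) + 1 - 5 / 2) * (N + 1 - 25 / 2)) * ((N + 1 - 7 / 2) * (N + 1 - 23 / 2)) *
        (((N + 1 - 11 / 2) * (N + 1 - 19 / 2)) * ((N + 1 - 13 / 2) * (N + 1 - 17 / 2))) := by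
        have b1 : 0 ≤ (N : ℝ) + 1 - 5 / 2 := by linarith
        have b2 : 0 ≤ (N : ℝ) + 1 - 25 / 2 := by linarith
        have b3 : 0 ≤ (N : ℝ) + 1 - 7 / 2 := by linarith
        have b4 : 0 ≤ (N : ℝ) + 1 - 23 / 2 := by linarith
        have b5 : 0 ≤ (N : ℝ) + 1 - 11 / 2 := by linarith
        have b6 : 0 ≤ (N : ℝ) + 1 - 19 / 2 := by linarith
        have b7 : 0 ≤ (N : ℝ) + 1 - 13 / 2 := by linarith
        have b8 : 0 ≤ (N : ℝ) + 1 - 17 / 2 := by linarith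
        refine mul_le_mul (mul_le_mul ?_ ?_ (by positivity) (by positivity))
          (mul_le_mul ?_ ?_ (by positivity) (by positivity)) (by positivity) (by positivity)
        all_goals nlinarith
    _ = _ := by ring

/-! ### Truncation -/

theorem repr_fourierProj (N : ℕ) (u : L2) (n : Fin 2 → ℤ) : fourierBasis.repr (fourierProj N u) n
    = (if ∀ j, |n j| ≤ (N : ℤ) then 1 else 0) * fourierBasis.repr u n :=
  repr_fourierMul _ _ u n

theorem repr_one_sub_fourierProj (N : ℕ) (u : L2) (n : Fin 2 → ℤ) :
    fourierBasis.repr ((1 - fourierProj N) u) n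
      = (if ∀ j, |n j| ≤ (N : ℤ) then 0 else 1) * fourierBasis.repr u n := by
  rw [sub_apply, one_apply_eq_self, map_sub, lp.coeFn_sub, Pi.sub_apply, repr_fourierProj]
  split_ifs <;> simp

theorem adjoint_fourierProj (N : ℕ) :
    ContinuousLinearMap.adjoint (fourierProj N) = fourierProj N := by
  symm
  rw [ContinuousLinearMap.eq_adjoint_iff]
  intro u v
  refine (inner_eq_tsum _ _).unique ((inner_eq_tsum _ _).congr_fun fun n => ?_)
  rw [repr_fourierProj, repr_fourierProj]
  split_ifs <;> simp

theorem norm_fourierProj_apply_le (N : ℕ) (u : L2) : ‖fourierProj N u‖ ≤ ‖u‖ := by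
  rw [← one_mul ‖u‖]
  refine norm_le_of_repr_le zero_le_one fun n => ?_
  rw [repr_fourierProj]
  split_ifs <;> simp

theorem norm_one_sub_fourierProj_apply_le (N : ℕ) (u : L2) : ‖(1 - fourierProj N) u‖ ≤ ‖u‖ := by
  rw [← one_mul ‖u‖]
  refine norm_le_of_repr_le zero_le_one fun n => ?_
  rw [repr_one_sub_fourierProj]
  split_ifs <;> simp

theorem suppIn_one_sub_fourierProj (N : ℕ) (u : L2) :
    SuppIn (farModes (N + 1)) ((1 - fourierProj N) u) := by
  intro n hn
  rw [repr_one_sub_fourierProj, if_pos, zero_mul]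
  intro j
  by_contra h
  exact hn ⟨j, by omega⟩

theorem one_sub_fourierProj_basis (N : ℕ) (n : Fin 2 → ℤ) : (1 - fourierProj N) (fourierBasis n)
    = if N < supNorm n then fourierBasis n else 0 := by
  refine ext_repr fun m => ?_
  have h : (∀ j, |n j| ≤ (N : ℤ)) ↔ ¬ N < supNorm n := by
    rw [not_lt, supNorm, max_le_iff, Fin.forall_fin_two, Int.abs_eq_natAbs, Int.abs_eq_natAbs]
    norm_cast
  rw [repr_one_sub_fourierProj, repr_basis]
  by_cases hm : m = n
  · subst hm
    by_cases hN : N < supNorm m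
    · simp [h, hN, repr_basis]
    · simp [h, hN]
  · rw [if_neg hm, mul_zero]
    split_ifs
    · rw [repr_basis, if_neg hm]
    · simp

theorem norm_pow_four_tail_basis_le {X : L2 →L[ℂ] L2} (hX : FarBound X) {N : ℕ} (hN : 16 ≤ N)
    (n : Fin 2 → ℤ) :
    ‖(X ^ 4 * (1 - fourierProj N) : L2 →L[ℂ] L2) (fourierBasis n)‖ ≤ tailWeight N (supNorm n) := by
  rw [mul_apply_eq_comp, one_sub_fourierProj_basis, tailWeight]
  split_ifs with h
  · have := (hX.pow_four (r := supNorm n) (by omega)).2 n (by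
      rcases max_choice (n 0).natAbs (n 1).natAbs with h | h
      · exact ⟨0, by rw [supNorm, h, Int.abs_eq_natAbs]⟩
      · exact ⟨1, by rw [supNorm, h, Int.abs_eq_natAbs]⟩)
    exact_mod_cast this
  · simp

/-- The part of the truncation error that acts on high modes. -/
def tailRight (N : ℕ) : L2 →L[ℂ] L2 := B ^ 4 * (1 - fourierProj N)

/-- The part of the truncation error that maps low modes to high modes. -/
def tailLeft (N : ℕ) : L2 →L[ℂ] L2 := (1 - fourierProj N) * B ^ 4 * fourierProj N

/-- The right part vanishes on low modes. The left part does not, but its adjoint Π_N B*⁴(1 - Π_N)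
does; this is why the trace norm estimate uses the adjoint of one summand. -/
theorem truncError_eq (N : ℕ) : truncError N = tailRight N + tailLeft N := by
  rw [truncError, tailRight, tailLeft]
  noncomm_ring

theorem adjoint_tailLeft (N : ℕ) : ContinuousLinearMap.adjoint (tailLeft N)
    = fourierProj N * (ContinuousLinearMap.adjoint B ^ 4 * (1 - fourierProj N)) := by
  have h : star (fourierProj N) = fourierProj N := by
    rw [ContinuousLinearMap.star_eq_adjoint, adjoint_fourierProj]
  rw [tailLeft, ← ContinuousLinearMap.star_eq_adjoint, star_mul, star_mul, star_pow, star_sub,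
    star_one, h, ContinuousLinearMap.star_eq_adjoint]

theorem norm_tailRight_basis_le {N : ℕ} (hN : 16 ≤ N) (n : Fin 2 → ℤ) :
    ‖tailRight N (fourierBasis n)‖ ≤ tailWeight N (supNorm n) := by
  have h := norm_pow_four_tail_basis_le farBound_B hN n
  have e : tailRight N = B ^ 4 * (1 - fourierProj N) := rfl
  rw [e]
  generalize B = X at h ⊢
  exact h

theorem norm_adjoint_tailLeft_basis_le {N : ℕ} (hN : 16 ≤ N) (n : Fin 2 → ℤ) :
    ‖ContinuousLinearMap.adjoint (tailLeft N) (fourierBasis n)‖ ≤ tailWeight N (supNorm n) := by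
  rw [adjoint_tailLeft, mul_apply_eq_comp]
  exact (norm_fourierProj_apply_le _ _).trans (norm_pow_four_tail_basis_le farBound_adjoint_B hN n)

theorem norm_pow_four_tail_le {X : L2 →L[ℂ] L2} (hX : FarBound X) {N : ℕ} (hN : 16 ≤ N) :
    ‖X ^ 4 * (1 - fourierProj N)‖ ≤ 6 ^ 8 / hopProd ((N : ℝ) + 1) := by
  have hN' : (16 : ℝ) ≤ N := by exact_mod_cast hN
  have hp := hopProd_pos (r := (N : ℝ) + 1) (by linarith)
  refine ContinuousLinearMap.opNorm_le_bound _ (by positivity) fun u => ?_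
  have := (hX.pow_four (r := N + 1) (by omega)).1 _ (suppIn_one_sub_fourierProj N u)
  push_cast at this
  refine this.trans ?_
  gcongr
  exact norm_one_sub_fourierProj_apply_le N u

theorem norm_truncError_le {N : ℕ} (hN : 16 ≤ N) :
    ‖truncError N‖ ≤ 6 ^ 8 * 2 * rho 0 N 8 * ((N : ℝ) ^ 8)⁻¹ := by
  have h1 : ‖tailRight N‖ ≤ 6 ^ 8 / hopProd ((N : ℝ) + 1) := norm_pow_four_tail_le farBound_B hN
  have h2 : ‖tailLeft N‖ ≤ 6 ^ 8 / hopProd ((N : ℝ) + 1) := by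
    rw [← LinearIsometryEquiv.norm_map ContinuousLinearMap.adjoint, adjoint_tailLeft]
    refine le_trans ?_ (norm_pow_four_tail_le farBound_adjoint_B hN)
    refine ContinuousLinearMap.opNorm_le_bound _ (norm_nonneg _) fun u => ?_
    rw [mul_apply_eq_comp]
    exact (norm_fourierProj_apply_le _ _).trans (ContinuousLinearMap.le_opNorm _ _)
  rw [truncError_eq]
  refine (norm_add_le _ _).trans ?_
  have := rho_zero_ge hN
  rw [div_eq_mul_inv] at h1 h2
  nlinarith

/-! ### Two-component operators and trace norms on the reduced spaces -/

theorem norm_diagOp_le (X : L2 →L[ℂ] L2) : ‖diagOp X‖ ≤ ‖X‖ := by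
  refine ContinuousLinearMap.opNorm_le_bound _ (norm_nonneg _) fun u => ?_
  refine (sq_le_sq₀ (norm_nonneg _) (by positivity)).mp ?_
  rw [mul_pow, PiLp.norm_sq_eq_of_L2, PiLp.norm_sq_eq_of_L2, Finset.mul_sum]
  refine Finset.sum_le_sum fun i _ => ?_
  rw [diagOp_apply, ← mul_pow]
  gcongr
  exact X.le_opNorm _

theorem adjoint_diagOp (X : L2 →L[ℂ] L2) :
    ContinuousLinearMap.adjoint (diagOp X) = diagOp (ContinuousLinearMap.adjoint X) := by
  symm
  rw [ContinuousLinearMap.eq_adjoint_iff]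
  intro u v
  rw [PiLp.inner_apply, PiLp.inner_apply]
  refine Finset.sum_congr rfl fun i _ => ?_
  rw [diagOp_apply, diagOp_apply, ContinuousLinearMap.adjoint_inner_left]

/-- The multi-indices of the modes of `L²₀(ℂ/Γ)`-type spaces in residue class `s`. -/
abbrev ResidueIndex (s : ℤ) : Type := {n : Fin 2 → ℤ // 3 ∣ n 0 - s ∧ 3 ∣ n 1 - s}

theorem hasSum_residue {s : ℤ} {v : L2}
    (hv : ∀ n : Fin 2 → ℤ, ¬ (3 ∣ n 0 - s ∧ 3 ∣ n 1 - s) → fourierBasis.repr v n = 0) :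
    HasSum (fun n : ResidueIndex s => fourierBasis.repr v n • fourierBasis n) v := by
  have h := fourierBasis.hasSum_repr v
  refine (hasSum_subtype_iff_of_support_subset (f := fun n => fourierBasis.repr v n •
    fourierBasis n) (s := {n | 3 ∣ n 0 - s ∧ 3 ∣ n 1 - s}) fun n hn => ?_).mpr h
  by_contra hs
  exact hn (by simp only [hv n hs, zero_smul])

theorem tsum_tailWeight_residue_le (N : ℕ) (s : ℤ) :
    ∑' n : ResidueIndex s, ENNReal.ofReal (tailWeight N (supNorm n))
      ≤ ∑' m, ((residueShell s m).card : ℝ≥0∞) * ENNReal.ofReal (tailWeight N m) :=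
  tsum_residue_le s (fun n : ResidueIndex s => (n : Fin 2 → ℤ)) Subtype.val_injective
    (fun n => n.2) fun m => ENNReal.ofReal (tailWeight N m)

theorem ofReal_two_mul_tailWeight (N m : ℕ) : ENNReal.ofReal (2 * tailWeight N m)
    = ENNReal.ofReal (tailWeight N m) + ENNReal.ofReal (tailWeight N m) := by
  rw [ENNReal.ofReal_mul (by norm_num), ENNReal.ofReal_ofNat, two_mul]

theorem traceNorm_restrictTo_reducedL2_le {N : ℕ} (hN : 16 ≤ N) :
    traceNorm (restrictTo reducedL2 (truncError N))
      ≤ ENNReal.ofReal (10.23 ^ 6 * (((N : ℝ) - 8) ^ 6)⁻¹) := by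
  rw [truncError_eq]
  refine (traceNorm_restrictTo_add_le reducedL2 _ _
    (fun n : ResidueIndex 0 => fourierBasis n)
    (fun n => (fourierBasis.orthonormal.1 _).le) (fun n => ?_) fun v hv => ?_).trans ?_
  · rw [mem_reducedL2_iff]
    intro m hm
    rw [repr_basis, if_neg]
    rintro rfl
    exact hm (by simpa using n.2)
  · rw [mem_reducedL2_iff] at hv
    simp_rw [← fourierBasis.repr_apply_apply]
    exact hasSum_residue (by simpa using hv)
  · refine le_trans ?_ (tsum_tailWeight_le hN (c := fun m => (residueShell 0 m).card)
      fun m hm => by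
        have := card_residueShell_add_le hm
        omega)
    simp_rw [ofReal_two_mul_tailWeight, mul_add]
    rw [ENNReal.tsum_add]
    gcongr
    · refine le_trans (ENNReal.tsum_le_tsum fun n => ?_) (tsum_tailWeight_residue_le N 0)
      exact ENNReal.ofReal_le_ofReal (norm_tailRight_basis_le hN _)
    · refine le_trans (ENNReal.tsum_le_tsum fun n => ?_) (tsum_tailWeight_residue_le N 0)
      exact ENNReal.ofReal_le_ofReal (norm_adjoint_tailLeft_basis_le hN _)

theorem diagOp_add (X Y : L2 →L[ℂ] L2) : diagOp (X + Y) = diagOp X + diagOp Y := by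
  ext1 u
  ext1 i
  rw [add_apply, PiLp.add_apply, diagOp_apply, diagOp_apply, diagOp_apply, add_apply]

theorem traceNorm_restrictTo_reducedL2Two_le {N : ℕ} (hN : 16 ≤ N) :
    traceNorm (restrictTo reducedL2Two (diagOp (truncError N)))
      ≤ ENNReal.ofReal (10.23 ^ 6 * (((N : ℝ) - 8) ^ 6)⁻¹) := by
  rw [truncError_eq, diagOp_add]
  set b : (Σ i : Fin 2, ResidueIndex (residue i)) → L2Two :=
    fun q => PiLp.single 2 q.1 (fourierBasis (q.2 : Fin 2 → ℤ)) with hb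
  have hnorm : ∀ (X : L2 →L[ℂ] L2) q, ‖diagOp X (b q)‖
      = ‖X (fourierBasis (q.2 : Fin 2 → ℤ))‖ := by
    intro X q
    have : diagOp X (b q) = PiLp.single 2 q.1 (X (fourierBasis (q.2 : Fin 2 → ℤ))) := by
      ext1 j
      rw [diagOp_apply, hb]
      by_cases h : j = q.1
      · rw [h]; simp
      · simp [h]
    rw [this, PiLp.norm_single]
  refine (traceNorm_restrictTo_add_le reducedL2Two _ _ b (fun q => ?_) (fun q => ?_)
    fun v hv => ?_).trans ?_
  · rw [hb, PiLp.norm_single]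
    exact (fourierBasis.orthonormal.1 _).le
  · rw [mem_reducedL2Two_iff]
    intro i n hn
    by_cases h : i = q.1
    · subst h
      simp only [hb, PiLp.single_apply, if_true]
      rw [repr_basis, if_neg]
      rintro rfl
      exact hn q.2.2
    · simp [hb, h]
  · rw [mem_reducedL2Two_iff] at hv
    have hinner : ∀ q, ⟪b q, v⟫_ℂ = fourierBasis.repr (v q.1) q.2 := fun q => by
      rw [hb, PiLp.inner_apply, Finset.sum_eq_single q.1 (fun j _ hj => by simp [hj])
        (fun h => absurd (Finset.mem_univ _) h), PiLp.single_eq_same,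
        ← fourierBasis.repr_apply_apply]
    -- Convergence is checked componentwise: for fixed i only the indices q with q.1 = i contribute,
    -- and these form the Fourier series of v i.
    have hcomp : HasSum (fun q => (⟪b q, v⟫_ℂ • b q).ofLp) v.ofLp := by
      refine Pi.hasSum.mpr fun i => ?_
      refine (Function.Injective.hasSum_iff (g := Sigma.mk i) sigma_mk_injective
        fun q hq => ?_).mp ?_
      · have h : i ≠ q.1 := by
          rintro rfl
          exact hq ⟨q.2, rfl⟩
        simp [hb, h]
      · refine (hasSum_residue (hv i)).congr_fun fun n => ?_
        simp only [Function.comp_apply, PiLp.smul_apply, hinner]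
        rw [hb, PiLp.single_eq_same]
    exact hcomp.mapL
      (PiLp.continuousLinearEquiv 2 ℂ fun _ : Fin 2 => L2).symm.toContinuousLinearMap
  · refine le_trans ?_ (tsum_tailWeight_le hN
      (c := fun m => (residueShell (-1) m).card + (residueShell 0 m).card)
      fun m hm => by
        have := card_residueShell_add_le hm
        omega)
    rw [adjoint_diagOp]
    simp_rw [ofReal_two_mul_tailWeight, mul_add, hnorm]
    rw [ENNReal.tsum_add]
    have key : ∀ F : (Fin 2 → ℤ) → ℝ, (∀ n, F n ≤ tailWeight N (supNorm n)) →
        ∑' q : Σ i : Fin 2, ResidueIndex (residue i), ENNReal.ofReal (F q.2)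
        ≤ ∑' m, (((residueShell (-1) m).card + (residueShell 0 m).card : ℕ) : ℝ≥0∞)
          * ENNReal.ofReal (tailWeight N m) := by
      intro F hF
      push_cast
      simp_rw [add_mul]
      rw [ENNReal.tsum_add, ENNReal.tsum_sigma', tsum_fintype, Fin.sum_univ_two]
      refine add_le_add ?_ ?_
      · exact (ENNReal.tsum_le_tsum fun n => ENNReal.ofReal_le_ofReal (hF _)).trans
          (tsum_tailWeight_residue_le N (residue 0))
      · exact (ENNReal.tsum_le_tsum fun n => ENNReal.ofReal_le_ofReal (hF _)).trans
          (tsum_tailWeight_residue_le N (residue 1))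
    exact add_le_add (key _ fun n => norm_tailRight_basis_le hN n)
      (key _ fun n => norm_adjoint_tailLeft_basis_le hN n)

theorem rpow_traceNorm_le {N : ℕ} (hN : 16 ≤ N) {t : ℝ≥0∞}
    (ht : t ≤ ENNReal.ofReal (10.23 ^ 6 * (((N : ℝ) - 8) ^ 6)⁻¹)) :
    t ^ (1 / 6 : ℝ) ≤ ENNReal.ofReal (10.23 * (N : ℝ)⁻¹ * rho 1 N 8 ^ (1 / 6 : ℝ)) := by
  refine (ENNReal.rpow_le_rpow ht (by norm_num)).trans ?_
  rw [ENNReal.ofReal_rpow_of_nonneg _ (by norm_num)]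
  · exact ENNReal.ofReal_le_ofReal (rho_one_ge hN)
  · have : (0 : ℝ) ≤ ((N : ℝ) - 8) ^ 6 := Even.pow_nonneg (by decide) _
    positivity

/-! ### Periodic functions -/

theorem latticePoint_add (s t s' t' : ℝ) :
    latticePoint (s + s') (t + t') = latticePoint s t + latticePoint s' t' := by
  simp only [latticePoint]
  push_cast
  ring

theorem latticePoint_smul (c s t : ℝ) :
    latticePoint (c * s) (c * t) = c * latticePoint s t := by
  simp only [latticePoint]
  push_cast
  ring

theorem exists_eq_latticePoint (z : ℂ) : ∃ s t, z = latticePoint s t := by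
  set w : ℂ := z / (4 * Real.pi * Complex.I) with hw
  have hz : z = 4 * Real.pi * Complex.I * w := by
    have : (Real.pi : ℂ) ≠ 0 := by exact_mod_cast Real.pi_ne_zero
    rw [hw]
    field_simp [Complex.I_ne_zero]
  refine ⟨-w.re + w.im / Real.sqrt 3, -w.re - w.im / Real.sqrt 3, ?_⟩
  rw [hz, latticePoint]
  congr 1
  have h3 := sqrt_three_ne_zero
  rw [ω_sq_add, ω_eq]
  conv_lhs => rw [← Complex.re_add_im w]
  push_cast
  field_simp
  ring

theorem exists_eq_dbarReal (z : ℂ) : ∃ x y, z = dbarReal x y := by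
  set w : ℂ := z * (Real.sqrt 3 : ℝ) with hw
  refine ⟨-w.re - w.im / Real.sqrt 3, w.re - w.im / Real.sqrt 3, ?_⟩
  have h3 := sqrt_three_ne_zero
  rw [dbarReal, eq_div_iff h3, ← hw, ω_sq_add, ω_eq]
  conv_lhs => rw [← Complex.re_add_im w]
  push_cast
  field_simp
  ring

/-- Periodicity with respect to `Γ`. -/
def IsPeriodic (f : ℂ → ℂ) : Prop := ∀ (p q : ℤ) (z : ℂ), f (z + latticePoint p q) = f z

theorem exists_torusRep_coe (s : Fin 2 → ℝ) : ∃ p q : ℤ,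
    torusRep (fun j => (s j : UnitAddCircle)) = latticePoint (s 0) (s 1) + latticePoint p q := by
  refine ⟨-⌊s 0⌋, -⌊s 1⌋, ?_⟩
  rw [torusRep_eq, ← latticePoint_add, AddCircle.coe_equivIco_mk_apply,
    AddCircle.coe_equivIco_mk_apply]
  simp only [div_one, mul_one, Int.fract]
  push_cast
  simp only [sub_eq_add_neg]

theorem exists_coe_eq (x : Torus) : ∃ s : Fin 2 → ℝ, x = fun j => (s j : UnitAddCircle) :=
  ⟨fun j => (AddCircle.equivIco (1 : ℝ) 0 (x j) : ℝ),
    funext fun j => ((AddCircle.equivIco (1 : ℝ) 0).symm_apply_apply (x j)).symm⟩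

namespace IsPeriodic

variable {f : ℂ → ℂ}

theorem torusRep_coe (hf : IsPeriodic f) (s : Fin 2 → ℝ) :
    f (torusRep (fun j => (s j : UnitAddCircle))) = f (latticePoint (s 0) (s 1)) := by
  obtain ⟨p, q, h⟩ := exists_torusRep_coe s
  rw [h, hf]

theorem torusRep_add (hf : IsPeriodic f) (x : Torus) (s : Fin 2 → ℝ) :
    f (torusRep (x + fun j => (s j : UnitAddCircle)))
      = f (torusRep x + latticePoint (s 0) (s 1)) := by
  obtain ⟨r, rfl⟩ := exists_coe_eq x
  obtain ⟨p, q, h⟩ := exists_torusRep_coe r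
  have e : ((fun j => (r j : UnitAddCircle)) + fun j => (s j : UnitAddCircle) : Torus)
      = fun j => (((r + s) j : ℝ) : UnitAddCircle) := by
    funext j
    exact (AddCircle.coe_add (p := (1 : ℝ)) (r j) (s j)).symm
  rw [e, hf.torusRep_coe, h, Pi.add_apply, Pi.add_apply, latticePoint_add, add_right_comm, hf]

/-- `torusRep` itself jumps across the boundary of the unit square. Composed with a periodic
function, it becomes continuous after pullback along the quotient map ℝ² → (ℝ/ℤ)². -/
theorem continuous_torusRep (hf : IsPeriodic f) (hc : Continuous f) :
    Continuous fun x => f (torusRep x) := by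
  have hq : IsOpenQuotientMap
      (fun (s : Fin 2 → ℝ) (j : Fin 2) => (s j : UnitAddCircle)) :=
    IsOpenQuotientMap.piMap fun _ => QuotientAddGroup.isOpenQuotientMap_mk
  rw [hq.isQuotientMap.continuous_iff]
  have e : ((fun x => f (torusRep x)) ∘ fun (s : Fin 2 → ℝ) (j : Fin 2) => (s j : UnitAddCircle))
      = fun s => f (latticePoint (s 0) (s 1)) := funext fun s => hf.torusRep_coe s
  rw [e]
  unfold latticePoint
  fun_prop

theorem exists_bound (hf : IsPeriodic f) (hc : Continuous f) : ∃ C, ∀ z, ‖f z‖ ≤ C := by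
  obtain ⟨C, hC⟩ := (isCompact_univ (X := Torus)).exists_bound_of_continuousOn
    (hf.continuous_torusRep hc).continuousOn
  refine ⟨C, fun z => ?_⟩
  obtain ⟨s, t, rfl⟩ := exists_eq_latticePoint z
  have := hC (fun j => ((![s, t] j : ℝ) : UnitAddCircle)) (Set.mem_univ _)
  rwa [hf.torusRep_coe] at this

end IsPeriodic

/-! ### Fourier coefficients of periodic functions -/

/-- The Fourier coefficients of a `Γ`-periodic function. -/
def coeff (f : ℂ → ℂ) (n : Fin 2 → ℤ) : ℂ :=
  ∫ x, UnitAddTorus.mFourier (-n) x * f (torusRep x) ∂torusMeasure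

theorem expChar_dbarSymbol (n : Fin 2 → ℤ) (s t : ℝ) :
    expChar (dbarSymbol n) (latticePoint s t)
      = Complex.exp (2 * Real.pi * Complex.I * (n 0 * s + n 1 * t)) := by
  rw [dbarSymbol_eq, expChar_dbarReal]
  push_cast
  rfl

theorem mFourier_coe_eq_expChar (n : Fin 2 → ℤ) (s : Fin 2 → ℝ) :
    UnitAddTorus.mFourier n (fun j => (s j : UnitAddCircle))
      = expChar (dbarSymbol n) (latticePoint (s 0) (s 1)) := by
  rw [mFourier_coe, expChar_dbarSymbol]

theorem isPeriodic_expChar (n : Fin 2 → ℤ) : IsPeriodic (expChar (dbarSymbol n)) := by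
  intro p q z
  rw [expChar_add_right, expChar_dbarSymbol]
  have : Complex.exp (2 * Real.pi * Complex.I * (n 0 * ((p : ℝ) : ℂ) + n 1 * ((q : ℝ) : ℂ))) = 1 := by
    rw [Complex.exp_eq_one_iff]
    exact ⟨n 0 * p + n 1 * q, by push_cast; ring⟩
  rw [this, mul_one]

theorem coeff_translate {f : ℂ → ℂ} (hf : IsPeriodic f) (n : Fin 2 → ℤ) (s t : ℝ) :
    coeff (fun z => f (z + latticePoint s t)) n
      = expChar (dbarSymbol n) (latticePoint s t) * coeff f n := by
  have h := integral_mFourier_translate (fun x => f (torusRep x)) n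
    (fun j => ((![s, t] j : ℝ) : UnitAddCircle))
  rw [mFourier_coe_eq_expChar] at h
  refine Eq.trans ?_ h
  refine integral_congr_ae (Filter.Eventually.of_forall fun x => ?_)
  simp only
  rw [hf.torusRep_add]
  rfl

theorem norm_coeff_le {f : ℂ → ℂ} {C : ℝ} (hC : ∀ z, ‖f z‖ ≤ C) (n : Fin 2 → ℤ) :
    ‖coeff f n‖ ≤ C := by
  have h := norm_integral_le_of_norm_le_const (μ := torusMeasure) (C := C)
    (f := fun x => UnitAddTorus.mFourier (-n) x * f (torusRep x))
    (Filter.Eventually.of_forall fun x => by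
      rw [norm_mul, norm_mFourier_apply, one_mul]
      exact hC _)
  simpa [coeff] using h

theorem IsPeriodic.fderiv {f : ℂ → ℂ} (hf : IsPeriodic f) (v : ℂ) :
    IsPeriodic fun z => fderiv ℝ f z v := by
  intro p q z
  have : f = fun w => f (w + latticePoint p q) := funext fun w => (hf p q w).symm
  beta_reduce
  conv_rhs => rw [this, fderiv_comp_add_right]

/-- Integration by parts without boundary terms: the coefficient of the translate f(· + hv) is an
exponential in h times that of f, and both sides are differentiated at h = 0, the left one under the
integral. -/
theorem coeff_fderiv {f : ℂ → ℂ} (hf : IsPeriodic f) (hd : ContDiff ℝ 1 f) (n : Fin 2 → ℤ)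
    (s t : ℝ) : coeff (fun z => fderiv ℝ f z (latticePoint s t)) n
      = 2 * Real.pi * Complex.I * (n 0 * s + n 1 * t) * coeff f n := by
  set v := latticePoint s t with hv
  have hc' : Continuous fun z => fderiv ℝ f z v :=
    (hd.continuous_fderiv (by norm_num)).clm_apply continuous_const
  obtain ⟨C, hC⟩ := (hf.fderiv v).exists_bound hc'
  obtain ⟨C₀, hC₀⟩ := hf.exists_bound hd.continuous
  have hm : ∀ g : ℂ → ℂ, Continuous g → AEStronglyMeasurable
      (fun x => UnitAddTorus.mFourier (-n) x * g (torusRep x)) torusMeasure := fun g hg =>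
    ((UnitAddTorus.mFourier (-n)).continuous.measurable.mul
      (hg.measurable.comp torusRep_measurable)).aestronglyMeasurable
  have h1 := (hasDerivAt_integral_of_dominated_loc_of_deriv_le (μ := torusMeasure)
    (F := fun (h : ℝ) x => UnitAddTorus.mFourier (-n) x * f (torusRep x + h * v))
    (F' := fun (h : ℝ) x => UnitAddTorus.mFourier (-n) x * fderiv ℝ f (torusRep x + h * v) v)
    (x₀ := 0) (s := Set.univ) (bound := fun _ => C) Filter.univ_mem
    (Filter.Eventually.of_forall fun h => hm (fun z => f (z + h * v))
      (hd.continuous.comp (continuous_id.add continuous_const)))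
    (Integrable.of_bound (hm (fun z => f (z + (0 : ℝ) * v))
      (hd.continuous.comp (continuous_id.add continuous_const))) C₀
      (Filter.Eventually.of_forall fun x => by
        rw [norm_mul, norm_mFourier_apply, one_mul]
        exact hC₀ _))
    (hm (fun z => fderiv ℝ f (z + (0 : ℝ) * v) v)
      (hc'.comp (continuous_id.add continuous_const)))
    (Filter.Eventually.of_forall fun x h _ => by
      rw [norm_mul, norm_mFourier_apply, one_mul]
      exact hC _)
    (integrable_const C)
    (Filter.Eventually.of_forall fun x h _ => by
      refine HasDerivAt.const_mul _ ?_
      have hin : HasDerivAt (fun h : ℝ => torusRep x + (h : ℂ) * v) v h := by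
        have := ((Complex.ofRealCLM.hasDerivAt (x := h)).mul_const v).const_add (torusRep x)
        simpa using this
      exact ((hd.differentiable (by norm_num) _).hasFDerivAt.comp_hasDerivAt h hin))).2
  have h2 : HasDerivAt (fun h : ℝ =>
      Complex.exp (h * (2 * Real.pi * Complex.I * (n 0 * s + n 1 * t))) * coeff f n)
      (2 * Real.pi * Complex.I * (n 0 * s + n 1 * t) * coeff f n) 0 := by
    have := (((Complex.ofRealCLM.hasDerivAt (x := 0)).mul_const
      (2 * Real.pi * Complex.I * (n 0 * s + n 1 * t) : ℂ)).cexp.mul_const (coeff f n))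
    simpa using this
  have e : (fun h : ℝ => ∫ x, UnitAddTorus.mFourier (-n) x * f (torusRep x + h * v) ∂torusMeasure)
      = fun h : ℝ => Complex.exp (h * (2 * Real.pi * Complex.I * (n 0 * s + n 1 * t)))
        * coeff f n := by
    funext h
    have := coeff_translate hf n (h * s) (h * t)
    rw [latticePoint_smul, ← hv] at this
    refine Eq.trans this ?_
    rw [hv, ← latticePoint_smul, expChar_dbarSymbol]
    congr 2
    push_cast
    ring
  rw [e] at h1
  have h := h1.unique h2
  rw [← h, coeff]
  simp

/-! ### Rapid decay -/

/-- The weight `1 + ‖n‖`. -/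
def wt (n : Fin 2 → ℤ) : ℝ := 1 + ‖n‖

theorem one_le_wt (n : Fin 2 → ℤ) : 1 ≤ wt n := le_add_of_nonneg_right (norm_nonneg n)

theorem wt_pos (n : Fin 2 → ℤ) : 0 < wt n := one_pos.trans_le (one_le_wt n)

theorem wt_le_mul (m n : Fin 2 → ℤ) : wt m ≤ wt n * wt (m - n) := by
  have h1 : ‖m‖ ≤ ‖n‖ + ‖m - n‖ := by
    have := norm_add_le n (m - n)
    rwa [add_sub_cancel] at this
  have := mul_nonneg (norm_nonneg n) (norm_nonneg (m - n))
  simp only [wt]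
  linarith

theorem wt_le_one_add_abs (n : Fin 2 → ℤ) : wt n ≤ 1 + |(n 0 : ℝ)| + |(n 1 : ℝ)| := by
  rw [wt, add_assoc]
  gcongr
  rw [pi_norm_le_iff_of_nonneg (by positivity)]
  intro j
  rw [Int.norm_eq_abs]
  fin_cases j
  · exact le_add_of_nonneg_right (abs_nonneg _)
  · exact le_add_of_nonneg_left (abs_nonneg _)

theorem norm_le_two_mul_norm_dbarSymbol (n : Fin 2 → ℤ) : ‖n‖ ≤ 2 * ‖dbarSymbol n‖ := by
  rw [pi_norm_le_iff_of_nonneg (by positivity)]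
  intro j
  rw [Int.norm_eq_abs]
  refine abs_le_of_sq_le_sq' ?_ (by positivity) |> abs_le.mpr
  rw [mul_pow, norm_dbarSymbol_sq]
  fin_cases j
  · simp only [Fin.zero_eta]
    nlinarith [sq_nonneg ((n 0 : ℝ) + 2 * n 1), sq_nonneg (n 0 : ℝ)]
  · simp only [Fin.mk_one]
    nlinarith [sq_nonneg (2 * (n 0 : ℝ) + n 1), sq_nonneg (n 1 : ℝ)]

theorem norm_dbarSymbol_le (n : Fin 2 → ℤ) : ‖dbarSymbol n‖ ≤ wt n := by
  refine le_trans ?_ (le_add_of_nonneg_left zero_le_one)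
  refine (sq_le_sq₀ (norm_nonneg _) (norm_nonneg _)).mp ?_
  have h : ∀ j, (n j : ℝ) ^ 2 ≤ ‖n‖ ^ 2 := fun j => by
    have := norm_le_pi_norm n j
    rw [Int.norm_eq_abs] at this
    rw [← sq_abs]
    gcongr
  rw [norm_dbarSymbol_sq]
  nlinarith [h 0, h 1, sq_nonneg ((n 0 : ℝ) - n 1)]

/-- Ellipticity of 2 D_{z̄} - k: the symbol grows linearly in n, so each use of the equation gains
one power of the weight. -/
theorem wt_le_mul_norm_dbarSymbol_sub (k : ℂ) (n : Fin 2 → ℤ) :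
    wt n ≤ (2 + 2 * ‖k‖) * (1 + ‖dbarSymbol n - k‖) := by
  have h1 := norm_le_two_mul_norm_dbarSymbol n
  have h2 := norm_le_norm_sub_add (dbarSymbol n) k
  have := mul_nonneg (norm_nonneg k) (norm_nonneg (dbarSymbol n - k))
  simp only [wt]
  linarith

/-- The exponent 3 exceeds the dimension 2 of the mode lattice. -/
theorem summable_inv_wt_pow : Summable fun n => (wt n ^ 3)⁻¹ := by
  refine EisensteinSeries.summable_of_isBigO_rpow_norm (a := 3) (by norm_num)
    (Asymptotics.IsBigO.of_bound 1 ?_)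
  filter_upwards [(Set.finite_singleton (0 : Fin 2 → ℤ)).compl_mem_cofinite] with n hn
  have hn : 0 < ‖n‖ := norm_pos_iff.mpr hn
  have := one_le_wt n
  rw [one_mul, Real.norm_of_nonneg (by positivity), Real.norm_of_nonneg (by positivity)]
  refine inv_anti₀ (by positivity) ?_
  rw [show (3 : ℝ) = (3 : ℕ) by norm_num, Real.rpow_natCast]
  gcongr
  simp [wt]

/-- Decay faster than any power of the weight. -/
def RapidDecay (a : (Fin 2 → ℤ) → ℂ) : Prop := ∀ s : ℕ, ∃ C, ∀ n, wt n ^ s * ‖a n‖ ≤ C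

theorem RapidDecay.summable {a : (Fin 2 → ℤ) → ℂ} (ha : RapidDecay a) (s : ℕ) :
    Summable fun n => wt n ^ s * ‖a n‖ := by
  obtain ⟨C, hC⟩ := ha (s + 3)
  have hp := fun n => wt_pos n
  refine Summable.of_nonneg_of_le (fun n => by have := hp n; positivity) (fun n => ?_)
    (summable_inv_wt_pow.mul_left C)
  rw [← div_eq_mul_inv, le_div_iff₀ (pow_pos (hp n) 3)]
  refine le_trans (le_of_eq ?_) (hC n)
  ring

theorem RapidDecay.summable_norm {a : (Fin 2 → ℤ) → ℂ} (ha : RapidDecay a) :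
    Summable fun n => ‖a n‖ := by simpa using ha.summable 0

/-- Derivatives along the two generators of Γ multiply the coefficients by 2πi n₀ and 2πi n₁, which
gains one power of the weight. The induction runs over all smooth periodic functions at once, since
the hypothesis is applied to these derivatives. -/
theorem rapidDecay_coeff {f : ℂ → ℂ} (hf : IsPeriodic f) (hd : ContDiff ℝ (⊤ : ℕ∞) f) :
    RapidDecay (coeff f) := by
  intro s
  induction s generalizing f with
  | zero =>
    obtain ⟨C, hC⟩ := hf.exists_bound hd.continuous
    exact ⟨C, fun n => by simpa using norm_coeff_le hC n⟩
  | succ s ih =>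
    have hd' : ∀ v, ContDiff ℝ (⊤ : ℕ∞) fun z => fderiv ℝ f z v := fun v =>
      (hd.fderiv_right (m := (⊤ : ℕ∞)) (by norm_cast)).clm_apply contDiff_const
    obtain ⟨C, hC⟩ := ih hf hd
    obtain ⟨C₀, hC₀⟩ := ih (hf.fderiv (latticePoint 1 0)) (hd' _)
    obtain ⟨C₁, hC₁⟩ := ih (hf.fderiv (latticePoint 0 1)) (hd' _)
    refine ⟨C + C₀ + C₁, fun n => ?_⟩
    have hd1 : ContDiff ℝ 1 f := hd.of_le (by norm_cast)
    have hpi : ∀ x : ℝ, ∀ y : ℂ, |x| * ‖y‖ ≤ ‖2 * Real.pi * Complex.I * x * y‖ := by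
      intro x y
      simp only [norm_mul, Complex.norm_real, Complex.norm_I, mul_one, Real.norm_eq_abs,
        Complex.norm_ofNat]
      have h1 : (1 : ℝ) ≤ 2 * |Real.pi| := by
        rw [abs_of_pos Real.pi_pos]
        linarith [Real.pi_gt_three]
      have h2 := mul_nonneg (abs_nonneg x) (norm_nonneg y)
      rw [mul_assoc]
      exact le_mul_of_one_le_left h2 h1
    have h0 : |(n 0 : ℝ)| * ‖coeff f n‖
        ≤ ‖coeff (fun z => fderiv ℝ f z (latticePoint 1 0)) n‖ := by
      rw [coeff_fderiv hf hd1]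
      simpa using hpi (n 0) (coeff f n)
    have h1 : |(n 1 : ℝ)| * ‖coeff f n‖
        ≤ ‖coeff (fun z => fderiv ℝ f z (latticePoint 0 1)) n‖ := by
      rw [coeff_fderiv hf hd1]
      simpa using hpi (n 1) (coeff f n)
    have hw : 0 ≤ wt n ^ s := pow_nonneg (wt_pos n).le s
    calc wt n ^ (s + 1) * ‖coeff f n‖ = wt n ^ s * (wt n * ‖coeff f n‖) := by ring
      _ ≤ wt n ^ s * ((1 + |(n 0 : ℝ)| + |(n 1 : ℝ)|) * ‖coeff f n‖) := by
        gcongr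
        exact wt_le_one_add_abs n
      _ ≤ wt n ^ s * (‖coeff f n‖ + ‖coeff (fun z => fderiv ℝ f z (latticePoint 1 0)) n‖
          + ‖coeff (fun z => fderiv ℝ f z (latticePoint 0 1)) n‖) := by
        gcongr
        linarith
      _ ≤ C + C₀ + C₁ := by
        rw [mul_add, mul_add]
        exact add_le_add (add_le_add (hC n) (hC₀ n)) (hC₁ n)

/-- Pointwise convergence of the Fourier series on the torus. -/
theorem hasSum_coeff_mFourier {f : ℂ → ℂ} (hf : IsPeriodic f) (hd : ContDiff ℝ (⊤ : ℕ∞) f)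
    (x : Torus) : HasSum (fun n => coeff f n * UnitAddTorus.mFourier n x) (f (torusRep x)) :=
  UnitAddTorus.hasSum_mFourier_series_apply_of_summable
    (f := ⟨fun x => f (torusRep x), hf.continuous_torusRep hd.continuous⟩)
    (rapidDecay_coeff hf hd).summable_norm.of_norm x

/-- Pointwise convergence of the Fourier series. -/
theorem hasSum_coeff_expChar {f : ℂ → ℂ} (hf : IsPeriodic f) (hd : ContDiff ℝ (⊤ : ℕ∞) f)
    (z : ℂ) : HasSum (fun n => coeff f n * expChar (dbarSymbol n) z) (f z) := by
  obtain ⟨s, t, rfl⟩ := exists_eq_latticePoint z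
  have h := hasSum_coeff_mFourier hf hd (fun j => ((![s, t] j : ℝ) : UnitAddCircle))
  simp only [mFourier_coe_eq_expChar] at h
  rw [hf.torusRep_coe] at h
  exact h

/-! ### The potential -/

namespace Potential

variable (U : Potential)

/-- The functions `U(z)`, `U(-z)` by which the potential maps the second component to the first,
the first component to the second. -/
def comp (i : Fin 2) : C(ℂ, ℂ) := if i = 0 then U.plus else U.minus

theorem contDiff_comp (i : Fin 2) : ContDiff ℝ (⊤ : ℕ∞) (U.comp i) := by
  fin_cases i
  · exact U.smooth
  · exact U.smooth.comp contDiff_neg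

theorem comp_rotation (i : Fin 2) (z : ℂ) : U.comp i (ω * z) = ω * U.comp i z := by
  fin_cases i
  · exact U.rotation z
  · change U.toFun (-(ω * z)) = ω * U.toFun (-z)
    rw [← mul_neg, U.rotation]

theorem toFun_translate (p q : ℤ) (z : ℂ) :
    U.toFun (z + latticePoint (p / 3) (q / 3)) = ω ^ (-(p + q)) * U.toFun z := by
  have hω : ω ≠ 0 := Complex.exp_ne_zero _
  have hc : conj ω = ω⁻¹ := by
    rw [conj_ω]
    refine eq_inv_of_mul_eq_one_left ?_
    rw [← ω_pow_three]
    ring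
  have key : ∀ a : ℂ, (∀ z, U.toFun (z + a) = conj ω * U.toFun z) → ∀ (p : ℤ) (z : ℂ),
      U.toFun (z + p * a) = ω ^ (-p) * U.toFun z := by
    intro a ha p
    induction p with
    | zero => simp
    | succ p ih =>
      intro z
      have := ih (z + a)
      rw [ha, hc] at this
      rw [show z + ((p + 1 : ℤ) : ℂ) * a = z + a + ((p : ℤ) : ℂ) * a by push_cast; ring, this,
        neg_add, zpow_add₀ hω, zpow_neg_one]
      ring
    | pred p ih =>
      intro z
      have h1 := ih (z - a)
      have h2 := ha (z - a)
      rw [sub_add_cancel, hc] at h2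
      rw [show z + ((-p - 1 : ℤ) : ℂ) * a = z - a + ((-p : ℤ) : ℂ) * a by push_cast; ring, h1,
        h2, neg_sub, sub_neg_eq_add, neg_neg, zpow_add₀ hω, zpow_one]
      field_simp
  have e : z + latticePoint (p / 3) (q / 3) = z + p * (4 / 3 * Real.pi * Complex.I * ω ^ 1)
      + q * (4 / 3 * Real.pi * Complex.I * ω ^ 2) := by
    simp only [latticePoint]
    push_cast
    ring
  rw [e, key _ (U.translation 2 (Or.inr rfl)), key _ (U.translation 1 (Or.inl rfl)), neg_add,
    zpow_add₀ hω]
  ring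

theorem comp_translate (i : Fin 2) (p q : ℤ) (z : ℂ) :
    U.comp i (z + latticePoint (p / 3) (q / 3))
      = ω ^ ((residue i - residue (i + 1)) * (p + q)) * U.comp i z := by
  fin_cases i
  · refine (U.toFun_translate p q z).trans ?_
    simp [residue]
    exact Or.inl rfl
  · change U.toFun (-(z + latticePoint (p / 3) (q / 3))) = _
    have := U.toFun_translate (-p) (-q) (-z)
    rw [show -(z + latticePoint (p / 3) (q / 3))
      = -z + latticePoint (((-p : ℤ) : ℝ) / 3) (((-q : ℤ) : ℝ) / 3) by
        simp only [latticePoint]; push_cast; ring, this]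
    simp [residue]
    rw [add_comm]
    rfl

theorem isPeriodic_comp (i : Fin 2) : IsPeriodic (U.comp i) := by
  intro p q z
  have h := U.comp_translate i (3 * p) (3 * q) z
  rw [(ω_zpow_eq_one_iff _).mpr ⟨(residue i - residue (i + 1)) * (p + q), by ring⟩, one_mul] at h
  rw [← h]
  congr 3 <;> push_cast <;> ring

/-- The Fourier coefficients of the potential. -/
def fourier (i : Fin 2) : (Fin 2 → ℤ) → ℂ := coeff (U.comp i)

theorem rapidDecay_fourier (i : Fin 2) : RapidDecay (U.fourier i) :=
  rapidDecay_coeff (U.isPeriodic_comp i) (U.contDiff_comp i)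

/-- The coefficients of a translate by Γ/3 are computed twice, from the translation law of
coefficients and from the symmetry of U. The surviving modes shift residues by exactly the offset
between the two components, so the potential preserves each sector. -/
theorem fourier_support (i : Fin 2) (n : Fin 2 → ℤ) (hn : U.fourier i n ≠ 0) (j : Fin 2) :
    3 ∣ n j - (residue i - residue (i + 1)) := by
  have hω : ω ≠ 0 := Complex.exp_ne_zero _
  have key : ∀ p q : ℤ, (3 : ℤ) ∣
      n 0 * p + n 1 * q - (residue i - residue (i + 1)) * (p + q) := by
    intro p q
    have h := coeff_translate (U.isPeriodic_comp i) n (p / 3) (q / 3)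
    have e : coeff (fun z => U.comp i (z + latticePoint (p / 3) (q / 3))) n
        = ω ^ ((residue i - residue (i + 1)) * (p + q)) * U.fourier i n := by
      simp only [comp_translate, coeff, fourier]
      rw [← integral_const_mul]
      congr 1
      funext x
      ring
    have e2 : expChar (dbarSymbol n) (latticePoint (p / 3) (q / 3))
        = ω ^ (n 0 * p + n 1 * q) := by
      rw [expChar_dbarSymbol, ω, ← Complex.exp_int_mul]
      congr 1
      push_cast
      ring
    rw [e, e2] at h
    rw [← ω_zpow_eq_one_iff, zpow_sub₀ hω, ← mul_right_cancel₀ hn h]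
    exact div_self (zpow_ne_zero _ hω)
  fin_cases j
  · simpa using key 1 0
  · simpa using key 0 1

theorem hasSum_repr_mulOp_comp (i : Fin 2) (u : L2) (m : Fin 2 → ℤ) :
    HasSum (fun n => U.fourier i n * fourierBasis.repr u (m - n))
      (fourierBasis.repr (mulOp (U.comp i) u) m) :=
  hasSum_repr_mulOp (U.comp i) id (U.rapidDecay_fourier i).summable_norm
    (hasSum_coeff_mFourier (U.isPeriodic_comp i) (U.contDiff_comp i)) u m

theorem potentialOp_apply (u : L2Two) (i : Fin 2) :
    potentialOp U u i = mulOp (U.comp i) (u (i + 1)) := by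
  rw [potentialOp, matOp_apply]
  fin_cases i
  · simp [comp]
  · simp [comp]

end Potential

/-! ### Convolution -/

/-- Convolution of families indexed by `ℤ²`. -/
def conv (A B : (Fin 2 → ℤ) → ℂ) (m : Fin 2 → ℤ) : ℂ := ∑' n, A n * B (m - n)

section Conv

variable {A B F : (Fin 2 → ℤ) → ℂ}

theorem summable_conv (hA : Summable fun n => ‖A n‖) {C : ℝ} (hB : ∀ n, ‖B n‖ ≤ C)
    (m : Fin 2 → ℤ) : Summable fun n => A n * B (m - n) :=
  Summable.of_norm_bounded (hA.mul_right C) fun n => by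
    rw [norm_mul]
    exact mul_le_mul_of_nonneg_left (hB _) (norm_nonneg _)

theorem norm_conv_le (hA : Summable fun n => ‖A n‖) {C : ℝ} (hB : ∀ n, ‖B n‖ ≤ C)
    (m : Fin 2 → ℤ) : ‖conv A B m‖ ≤ (∑' n, ‖A n‖) * C :=
  tsum_of_norm_bounded (hA.hasSum.mul_right C) fun n => by
    rw [norm_mul]
    exact mul_le_mul_of_nonneg_left (hB _) (norm_nonneg _)

theorem conv_comm (A B : (Fin 2 → ℤ) → ℂ) (m : Fin 2 → ℤ) : conv A B m = conv B A m := by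
  rw [conv, ← (Equiv.subLeft m).tsum_eq]
  refine tsum_congr fun n => ?_
  rw [Equiv.subLeft_apply, sub_sub_cancel, mul_comm]

/-- F is only assumed bounded since it will be `poleCoeff`, whose coefficients decay like 1/|q| on
3ℤ² and are not summable. Absolute convergence of the double sum comes from A and B. -/
theorem conv_left_comm (hA : Summable fun n => ‖A n‖) (hB : Summable fun n => ‖B n‖) {C : ℝ}
    (hF : ∀ n, ‖F n‖ ≤ C) (m : Fin 2 → ℤ) : conv F (conv A B) m = conv A (conv F B) m := by
  have h1 : Summable (Function.uncurry fun p n => F p * (A n * B (m - p - n))) := by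
    have h0 := summable_mul_of_summable_norm hA.norm hB.norm
    have hinj : Function.Injective fun x : (Fin 2 → ℤ) × (Fin 2 → ℤ) => (x.2, m - x.1 - x.2) := by
      rintro ⟨p, n⟩ ⟨p', n'⟩ h
      simp only [Prod.mk.injEq] at h
      obtain ⟨rfl, h⟩ := h
      rw [sub_left_inj, sub_right_inj] at h
      rw [h]
    refine Summable.of_norm_bounded ((h0.comp_injective hinj).mul_left C) ?_
    rintro ⟨p, n⟩
    simp only [Function.uncurry_apply_pair, Function.comp_apply, norm_mul]
    exact mul_le_mul_of_nonneg_right (hF p) (by positivity)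
  simp only [conv, ← tsum_mul_left]
  rw [← h1.tsum_comm]
  refine tsum_congr fun n => tsum_congr fun p => ?_
  rw [sub_right_comm]
  ring

/-- The sum of a convolution is the product of the sums. -/
theorem hasSum_conv (hA : Summable fun n => ‖A n‖) (hB : Summable fun n => ‖B n‖) :
    HasSum (conv A B) ((∑' n, A n) * ∑' n, B n) := by
  have h := hA.of_norm.hasSum.mul hB.of_norm.hasSum
    (summable_mul_of_summable_norm hA hB)
  let e : (Fin 2 → ℤ) × (Fin 2 → ℤ) ≃ (Fin 2 → ℤ) × (Fin 2 → ℤ) :=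
    { toFun := fun x => (x.2, x.1 - x.2)
      invFun := fun x => (x.1 + x.2, x.1)
      left_inv := fun x => by simp
      right_inv := fun x => by simp }
  obtain ⟨C, hC⟩ : ∃ C, ∀ n, ‖B n‖ ≤ C :=
    ⟨∑' n, ‖B n‖, fun n => hB.le_tsum n fun _ _ => norm_nonneg _⟩
  exact ((e.hasSum_iff).mpr h).prod_fiberwise fun m => (summable_conv hA hC m).hasSum

theorem hasSum_conv_expChar (hA : Summable fun n => ‖A n‖) (hB : Summable fun n => ‖B n‖) (z : ℂ) :
    HasSum (fun m => conv A B m * expChar (dbarSymbol m) z)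
      ((∑' n, A n * expChar (dbarSymbol n) z) * ∑' n, B n * expChar (dbarSymbol n) z) := by
  have h := hasSum_conv (A := fun n => A n * expChar (dbarSymbol n) z)
    (B := fun n => B n * expChar (dbarSymbol n) z)
    (by simpa only [norm_mul, norm_expChar, mul_one] using hA)
    (by simpa only [norm_mul, norm_expChar, mul_one] using hB)
  refine h.congr_fun fun m => ?_
  rw [conv, conv, ← tsum_mul_right]
  refine tsum_congr fun n => ?_
  have e : dbarSymbol m = dbarSymbol n + dbarSymbol (m - n) := by
    simp only [dbarSymbol, Pi.sub_apply]
    push_cast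
    ring
  rw [e, expChar_add_left]
  ring

/-- The weight is submultiplicative, so wt m ^ s distributes over the two factors of the
convolution. -/
theorem exists_wt_pow_mul_norm_conv_le (hA : RapidDecay A) {s : ℕ} {C : ℝ}
    (hB : ∀ n, wt n ^ s * ‖B n‖ ≤ C) : ∃ C', ∀ n, wt n ^ s * ‖conv A B n‖ ≤ C' := by
  refine ⟨(∑' n, wt n ^ s * ‖A n‖) * C, fun m => ?_⟩
  have hp : ∀ n, 0 ≤ wt n ^ s := fun n => pow_nonneg (wt_pos n).le s
  have e : wt m ^ s * ‖conv A B m‖ = ‖∑' n, ((wt m ^ s : ℝ) : ℂ) * (A n * B (m - n))‖ := by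
    rw [tsum_mul_left, norm_mul, Complex.norm_real, Real.norm_of_nonneg (hp m)]
    rfl
  rw [e]
  refine tsum_of_norm_bounded ((hA.summable s).hasSum.mul_right C) fun n => ?_
  rw [norm_mul, norm_mul, Complex.norm_real, Real.norm_of_nonneg (hp m)]
  have h : wt m ^ s ≤ wt n ^ s * wt (m - n) ^ s := by
    rw [← mul_pow]
    exact pow_le_pow_left₀ (wt_pos m).le (wt_le_mul m n) s
  calc wt m ^ s * (‖A n‖ * ‖B (m - n)‖)
      ≤ wt n ^ s * wt (m - n) ^ s * (‖A n‖ * ‖B (m - n)‖) := by gcongr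
    _ = wt n ^ s * ‖A n‖ * (wt (m - n) ^ s * ‖B (m - n)‖) := by ring
    _ ≤ wt n ^ s * ‖A n‖ * C :=
      mul_le_mul_of_nonneg_left (hB _) (mul_nonneg (hp n) (norm_nonneg _))

end Conv

/-! ### The equation `(D(α) - k) u = 0` for Fourier coefficients -/

theorem dbarSymbol_add (m n : Fin 2 → ℤ) :
    dbarSymbol (m + n) = dbarSymbol m + dbarSymbol n := by
  simp only [dbarSymbol, Pi.add_apply]
  push_cast
  ring

theorem dbarSymbol_sub (m n : Fin 2 → ℤ) :
    dbarSymbol (m - n) = dbarSymbol m - dbarSymbol n := by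
  simp only [dbarSymbol, Pi.sub_apply]
  push_cast
  ring

theorem dbarSymbol_neg (n : Fin 2 → ℤ) : dbarSymbol (-n) = -dbarSymbol n := by
  simp only [dbarSymbol, Pi.neg_apply]
  push_cast
  ring

theorem mem_dualLattice_iff (k : ℂ) : k ∈ dualLattice ↔ ∃ n, k = dbarSymbol n := by
  refine ⟨?_, ?_⟩
  · rintro ⟨a, b, rfl⟩
    refine ⟨![b, -a], ?_⟩
    simp only [dbarSymbol, Matrix.cons_val_zero, Matrix.cons_val_one]
    push_cast
    ring
  · rintro ⟨n, rfl⟩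
    refine ⟨-n 1, n 0, ?_⟩
    simp only [dbarSymbol]
    push_cast
    ring

/-- Bounded families of Fourier coefficients that satisfy `(D(α) - k) u = 0`. -/
structure IsSolution (U : Potential) (α k : ℂ) (a : Fin 2 → (Fin 2 → ℤ) → ℂ) : Prop where
  bounded : ∃ C, ∀ i m, ‖a i m‖ ≤ C
  eq : ∀ i m, (dbarSymbol m - k) * a i m + α * conv (U.fourier i) (a (i + 1)) m = 0

/-- The Fourier modes of the `i`-th component of functions in the sector `r`. -/
def SectorMode (r : Fin 2 → ℤ) (i : Fin 2) (m : Fin 2 → ℤ) : Prop :=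
  ∀ j, (3 : ℤ) ∣ m j - r j - residue i

/-- The condition that all Fourier modes lie in the sector `r`. -/
def InSector (r : Fin 2 → ℤ) (a : Fin 2 → (Fin 2 → ℤ) → ℂ) : Prop :=
  ∀ i m, ¬ SectorMode r i m → a i m = 0

theorem sectorMode_sub_iff {U : Potential} {i : Fin 2} {n : Fin 2 → ℤ} (hn : U.fourier i n ≠ 0)
    (r m : Fin 2 → ℤ) : SectorMode r (i + 1) (m - n) ↔ SectorMode r i m := by
  refine forall_congr' fun j => ?_
  rw [show (m - n) j - r j - residue (i + 1)
    = m j - r j - residue i - (n j - (residue i - residue (i + 1))) by simp; ring]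
  exact dvd_sub_left (U.fourier_support i n hn j)

theorem conv_eq_zero_of_inSector {U : Potential} {i : Fin 2} {r : Fin 2 → ℤ}
    {b : (Fin 2 → ℤ) → ℂ} (hb : ∀ m, ¬ SectorMode r (i + 1) m → b m = 0) {m : Fin 2 → ℤ}
    (hm : ¬ SectorMode r i m) : conv (U.fourier i) b m = 0 := by
  rw [conv, ← tsum_zero (β := Fin 2 → ℤ)]
  refine tsum_congr fun n => ?_
  by_cases hn : U.fourier i n = 0
  · rw [hn, zero_mul]
  · rw [hb _ (mt (sectorMode_sub_iff hn r m).mp hm), mul_zero]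

namespace IsSolution

variable {U : Potential} {α k : ℂ} {a : Fin 2 → (Fin 2 → ℤ) → ℂ}

/-- Elliptic bootstrap: convolution with the coefficients of U preserves a given decay rate, and
dividing by the symbol improves it by one power. Starting from mere boundedness matters, because
products with a singular function are at first only known to have bounded coefficients. -/
theorem rapidDecay (ha : IsSolution U α k a) (i : Fin 2) : RapidDecay (a i) := by
  suffices h : ∀ s : ℕ, ∃ C, ∀ i n, wt n ^ s * ‖a i n‖ ≤ C by
    intro s
    obtain ⟨C, hC⟩ := h s
    exact ⟨C, hC i⟩
  intro s
  induction s with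
  | zero => simpa using ha.bounded
  | succ s ih =>
    obtain ⟨C, hC⟩ := ih
    choose C' hC' using fun i => exists_wt_pow_mul_norm_conv_le (U.rapidDecay_fourier i)
      (hC (i + 1))
    refine ⟨(2 + 2 * ‖k‖) * (C + ‖α‖ * (|C' 0| + |C' 1|)), fun i n => ?_⟩
    have hC'' : C' i ≤ |C' 0| + |C' 1| := by
      fin_cases i
      · exact (le_abs_self _).trans (le_add_of_nonneg_right (abs_nonneg _))
      · exact (le_abs_self _).trans (le_add_of_nonneg_left (abs_nonneg _))
    have hw : 0 ≤ wt n ^ s := pow_nonneg (wt_pos n).le s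
    have h1 : ‖dbarSymbol n - k‖ * ‖a i n‖ = ‖α‖ * ‖conv (U.fourier i) (a (i + 1)) n‖ := by
      rw [← norm_mul, ← norm_mul, eq_neg_of_add_eq_zero_left (ha.eq i n), norm_neg]
    calc wt n ^ (s + 1) * ‖a i n‖ = wt n * (wt n ^ s * ‖a i n‖) := by ring
      _ ≤ (2 + 2 * ‖k‖) * (1 + ‖dbarSymbol n - k‖) * (wt n ^ s * ‖a i n‖) := by
        gcongr
        exact wt_le_mul_norm_dbarSymbol_sub k n
      _ = (2 + 2 * ‖k‖) * (wt n ^ s * ‖a i n‖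
          + wt n ^ s * (‖dbarSymbol n - k‖ * ‖a i n‖)) := by ring
      _ = (2 + 2 * ‖k‖) * (wt n ^ s * ‖a i n‖
          + ‖α‖ * (wt n ^ s * ‖conv (U.fourier i) (a (i + 1)) n‖)) := by rw [h1]; ring
      _ ≤ (2 + 2 * ‖k‖) * (C + ‖α‖ * (|C' 0| + |C' 1|)) := by
        gcongr
        · exact hC i n
        · exact (hC' i n).trans hC''

theorem summable_norm (ha : IsSolution U α k a) (i : Fin 2) : Summable fun n => ‖a i n‖ :=
  (ha.rapidDecay i).summable_norm

/-- On the function side this is multiplication by a character, which commutes with the potential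
and shifts k by an element of Γ*. -/
theorem shift (ha : IsSolution U α k a) (r : Fin 2 → ℤ) :
    IsSolution U α (k - dbarSymbol r) fun i m => a i (m + r) where
  bounded := by
    obtain ⟨C, hC⟩ := ha.bounded
    exact ⟨C, fun i m => hC i _⟩
  eq i m := by
    have h := ha.eq i (m + r)
    rw [dbarSymbol_add] at h
    have e : conv (U.fourier i) (fun m => a (i + 1) (m + r)) m
        = conv (U.fourier i) (a (i + 1)) (m + r) := by
      refine tsum_congr fun n => ?_
      beta_reduce
      rw [sub_add_eq_add_sub]
    rw [e, ← h]
    ring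

-- The potential respects sectors, so cutting the Fourier modes to one sector commutes with the
-- equation.
open scoped Classical in
theorem restrict (ha : IsSolution U α k a) (r : Fin 2 → ℤ) :
    IsSolution U α k fun i m => if SectorMode r i m then a i m else 0 where
  bounded := by
    obtain ⟨C, hC⟩ := ha.bounded
    refine ⟨C, fun i m => ?_⟩
    split_ifs
    · exact hC i m
    · rw [norm_zero]
      exact (norm_nonneg _).trans (hC i m)
  eq i m := by
    split_ifs with hm
    · refine Eq.trans ?_ (ha.eq i m)
      congr 2
      refine tsum_congr fun n => ?_
      by_cases hn : U.fourier i n = 0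
      · rw [hn, zero_mul, zero_mul]
      · beta_reduce
        rw [if_pos ((sectorMode_sub_iff hn r m).mpr hm)]
    · rw [conv_eq_zero_of_inSector (r := r) (fun m hm => if_neg hm) hm, mul_zero, mul_zero,
        add_zero]

/-- A solution has a nonzero component in some sector, which can be shifted to the sector `0`. -/
theorem exists_inSector_zero (ha : IsSolution U α k a) (h0 : a ≠ 0) :
    ∃ (r : Fin 2 → ℤ) (b : Fin 2 → (Fin 2 → ℤ) → ℂ),
      IsSolution U α (k - dbarSymbol r) b ∧ InSector 0 b ∧ b ≠ 0 := by
  classical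
  obtain ⟨i, m, him⟩ : ∃ i m, a i m ≠ 0 := by
    by_contra! h
    exact h0 (funext fun i => funext fun m => h i m)
  refine ⟨fun j => m j - residue i, _, (ha.restrict fun j => m j - residue i).shift _, ?_, ?_⟩
  · intro i' m' hm'
    refine if_neg fun h => hm' fun j => ?_
    simpa using h j
  · intro h
    have h1 := congrFun (congrFun h i) (m - fun j => m j - residue i)
    simp only [sub_add_cancel, Pi.zero_apply, ite_eq_right_iff] at h1
    exact him (h1 fun j => by simp)

end IsSolution

/-! ### Compactness -/

theorem exists_repr_eq {a : (Fin 2 → ℤ) → ℂ} (ha : Summable fun n => ‖a n‖) :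
    ∃ u : L2, ∀ n, fourierBasis.repr u n = a n := by
  have h1 : Memℓp a 1 := by
    refine memℓp_gen ?_
    simpa using ha
  refine ⟨fourierBasis.repr.symm ⟨a, h1.of_exponent_ge (by norm_num)⟩, fun n => ?_⟩
  rw [LinearIsometryEquiv.apply_symm_apply]

theorem exists_repr_eq_pi {a : Fin 2 → (Fin 2 → ℤ) → ℂ} (ha : ∀ i, Summable fun n => ‖a i n‖) :
    ∃ u : L2Two, ∀ i n, fourierBasis.repr (u i) n = a i n := by
  choose u hu using fun i => exists_repr_eq (ha i)
  exact ⟨WithLp.toLp 2 u, hu⟩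

/-- Cutting the symbol to a finite set of modes gives finite rank operators, which converge in norm
because the symbol tends to 0. -/
theorem isCompactOperator_fourierMul {m : (Fin 2 → ℤ) → ℂ} (hm : ∃ C : ℝ, ∀ n, ‖m n‖ ≤ C)
    (h0 : Filter.Tendsto m Filter.cofinite (nhds 0)) : IsCompactOperator (fourierMul m hm) := by
  classical
  have hb : ∀ S : Finset (Fin 2 → ℤ), ∃ C : ℝ, ∀ n, ‖if n ∈ S then m n else 0‖ ≤ C := by
    intro S
    obtain ⟨C, hC⟩ := hm
    refine ⟨C, fun n => ?_⟩
    split_ifs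
    · exact hC n
    · rw [norm_zero]
      exact (norm_nonneg _).trans (hC n)
  refine isCompactOperator_of_tendsto (l := Filter.atTop)
    (F := fun S => fourierMul (fun n => if n ∈ S then m n else 0) (hb S)) ?_
    (Filter.Eventually.of_forall fun S => ?_)
  · rw [Metric.tendsto_nhds]
    intro ε hε
    have hfin : {n | ¬ ‖m n‖ < ε / 2}.Finite := by
      have := (Metric.tendsto_nhds.mp h0) (ε / 2) (by positivity)
      simp only [dist_zero_right] at this
      exact this
    filter_upwards [Filter.eventually_ge_atTop hfin.toFinset] with S hS
    rw [dist_eq_norm]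
    refine lt_of_le_of_lt (ContinuousLinearMap.opNorm_le_bound _ (by positivity) fun u => ?_)
      (half_lt_self hε)
    refine norm_le_of_repr_le (by positivity) fun n => ?_
    rw [sub_apply, map_sub, lp.coeFn_sub, Pi.sub_apply, repr_fourierMul, repr_fourierMul]
    by_cases hn : n ∈ S
    · rw [if_pos hn, sub_self, norm_zero]
      positivity
    · rw [if_neg hn, zero_mul, zero_sub, norm_neg, norm_mul]
      have : ‖m n‖ < ε / 2 := by
        by_contra h
        exact hn (hS (hfin.mem_toFinset.mpr h))
      gcongr
  · have e : (fourierMul (fun n => if n ∈ S then m n else 0) (hb S) : L2 → L2)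
        = (∑ n ∈ S, m n • ((innerSL ℂ (fourierBasis n)).smulRight (fourierBasis n)) :
          L2 →L[ℂ] L2) := by
      funext u
      refine ext_repr fun k => ?_
      rw [repr_fourierMul, sum_apply, map_sum, lp.coeFn_sum, Finset.sum_apply]
      simp only [smul_apply, ContinuousLinearMap.smulRight_apply, innerSL_apply_apply, map_smul,
        lp.coeFn_smul, Pi.smul_apply, smul_eq_mul, repr_basis, ← fourierBasis.repr_apply_apply]
      simp [ite_mul]
    rw [e]
    have hfd : ∀ n, IsCompactOperator
        ((innerSL ℂ (fourierBasis n)).smulRight (fourierBasis n) : L2 →L[ℂ] L2) := fun n =>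
      (isCompactOperator_of_locallyCompactSpace_dom
        (innerSL ℂ (fourierBasis n) : L2 →L[ℂ] ℂ)).clm_comp
        ((ContinuousLinearMap.id ℂ ℂ).smulRight (fourierBasis n))
    exact Submodule.sum_mem (compactOperator (RingHom.id ℂ) L2 L2) fun n _ =>
      Submodule.smul_mem _ _ (hfd n)

theorem matOp_diagonal_apply (X : Fin 2 → (L2 →L[ℂ] L2)) (u : L2Two) (i : Fin 2) :
    matOp (Matrix.diagonal X) u i = X i (u i) := by
  rw [matOp_apply]
  fin_cases i <;> simp

theorem isCompactOperator_matOp_diagonal {X : Fin 2 → (L2 →L[ℂ] L2)}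
    (hX : ∀ i, IsCompactOperator (X i)) : IsCompactOperator (matOp (Matrix.diagonal X)) := by
  let ι (i : Fin 2) : L2 →L[ℂ] L2Two :=
    (PiLp.continuousLinearEquiv 2 ℂ fun _ : Fin 2 => L2).symm.toContinuousLinearMap ∘L
      ContinuousLinearMap.single ℂ (fun _ : Fin 2 => L2) i
  have h : ∀ i, IsCompactOperator
      (ι i ∘L X i ∘L PiLp.proj (𝕜 := ℂ) 2 (fun _ : Fin 2 => L2) i) := fun i =>
    ((hX i).comp_clm _).clm_comp (ι i)
  have e : (matOp (Matrix.diagonal X) : L2Two → L2Two)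
      = (∑ i, ι i ∘L X i ∘L PiLp.proj (𝕜 := ℂ) 2 (fun _ : Fin 2 => L2) i :
        L2Two →L[ℂ] L2Two) := by
    funext u
    ext1 i
    rw [matOp_diagonal_apply, Fin.sum_univ_two]
    fin_cases i <;> simp [ι]
  rw [e, Fin.sum_univ_two]
  exact (h 0).add (h 1)

theorem tendsto_inv_dbarSymbol_sub (k : ℂ) :
    Filter.Tendsto (fun n => (dbarSymbol n - k)⁻¹) Filter.cofinite (nhds 0) := by
  refine Filter.tendsto_inv₀_cobounded.comp (tendsto_norm_atTop_iff_cobounded.mp ?_)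
  have h : Filter.Tendsto (fun n : Fin 2 → ℤ => (1 / 2) * ‖n‖ - ‖k‖) Filter.cofinite
      Filter.atTop := by
    rw [← Filter.cocompact_eq_cofinite]
    exact Filter.tendsto_atTop_add_const_right _ _
      ((tendsto_norm_cocompact_atTop (E := Fin 2 → ℤ)).const_mul_atTop (by norm_num))
  refine Filter.tendsto_atTop_mono (fun n => ?_) h
  have h1 := norm_le_two_mul_norm_dbarSymbol n
  have h2 := norm_le_norm_sub_add (dbarSymbol n) k
  linarith

theorem isCompactOperator_resolvent (k : ℂ) : IsCompactOperator (resolvent k) :=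
  isCompactOperator_fourierMul _ (tendsto_inv_dbarSymbol_sub k)

theorem isCompactOperator_Top (U : Potential) (k : ℂ) : IsCompactOperator (Top U k) := by
  have e : diagOp (resolvent k) = matOp (Matrix.diagonal fun _ => resolvent k) := by
    ext1 u
    ext1 i
    rw [diagOp_apply, matOp_diagonal_apply]
  rw [Top, e]
  exact (isCompactOperator_matOp_diagonal fun _ => isCompactOperator_resolvent k).comp_clm _

/-! ### Solutions as elements of `L²` -/

theorem Potential.repr_mulOp_comp (U : Potential) (i : Fin 2) (u : L2) (m : Fin 2 → ℤ) :
    fourierBasis.repr (mulOp (U.comp i) u) m = conv (U.fourier i) (fun n => fourierBasis.repr u n) m :=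
  (U.hasSum_repr_mulOp_comp i u m).tsum_eq.symm

theorem conv_neg_right (A B : (Fin 2 → ℤ) → ℂ) (m : Fin 2 → ℤ) :
    conv A (fun n => -B n) m = -conv A B m := by
  simp only [conv, mul_neg, tsum_neg]

/-- A magic parameter gives a nonzero solution for some `k ∉ Γ*`. -/
theorem exists_isSolution_of_mem_magicSet {U : Potential} {α : ℂ} (hα : α ∈ magicSet U) :
    ∃ k ∉ dualLattice, ∃ a, IsSolution U α k a ∧ a ≠ 0 := by
  obtain ⟨k, hk, lam, hlam, h0, rfl⟩ := hα
  refine ⟨k, hk, ?_⟩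
  rw [← (isCompactOperator_Top U k).hasEigenvalue_iff_mem_spectrum h0] at hlam
  obtain ⟨u, hu⟩ := hlam.exists_hasEigenvector
  have hu1 : Top U k u = lam • u := hu.apply_eq_smul
  have key : ∀ i m, (dbarSymbol m - k) * (lam * fourierBasis.repr (u i) m)
      = conv (U.fourier i) (fun n => fourierBasis.repr (u (i + 1)) n) m := by
    intro i m
    have h1 : Top U k u i = lam • u i := by rw [hu1]; rfl
    have h2 : Top U k u i = resolvent k (mulOp (U.comp i) (u (i + 1))) := by
      rw [Top, ContinuousLinearMap.comp_apply, diagOp_apply, U.potentialOp_apply]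
    have h3 := congrArg (fun v : L2 => fourierBasis.repr v m) (h2.symm.trans h1)
    simp only [resolvent, repr_fourierMul, U.repr_mulOp_comp, map_smul, lp.coeFn_smul,
      Pi.smul_apply, smul_eq_mul] at h3
    rw [← h3, mul_inv_cancel_left₀]
    exact fun h => hk ((mem_dualLattice_iff k).mpr ⟨m, (sub_eq_zero.mp h).symm⟩)
  -- From T_k u = λu one gets (2 D_{z̄} - k)u = λ⁻¹Vu, with V the potential matrix. Changing the
  -- sign of the second component reverses the sign of the off-diagonal V and yields (D(1/λ) - k)u =
  -- 0.
  refine ⟨![fun m => fourierBasis.repr (u 0) m, fun m => -fourierBasis.repr (u 1) m],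
    ⟨⟨‖u 0‖ + ‖u 1‖, fun i m => ?_⟩, fun i m => ?_⟩, fun h => hu.2 ?_⟩
  · have h0 := norm_repr_le (u 0) m
    have h1 := norm_repr_le (u 1) m
    fin_cases i
    · exact h0.trans (le_add_of_nonneg_right (norm_nonneg _))
    · simpa using h1.trans (le_add_of_nonneg_left (norm_nonneg (u 0)))
  · fin_cases i
    · have := key 0 m
      simp only [Fin.zero_eta, Matrix.cons_val_zero, zero_add, Matrix.cons_val_one,
        conv_neg_right] at this ⊢
      rw [← this]
      field_simp
      ring
    · have := key 1 m
      simp only [Fin.mk_one, Matrix.cons_val_one, Fin.reduceAdd, Matrix.cons_val_zero] at this ⊢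
      rw [← this]
      field_simp
      ring
  · ext1 i
    refine ext_repr fun m => ?_
    have hm := congrFun (congrFun h i) m
    fin_cases i
    · simpa using hm
    · simpa using hm

/-! ### Solutions in the sector `0` for varying `k` -/

/-- The set of all `k` for which `(D(α) - k) u = 0` has a nonzero solution in the sector `0`. -/
def solvableSet (U : Potential) (α : ℂ) : Set ℂ :=
  {k | ∃ a, IsSolution U α k a ∧ InSector 0 a ∧ a ≠ 0}

open scoped Classical in
/-- The symbol of `(2 D_{z̄} - k)⁻¹` on the sector `0`. -/
def sectorSymbol (k : ℂ) (i : Fin 2) (n : Fin 2 → ℤ) : ℂ :=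
  if SectorMode 0 i n then (dbarSymbol n - k)⁻¹ else 0

theorem norm_sectorSymbol_le (k : ℂ) (i : Fin 2) (n : Fin 2 → ℤ) :
    ‖sectorSymbol k i n‖ ≤ ‖(dbarSymbol n - k)⁻¹‖ := by
  rw [sectorSymbol]
  split_ifs
  · exact le_rfl
  · rw [norm_zero]
    exact norm_nonneg _

theorem sectorSymbol_bounded (k : ℂ) (i : Fin 2) : ∃ C : ℝ, ∀ n, ‖sectorSymbol k i n‖ ≤ C := by
  obtain ⟨C, hC⟩ := resolventSymbol_bounded k
  exact ⟨C, fun n => (norm_sectorSymbol_le k i n).trans (hC n)⟩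

/-- The resolvent on the sector `0`. -/
def sectorResolvent (k : ℂ) : L2Two →L[ℂ] L2Two :=
  matOp (Matrix.diagonal fun i => fourierMul (sectorSymbol k i) (sectorSymbol_bounded k i))

theorem isCompactOperator_sectorResolvent (k : ℂ) : IsCompactOperator (sectorResolvent k) :=
  isCompactOperator_matOp_diagonal fun i => isCompactOperator_fourierMul _
    (squeeze_zero_norm (norm_sectorSymbol_le k i) (by
      simpa using (tendsto_inv_dbarSymbol_sub k).norm))

/-- The operator `K` for which the equation `K u = -u` expresses that `u` is a solution in the
sector `0`. -/
def sectorOp (U : Potential) (α k₀ k : ℂ) : L2Two →L[ℂ] L2Two :=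
  sectorResolvent k₀ ∘L ((k₀ - k) • ContinuousLinearMap.id ℂ L2Two + α • potentialOp U)

theorem repr_sectorOp (U : Potential) (α k₀ k : ℂ) (u : L2Two) (i : Fin 2) (m : Fin 2 → ℤ) :
    fourierBasis.repr (sectorOp U α k₀ k u i) m = sectorSymbol k₀ i m *
      ((k₀ - k) * fourierBasis.repr (u i) m
        + α * conv (U.fourier i) (fun n => fourierBasis.repr (u (i + 1)) n) m) := by
  rw [sectorOp, ContinuousLinearMap.comp_apply, sectorResolvent, matOp_diagonal_apply,
    repr_fourierMul, add_apply, smul_apply, smul_apply, PiLp.add_apply, PiLp.smul_apply,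
    PiLp.smul_apply, U.potentialOp_apply]
  simp only [map_add, map_smul, lp.coeFn_add, lp.coeFn_smul, Pi.add_apply, Pi.smul_apply,
    smul_eq_mul, U.repr_mulOp_comp, ContinuousLinearMap.id_apply]

/-- Applying (2 D_{z̄} - k₀)⁻¹ rewrites the equation as Ku = -u with K compact, so solvability
becomes a spectral condition. The auxiliary k₀ ∉ Γ* is fixed while k varies freely, including over
Γ*. -/
theorem mem_solvableSet_iff (U : Potential) (α k : ℂ) {k₀ : ℂ} (hk₀ : k₀ ∉ dualLattice) :
    k ∈ solvableSet U α ↔ -1 ∈ spectrum ℂ (sectorOp U α k₀ k) := by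
  have hd : ∀ m, dbarSymbol m - k₀ ≠ 0 := fun m h =>
    hk₀ ((mem_dualLattice_iff k₀).mpr ⟨m, (sub_eq_zero.mp h).symm⟩)
  have hc : IsCompactOperator (sectorOp U α k₀ k) :=
    (isCompactOperator_sectorResolvent k₀).comp_clm _
  rw [← hc.hasEigenvalue_iff_mem_spectrum (by norm_num)]
  constructor
  · rintro ⟨a, ha, hs, h0⟩
    obtain ⟨u, hu⟩ := exists_repr_eq_pi ha.summable_norm
    refine Module.End.hasEigenvalue_of_hasEigenvector (x := u)
      (Module.End.hasEigenvector_iff.mpr ⟨?_, ?_⟩)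
    · rw [Module.End.mem_eigenspace_iff]
      change sectorOp U α k₀ k u = (-1 : ℂ) • u
      ext1 i
      refine ext_repr fun m => ?_
      rw [repr_sectorOp, PiLp.smul_apply, map_smul, lp.coeFn_smul, Pi.smul_apply, smul_eq_mul]
      simp only [hu]
      rw [sectorSymbol]
      split_ifs with hm
      · have := ha.eq i m
        rw [inv_mul_eq_iff_eq_mul₀ (hd m)]
        linear_combination this
      · rw [hs i m hm]
        ring
    · rintro rfl
      refine h0 (funext fun i => funext fun m => ?_)
      rw [← hu i m]
      simp
  · intro h
    obtain ⟨u, hu⟩ := h.exists_hasEigenvector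
    have hu1 : sectorOp U α k₀ k u = (-1 : ℂ) • u := hu.apply_eq_smul
    have key : ∀ i m, sectorSymbol k₀ i m * ((k₀ - k) * fourierBasis.repr (u i) m
        + α * conv (U.fourier i) (fun n => fourierBasis.repr (u (i + 1)) n) m)
        = -fourierBasis.repr (u i) m := by
      intro i m
      rw [← repr_sectorOp, hu1, PiLp.smul_apply, map_smul, lp.coeFn_smul, Pi.smul_apply,
        smul_eq_mul, neg_one_mul]
    -- The symbol is 0 off the sector, so K maps into the sector and its eigenvectors for -1 lie
    -- there automatically.
    have hs : InSector 0 fun i m => fourierBasis.repr (u i) m := by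
      intro i m hm
      have := key i m
      rw [sectorSymbol, if_neg hm, zero_mul] at this
      exact neg_eq_zero.mp this.symm
    refine ⟨fun i m => fourierBasis.repr (u i) m,
      ⟨⟨‖u 0‖ + ‖u 1‖, fun i m => ?_⟩, fun i m => ?_⟩, hs, fun h => hu.2 ?_⟩
    · refine (norm_repr_le (u i) m).trans ?_
      fin_cases i
      · exact le_add_of_nonneg_right (norm_nonneg _)
      · exact le_add_of_nonneg_left (norm_nonneg _)
    · by_cases hm : SectorMode 0 i m
      · have := key i m
        rw [sectorSymbol, if_pos hm, inv_mul_eq_iff_eq_mul₀ (hd m)] at this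
        linear_combination this
      · rw [conv_eq_zero_of_inSector (hs (i + 1)) hm]
        simp only [hs i m hm]
        ring
    · ext1 i
      refine ext_repr fun m => ?_
      simpa using congrFun (congrFun h i) m

/-- `sectorOp` is affine in k and invertibility is an open condition. -/
theorem isClosed_solvableSet (U : Potential) (α : ℂ) {k₀ : ℂ} (hk₀ : k₀ ∉ dualLattice) :
    IsClosed (solvableSet U α) := by
  have e : (solvableSet U α)ᶜ = (fun k => algebraMap ℂ (L2Two →L[ℂ] L2Two) (-1)
      - sectorOp U α k₀ k) ⁻¹' {X | IsUnit X} := by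
    ext k
    rw [Set.mem_compl_iff, mem_solvableSet_iff U α k hk₀, spectrum.mem_iff, not_not]
    rfl
  rw [← isOpen_compl_iff, e]
  refine Units.isOpen.preimage (continuous_const.sub ?_)
  unfold sectorOp
  fun_prop

/-! ### The Cauchy-Riemann operator on smooth functions -/

/-- The function `f` is real differentiable at `z`, with `(∂_x + i ∂_y) f = w` at `z`. -/
def HasDbar (f : ℂ → ℂ) (w z : ℂ) : Prop :=
  ∃ L : ℂ →L[ℝ] ℂ, HasFDerivAt f L z ∧ L 1 + Complex.I * L Complex.I = w

namespace HasDbar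

variable {f g : ℂ → ℂ} {v w z : ℂ}

theorem differentiableAt (h : HasDbar f w z) : DifferentiableAt ℝ f z :=
  h.choose_spec.1.differentiableAt

theorem unique (h : HasDbar f w z) (h' : HasDbar f v z) : w = v := by
  obtain ⟨L, h1, rfl⟩ := h
  obtain ⟨L', h2, rfl⟩ := h'
  rw [h1.unique h2]

theorem mul (hf : HasDbar f v z) (hg : HasDbar g w z) :
    HasDbar (fun z => f z * g z) (v * g z + f z * w) z := by
  obtain ⟨L, h1, rfl⟩ := hf
  obtain ⟨L', h2, rfl⟩ := hg
  refine ⟨_, h1.mul h2, ?_⟩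
  simp only [add_apply, smul_apply, smul_eq_mul]
  ring

theorem sub (hf : HasDbar f v z) (hg : HasDbar g w z) :
    HasDbar (fun z => f z - g z) (v - w) z := by
  obtain ⟨L, h1, rfl⟩ := hf
  obtain ⟨L', h2, rfl⟩ := hg
  refine ⟨_, h1.sub h2, ?_⟩
  simp only [sub_apply]
  ring

theorem comp_mul_left (c : ℂ) (hf : HasDbar f w (c * z)) :
    HasDbar (fun z => f (c * z)) (conj c * w) z := by
  obtain ⟨L, h1, rfl⟩ := hf
  have h2 : HasFDerivAt (fun z => c * z) (c • ContinuousLinearMap.id ℝ ℂ) z :=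
    (hasFDerivAt_id z).const_mul c
  refine ⟨_, h1.comp z h2, ?_⟩
  have hL : ∀ v : ℂ, L v = v.re * L 1 + v.im * L Complex.I := by
    intro v
    conv_lhs => rw [← Complex.re_add_im v, ← mul_one (v.re : ℂ), ← Complex.real_smul,
      ← Complex.real_smul, map_add, map_smul, map_smul]
    simp
  have hc : conj c = c.re - c.im * Complex.I := by
    apply Complex.ext <;> simp
  simp only [ContinuousLinearMap.comp_apply, smul_apply, ContinuousLinearMap.id_apply, smul_eq_mul]
  rw [hL (c * 1), hL (c * Complex.I), hc]
  simp only [mul_one, Complex.mul_re, Complex.mul_im, Complex.I_re, Complex.I_im, mul_zero, zero_sub,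
    add_zero]
  push_cast
  linear_combination ((c.im : ℂ) * L Complex.I) * Complex.I_sq

end HasDbar

/-! ### Characters of ℂ and a Liouville theorem -/

/-- The real derivative of `z ↦ exp (i Re (d z̄))`. -/
def expCharDeriv (d z : ℂ) : ℂ →L[ℝ] ℂ :=
  (expChar d z * Complex.I) • (Complex.ofRealCLM ∘L Complex.reCLM ∘L
    (d • (Complex.conjCLE : ℂ →L[ℝ] ℂ)))

theorem expCharDeriv_apply (d z v : ℂ) :
    expCharDeriv d z v = expChar d z * Complex.I * ((d * conj v).re : ℝ) := rfl

theorem hasFDerivAt_expChar (d z : ℂ) : HasFDerivAt (expChar d) (expCharDeriv d z) z := by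
  have h : HasFDerivAt (fun z => (((d * conj z).re : ℝ) : ℂ) * Complex.I)
      (Complex.I • (Complex.ofRealCLM ∘L Complex.reCLM ∘L
        (d • (Complex.conjCLE : ℂ →L[ℝ] ℂ)))) z :=
    (Complex.ofRealCLM ∘L Complex.reCLM ∘L
        (d • (Complex.conjCLE : ℂ →L[ℝ] ℂ))).hasFDerivAt.mul_const Complex.I
  have := h.cexp
  rwa [smul_smul] at this

theorem norm_expCharDeriv_le (d z : ℂ) : ‖expCharDeriv d z‖ ≤ ‖d‖ := by
  refine ContinuousLinearMap.opNorm_le_bound _ (norm_nonneg _) fun v => ?_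
  rw [expCharDeriv_apply, norm_mul, norm_mul, norm_expChar, Complex.norm_I, one_mul, one_mul,
    Complex.norm_real]
  refine (Complex.abs_re_le_norm _).trans ?_
  rw [norm_mul, Complex.norm_conj]

theorem expCharDeriv_dbar (d z : ℂ) : expCharDeriv d z 1 + Complex.I * expCharDeriv d z Complex.I
    = Complex.I * d * expChar d z := by
  rw [expCharDeriv_apply, expCharDeriv_apply]
  simp
  linear_combination (Complex.I * expChar d z) * Complex.re_add_im d

theorem hasDbar_expChar (d z : ℂ) : HasDbar (expChar d) (Complex.I * d * expChar d z) z :=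
  ⟨_, hasFDerivAt_expChar d z, expCharDeriv_dbar d z⟩

/-- Liouville's theorem for solutions of `(2 D_{z̄} - κ) f = 0`. -/
theorem eq_mul_expChar {f : ℂ → ℂ} {κ : ℂ} {C : ℝ} (hC : ∀ z, ‖f z‖ ≤ C)
    (hf : ∀ z, HasDbar f (Complex.I * κ * f z) z) (z : ℂ) : f z = f 0 * expChar κ z := by
  -- Multiplication by the unimodular character with frequency -κ cancels the zeroth-order term; the
  -- product is bounded and entire, hence constant.
  have hg : ∀ z, HasDbar (fun z => f z * expChar (-κ) z) 0 z := by
    intro z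
    have h := (hf z).mul (hasDbar_expChar (-κ) z)
    rwa [show Complex.I * κ * f z * expChar (-κ) z
      + f z * (Complex.I * -κ * expChar (-κ) z) = 0 by ring] at h
  have hd : Differentiable ℂ fun z => f z * expChar (-κ) z := by
    intro z
    obtain ⟨L, h1, h2⟩ := hg z
    rw [differentiableAt_complex_iff_differentiableAt_real, h1.fderiv]
    refine ⟨h1.differentiableAt, ?_⟩
    rw [smul_eq_mul]
    linear_combination (-Complex.I) * h2 + L Complex.I * Complex.I_sq
  have hb : Bornology.IsBounded (Set.range fun z => f z * expChar (-κ) z) := by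
    refine isBounded_iff_forall_norm_le.mpr ⟨C, ?_⟩
    rintro _ ⟨z, rfl⟩
    rw [norm_mul, norm_expChar, mul_one]
    exact hC z
  have h := hd.apply_eq_apply_of_bounded hb z 0
  simp only [expChar_zero_right, mul_one] at h
  rw [← h, mul_assoc, ← expChar_add_left, neg_add_cancel, expChar_zero_left, mul_one]

/-! ### Fourier series -/

/-- The sum of a Fourier series on `ℂ/Γ`. -/
def series (a : (Fin 2 → ℤ) → ℂ) (z : ℂ) : ℂ := ∑' n, a n * expChar (dbarSymbol n) z

theorem hasSum_series {a : (Fin 2 → ℤ) → ℂ} (ha : Summable fun n => ‖a n‖) (z : ℂ) :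
    HasSum (fun n => a n * expChar (dbarSymbol n) z) (series a z) := by
  refine Summable.hasSum (Summable.of_norm ?_)
  simpa only [norm_mul, norm_expChar, mul_one] using ha

theorem isPeriodic_series (a : (Fin 2 → ℤ) → ℂ) : IsPeriodic (series a) := by
  intro p q z
  simp only [series, isPeriodic_expChar _ p q z]

theorem hasDbar_series {a : (Fin 2 → ℤ) → ℂ} (ha : RapidDecay a) {w z : ℂ}
    (hw : HasSum (fun n => a n * (Complex.I * dbarSymbol n * expChar (dbarSymbol n) z)) w) :
    HasDbar (series a) w z := by
  have hu : Summable fun n => wt n * ‖a n‖ := by simpa using ha.summable 1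
  have hb : ∀ n z, ‖a n • expCharDeriv (dbarSymbol n) z‖ ≤ wt n * ‖a n‖ := by
    intro n z
    rw [norm_smul, mul_comm]
    gcongr
    exact (norm_expCharDeriv_le _ _).trans (norm_dbarSymbol_le n)
  refine ⟨_, hasFDerivAt_tsum hu (fun n z => (hasFDerivAt_expChar (dbarSymbol n) z).const_mul (a n))
    hb (x₀ := 0) (hasSum_series ha.summable_norm 0).summable z, ?_⟩
  have hs : HasSum (fun n => a n • expCharDeriv (dbarSymbol n) z)
      (∑' n, a n • expCharDeriv (dbarSymbol n) z) :=
    (Summable.of_norm_bounded hu fun n => hb n z).hasSum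
  have h1 := hs.mapL (ContinuousLinearMap.apply ℝ ℂ (1 : ℂ))
  have h2 := (hs.mapL (ContinuousLinearMap.apply ℝ ℂ Complex.I)).mul_left Complex.I
  refine (h1.add h2).unique (hw.congr_fun fun n => ?_)
  rw [← expCharDeriv_dbar]
  simp
  ring

theorem IsSolution.hasDbar {U : Potential} {α k : ℂ} {a : Fin 2 → (Fin 2 → ℤ) → ℂ}
    (ha : IsSolution U α k a) (i : Fin 2) (z : ℂ) : HasDbar (series (a i))
      (Complex.I * (k * series (a i) z - α * (U.comp i z * series (a (i + 1)) z))) z := by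
  refine hasDbar_series (ha.rapidDecay i) ?_
  have h1 := (hasSum_series (ha.summable_norm i) z).mul_left k
  have h2 := (hasSum_conv_expChar (U.rapidDecay_fourier i).summable_norm
    (ha.summable_norm (i + 1)) z).mul_left α
  have e : ∑' n, U.fourier i n * expChar (dbarSymbol n) z = U.comp i z :=
    (hasSum_coeff_expChar (U.isPeriodic_comp i) (U.contDiff_comp i) z).tsum_eq
  rw [e] at h2
  refine ((h1.sub h2).mul_left Complex.I).congr_fun fun m => ?_
  linear_combination Complex.I * expChar (dbarSymbol m) z * ha.eq i m

theorem series_translate {a : (Fin 2 → ℤ) → ℂ} {i : Fin 2}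
    (ha : ∀ m, ¬ SectorMode 0 i m → a m = 0) (p q : ℤ) (z : ℂ) :
    series a (z + latticePoint (p / 3) (q / 3)) = ω ^ (residue i * (p + q)) * series a z := by
  have hω : ω ≠ 0 := Complex.exp_ne_zero _
  rw [series, series, ← tsum_mul_left]
  refine tsum_congr fun n => ?_
  by_cases hn : SectorMode 0 i n
  · have e : expChar (dbarSymbol n) (latticePoint (p / 3) (q / 3))
        = ω ^ (n 0 * p + n 1 * q) := by
      rw [expChar_dbarSymbol, ω, ← Complex.exp_int_mul]
      congr 1
      push_cast
      ring
    have e2 : ω ^ (n 0 * p + n 1 * q) = ω ^ (residue i * (p + q)) := by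
      rw [← div_eq_one_iff_eq (zpow_ne_zero _ hω), ← zpow_sub₀ hω, ω_zpow_eq_one_iff]
      have h := dvd_add ((hn 0).mul_right p) ((hn 1).mul_right q)
      refine (Int.dvd_iff_dvd_of_dvd_sub ?_).mp h
      refine ⟨0, ?_⟩
      simp only [Pi.zero_apply]
      ring
    rw [expChar_add_right, e, e2]
    ring
  · rw [ha n hn]
    ring

/-! ### Rotation by ω and the dual lattice -/

theorem ω_mul_latticePoint (s t : ℝ) : ω * latticePoint s t = latticePoint (-t) (s - t) := by
  simp only [latticePoint]
  push_cast
  linear_combination (4 * Real.pi * Complex.I * t) * (ω_pow_three + ω_sq_add)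

theorem ω_mul_dbarSymbol (n : Fin 2 → ℤ) : ω * dbarSymbol n = dbarSymbol ![-n 0 - n 1, n 0] := by
  simp only [dbarSymbol, Matrix.cons_val_zero, Matrix.cons_val_one]
  push_cast
  rw [mul_div_assoc', div_left_inj' sqrt_three_ne_zero]
  linear_combination (n 0 : ℂ) * (ω_pow_three + ω_sq_add)

theorem ω_mul_mem_dualLattice {k : ℂ} (hk : k ∈ dualLattice) : ω * k ∈ dualLattice := by
  obtain ⟨n, rfl⟩ := (mem_dualLattice_iff k).mp hk
  exact (mem_dualLattice_iff _).mpr ⟨_, ω_mul_dbarSymbol n⟩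

theorem sub_mem_dualLattice {k l : ℂ} (hk : k ∈ dualLattice) (hl : l ∈ dualLattice) :
    k - l ∈ dualLattice := by
  obtain ⟨n, rfl⟩ := (mem_dualLattice_iff k).mp hk
  obtain ⟨m, rfl⟩ := (mem_dualLattice_iff l).mp hl
  exact (mem_dualLattice_iff _).mpr ⟨_, (dbarSymbol_sub n m).symm⟩

theorem neg_mem_dualLattice {k : ℂ} (hk : k ∈ dualLattice) : -k ∈ dualLattice := by
  obtain ⟨n, rfl⟩ := (mem_dualLattice_iff k).mp hk
  exact (mem_dualLattice_iff _).mpr ⟨_, (dbarSymbol_neg n).symm⟩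

theorem mem_dualLattice_of_expChar_eq_one {κ : ℂ} (h0 : expChar κ (latticePoint 1 0) = 1)
    (h1 : expChar κ (latticePoint 0 1) = 1) : κ ∈ dualLattice := by
  obtain ⟨x, y, rfl⟩ := exists_eq_dbarReal κ
  have key : ∀ w : ℝ, Complex.exp (2 * Real.pi * Complex.I * w) = 1 → ∃ n : ℤ, w = n := by
    intro w hw
    obtain ⟨n, hn⟩ := Complex.exp_eq_one_iff.mp hw
    refine ⟨n, ?_⟩
    have hpi : (2 * Real.pi * Complex.I : ℂ) ≠ 0 := Complex.two_pi_I_ne_zero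
    rw [mul_comm] at hn
    exact_mod_cast mul_right_cancel₀ hpi hn
  rw [expChar_dbarReal] at h0 h1
  obtain ⟨n, hn⟩ := key x (by simpa using h0)
  obtain ⟨m, hm⟩ := key y (by simpa using h1)
  refine (mem_dualLattice_iff _).mpr ⟨![n, m], ?_⟩
  rw [dbarSymbol_eq, hn, hm]
  rfl

theorem expChar_smul (d z : ℂ) (c : ℝ) : expChar d (c * z) = expChar (c * d) z := by
  rw [expChar, expChar, map_mul, Complex.conj_ofReal]
  congr 4
  ring

/-- The components of a solution in the sector `0` have a common zero. -/
theorem IsSolution.exists_common_zero {U : Potential} {α k : ℂ} {a : Fin 2 → (Fin 2 → ℤ) → ℂ}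
    (ha : IsSolution U α k a) (hs : InSector 0 a) (hk : k ∉ dualLattice) :
    ∃ z, ∀ i, series (a i) z = 0 := by
  by_contra! hno
  have hω0 : ω ≠ 0 := Complex.exp_ne_zero _
  have hω3 := ω_pow_three
  set u := fun i => series (a i) with hu
  -- By the rotation symmetry of U, the rotated function v solves the same system with ω̄k = ω²k in
  -- place of k.
  set v := fun (i : Fin 2) (z : ℂ) => u i (ω * z) with hv
  have hdu : ∀ i z, HasDbar (u i) (Complex.I * (k * u i z - α * (U.comp i z * u (i + 1) z))) z :=
    fun i z => ha.hasDbar i z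
  have hdv : ∀ i z, HasDbar (v i)
      (Complex.I * (ω ^ 2 * k * v i z - α * (U.comp i z * v (i + 1) z))) z := by
    intro i z
    have h := (hdu i (ω * z)).comp_mul_left ω
    rw [conj_ω, U.comp_rotation] at h
    rw [show Complex.I * (ω ^ 2 * k * v i z - α * (U.comp i z * v (i + 1) z))
      = ω ^ 2 * (Complex.I * (k * u i (ω * z) - α * (ω * U.comp i z * u (i + 1) (ω * z)))) by
        simp only [hv]
        linear_combination (Complex.I * α * U.comp i z * u (i + 1) (ω * z)) * hω3]
    exact h
  have hdu0 := fun z => hdu 0 z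
  have hdu1 := fun z => hdu 1 z
  have hdv0 := fun z => hdv 0 z
  have hdv1 := fun z => hdv 1 z
  simp only [zero_add, Fin.reduceAdd] at hdu0 hdu1 hdv0 hdv1
  have hcont : ∀ {f : ℂ → ℂ} {w : ℂ → ℂ}, (∀ z, HasDbar f (w z) z) → Continuous f :=
    fun h => continuous_iff_continuousAt.mpr fun z => (h z).differentiableAt.continuousAt
  have hup : ∀ i, IsPeriodic (u i) := fun i => isPeriodic_series (a i)
  have hvp : ∀ i, IsPeriodic (v i) := by
    intro i p q z
    simp only [hv, mul_add, ω_mul_latticePoint]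
    have := hup i (-q) (p - q) (ω * z)
    push_cast at this
    exact this
  -- In the Wronskian the potential terms cancel, leaving the frequency k + ω²k = -ωk. By Liouville
  -- it is a multiple of that character, and periodicity of a nonzero multiple would put ωk, hence
  -- k, into Γ*.
  have hW : ∀ z, u 0 z * v 1 z - u 1 z * v 0 z = 0 := by
    have hd : ∀ z, HasDbar (fun z => u 0 z * v 1 z - u 1 z * v 0 z)
        (Complex.I * (-(ω * k)) * (u 0 z * v 1 z - u 1 z * v 0 z)) z := by
      intro z
      have h := ((hdu0 z).mul (hdv1 z)).sub ((hdu1 z).mul (hdv0 z))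
      refine Eq.mp (congrArg (fun w => HasDbar _ w z) ?_) h
      linear_combination (Complex.I * k * (u 0 z * v 1 z - u 1 z * v 0 z)) * ω_sq_add
    have hp : IsPeriodic fun z => u 0 z * v 1 z - u 1 z * v 0 z := by
      intro p q z
      simp only [hup _ p q z, hvp _ p q z]
    obtain ⟨C, hC⟩ := hp.exists_bound (hcont hd)
    have hL := eq_mul_expChar hC hd
    by_contra! hne
    obtain ⟨z, hz⟩ := hne
    have h0 : u 0 0 * v 1 0 - u 1 0 * v 0 0 ≠ 0 := by
      intro h
      have := hL z
      rw [h, zero_mul] at this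
      exact hz this
    have hper : ∀ p q : ℤ, expChar (-(ω * k)) (latticePoint p q) = 1 := by
      intro p q
      have h1 := hL (0 + latticePoint p q)
      have h2 := hp p q 0
      beta_reduce at h2
      rw [h2, zero_add] at h1
      exact (mul_eq_left₀ h0).mp h1.symm
    have hmem := mem_dualLattice_of_expChar_eq_one (by simpa using hper 1 0)
      (by simpa using hper 0 1)
    refine hk ?_
    have := neg_mem_dualLattice (ω_mul_mem_dualLattice (ω_mul_mem_dualLattice hmem))
    rwa [show -(ω * (ω * -(ω * k))) = k by linear_combination k * hω3] at this
  -- Since the Wronskian vanishes, v is pointwise proportional to u. The factor g = ⟨u, v⟩/|u|² is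
  -- differentiable because u is assumed to have no common zero.
  set g : ℂ → ℂ := fun z => (v 0 z * conj (u 0 z) + v 1 z * conj (u 1 z))
    / (u 0 z * conj (u 0 z) + u 1 z * conj (u 1 z)) with hg
  have hN : ∀ z, u 0 z * conj (u 0 z) + u 1 z * conj (u 1 z) ≠ 0 := by
    intro z h
    rw [Complex.mul_conj, Complex.mul_conj] at h
    have h' : Complex.normSq (u 0 z) + Complex.normSq (u 1 z) = 0 := by exact_mod_cast h
    obtain ⟨i, hi⟩ := hno z
    have h0 := Complex.normSq_nonneg (u 0 z)
    have h1 := Complex.normSq_nonneg (u 1 z)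
    refine hi (Complex.normSq_eq_zero.mp ?_)
    fin_cases i
    · change Complex.normSq (u 0 z) = 0
      linarith
    · change Complex.normSq (u 1 z) = 0
      linarith
  have hvg : ∀ i z, v i z = g z * u i z := by
    intro i z
    rw [hg]
    simp only
    rw [div_mul_eq_mul_div, eq_div_iff (hN z)]
    have := hW z
    fin_cases i
    · change v 0 z * _ = _ * u 0 z
      linear_combination (-conj (u 1 z)) * this
    · change v 1 z * _ = _ * u 1 z
      linear_combination conj (u 0 z) * this
  have hgd : Differentiable ℝ g := by
    have hc : ∀ i, Differentiable ℝ fun z => conj (u i z) := fun i =>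
      Complex.conjCLE.differentiable.comp fun z => (hdu i z).differentiableAt
    have hu' : ∀ i, Differentiable ℝ (u i) := fun i z => (hdu i z).differentiableAt
    have hv' : ∀ i, Differentiable ℝ (v i) := fun i z => (hdv i z).differentiableAt
    intro z
    simp only [hg, div_eq_mul_inv]
    exact (((hv' 0).mul (hc 0)).add ((hv' 1).mul (hc 1)) z).mul
      (((differentiableAt_inv (𝕜 := ℂ) (hN z)).restrictScalars ℝ).comp z
        (((hu' 0).mul (hc 0)).add ((hu' 1).mul (hc 1)) z))
  have hgdbar : ∀ z, HasDbar g (Complex.I * ((ω ^ 2 - 1) * k) * g z) z := by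
    intro z
    have h0 : HasDbar g _ z := ⟨_, (hgd z).hasFDerivAt, rfl⟩
    refine Eq.mp (congrArg (fun w => HasDbar _ w z) ?_) h0
    set w := fderiv ℝ g z 1 + Complex.I * fderiv ℝ g z Complex.I
    obtain ⟨i, hi⟩ := hno z
    refine mul_right_cancel₀ hi ?_
    have h1 := h0.mul (hdu i z)
    rw [← funext (hvg i)] at h1
    have h2 := h1.unique (hdv i z)
    rw [hvg i z, hvg (i + 1) z] at h2
    linear_combination h2
  -- Both u and v pick up ω^{residue · (p+q)} under translation by Γ/3: rotation sends (p, q) to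
  -- (-q, p - q), whose coordinate sum p - 2q is congruent to p + q mod 3. So g has the finer period
  -- lattice Γ/3.
  have hgper : ∀ (p q : ℤ) (z : ℂ), g (z + latticePoint (p / 3) (q / 3)) = g z := by
    intro p q z
    obtain ⟨i, hi⟩ := hno z
    have hc : ω ^ (residue i * (p + q)) ≠ 0 := zpow_ne_zero _ hω0
    refine mul_right_cancel₀ (mul_ne_zero hc hi) ?_
    have h1 := series_translate (hs i) p q z
    have h2 := series_translate (hs i) (-q) (p - q) (ω * z)
    have h3 := hvg i (z + latticePoint (p / 3) (q / 3))
    have e : v i (z + latticePoint (p / 3) (q / 3))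
        = series (a i) (ω * z + latticePoint (((-q : ℤ) : ℝ) / 3) (((p - q : ℤ) : ℝ) / 3)) := by
      simp only [hv, hu, mul_add, ω_mul_latticePoint]
      congr 3 <;> push_cast <;> ring
    have e2 : ω ^ (residue i * (-q + (p - q))) = ω ^ (residue i * (p + q)) := by
      rw [← div_eq_one_iff_eq hc, ← zpow_sub₀ hω0, ω_zpow_eq_one_iff]
      exact ⟨-(residue i * q), by ring⟩
    have h4 := hvg i z
    rw [e, h2, e2] at h3
    simp only [hv, hu] at h3 h4
    rw [h1, h4] at h3
    linear_combination -h3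
  have hgP : IsPeriodic g := by
    intro p q z
    have := hgper (3 * p) (3 * q) z
    push_cast at this
    rwa [mul_div_cancel_left₀ _ (by norm_num), mul_div_cancel_left₀ _ (by norm_num)] at this
  obtain ⟨C, hC⟩ := hgP.exists_bound hgd.continuous
  have hL := eq_mul_expChar hC hgdbar
  -- The rotation fixes 0, so v and u agree there.
  have hg0 : g 0 ≠ 0 := by
    intro h
    obtain ⟨i, hi⟩ := hno 0
    have := hvg i 0
    rw [h, zero_mul] at this
    simp only [hv, mul_zero] at this
    exact hi this
  have hper : ∀ p q : ℤ,
      expChar ((1 / 3 : ℝ) * ((ω ^ 2 - 1) * k)) (latticePoint p q) = 1 := by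
    intro p q
    have h1 := hL (0 + latticePoint (p / 3) (q / 3))
    rw [hgper, zero_add] at h1
    rw [← expChar_smul, ← latticePoint_smul, one_div_mul_eq_div, one_div_mul_eq_div]
    exact (mul_eq_left₀ hg0).mp h1.symm
  have hmem := mem_dualLattice_of_expChar_eq_one (by simpa using hper 1 0)
    (by simpa using hper 0 1)
  refine hk ?_
  -- Periodicity under Γ/3 puts (ω² - 1)k/3 into Γ*. Multiplication by ω - 1 preserves Γ*, and (ω -
  -- 1)(ω² - 1) = 3, so k itself would lie in Γ*.
  have := sub_mem_dualLattice (ω_mul_mem_dualLattice hmem) hmem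
  rwa [show ω * (3⁻¹ * ((ω ^ 2 - 1) * k)) - 3⁻¹ * ((ω ^ 2 - 1) * k)
    = k by linear_combination (k / 3) * (hω3 - ω_sq_add)] at this

/-! ### Solutions for nearby `k` -/

open scoped Classical in
/-- The Fourier coefficients of a function on `ℂ/Γ` with simple poles at the points of
`z₀ + Γ/3`. -/
def poleCoeff (z₀ κ : ℂ) (q : Fin 2 → ℤ) : ℂ :=
  if ∀ j, (3 : ℤ) ∣ q j then expChar (-dbarSymbol q) z₀ / (dbarSymbol q - κ) else 0

theorem three_halves_le_norm_dbarSymbol {q : Fin 2 → ℤ} (hq : ∀ j, (3 : ℤ) ∣ q j) (h0 : q ≠ 0) :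
    3 / 2 ≤ ‖dbarSymbol q‖ := by
  obtain ⟨j, hj⟩ := Function.ne_iff.mp h0
  have h1 : (3 : ℤ) ≤ |q j| := by
    obtain ⟨p, hp⟩ := hq j
    have : p ≠ 0 := by
      rintro rfl
      simp [hp] at hj
    have := Int.one_le_abs this
    rw [hp, abs_mul]
    norm_num
    linarith
  have h2 := norm_le_pi_norm q j
  rw [Int.norm_eq_abs] at h2
  have h3 : (3 : ℝ) ≤ |(q j : ℝ)| := by exact_mod_cast h1
  have := norm_le_two_mul_norm_dbarSymbol q
  linarith

theorem one_le_norm_dbarSymbol_sub {κ : ℂ} (hκ : ‖κ‖ ≤ 1 / 2) {q : Fin 2 → ℤ}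
    (hq : ∀ j, (3 : ℤ) ∣ q j) (h0 : q ≠ 0) : 1 ≤ ‖dbarSymbol q - κ‖ := by
  have h1 := three_halves_le_norm_dbarSymbol hq h0
  have h2 := norm_le_norm_sub_add (dbarSymbol q) κ
  linarith

theorem norm_poleCoeff_le_one (z₀ : ℂ) {κ : ℂ} (hκ : ‖κ‖ ≤ 1 / 2) {q : Fin 2 → ℤ} (h0 : q ≠ 0) :
    ‖poleCoeff z₀ κ q‖ ≤ 1 := by
  rw [poleCoeff]
  split_ifs with hq
  · rw [norm_div, norm_expChar]
    exact (div_le_one₀ (one_pos.trans_le (one_le_norm_dbarSymbol_sub hκ hq h0))).mpr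
      (one_le_norm_dbarSymbol_sub hκ hq h0)
  · simp

theorem poleCoeff_zero (z₀ κ : ℂ) : poleCoeff z₀ κ 0 = -κ⁻¹ := by
  have h : dbarSymbol 0 = 0 := by simp [dbarSymbol]
  have h3 : ∀ j, (3 : ℤ) ∣ (0 : Fin 2 → ℤ) j := fun j => dvd_zero (3 : ℤ)
  rw [poleCoeff, if_pos h3, h, neg_zero, expChar_zero_left, zero_sub, one_div,
    inv_neg]

theorem norm_poleCoeff_le (z₀ : ℂ) {κ : ℂ} (hκ : ‖κ‖ ≤ 1 / 2) (q : Fin 2 → ℤ) :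
    ‖poleCoeff z₀ κ q‖ ≤ 1 + ‖κ‖⁻¹ := by
  by_cases h0 : q = 0
  · rw [h0, poleCoeff_zero, norm_neg, norm_inv]
    exact le_add_of_nonneg_left zero_le_one
  · exact (norm_poleCoeff_le_one z₀ hκ h0).trans
      (le_add_of_nonneg_right (inv_nonneg.mpr (norm_nonneg _)))

open scoped Classical in
theorem dbarSymbol_sub_mul_poleCoeff (z₀ : ℂ) {κ : ℂ} (hκ0 : κ ≠ 0) (hκ : ‖κ‖ ≤ 1 / 2)
    (q : Fin 2 → ℤ) : (dbarSymbol q - κ) * poleCoeff z₀ κ q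
      = if ∀ j, (3 : ℤ) ∣ q j then expChar (-dbarSymbol q) z₀ else 0 := by
  rw [poleCoeff]
  split_ifs with hq
  · refine mul_div_cancel₀ _ fun h => ?_
    by_cases h0 : q = 0
    · rw [h0] at h
      simp [dbarSymbol, hκ0] at h
    · have := one_le_norm_dbarSymbol_sub hκ hq h0
      rw [h, norm_zero] at this
      linarith
  · rw [mul_zero]

theorem summable_conv_right {F B : (Fin 2 → ℤ) → ℂ} {C : ℝ} (hF : ∀ n, ‖F n‖ ≤ C)
    (hB : Summable fun n => ‖B n‖) (m : Fin 2 → ℤ) : Summable fun n => F n * B (m - n) := by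
  have h := ((Equiv.subLeft m).summable_iff (f := fun n => ‖B n‖)).mpr hB
  refine Summable.of_norm_bounded (h.mul_left C) fun n => ?_
  rw [norm_mul]
  exact mul_le_mul_of_nonneg_right (hF n) (norm_nonneg _)

theorem sectorMode_sub_iff_of_dvd {q : Fin 2 → ℤ} (hq : ∀ j, (3 : ℤ) ∣ q j) (r : Fin 2 → ℤ)
    (i : Fin 2) (m : Fin 2 → ℤ) : SectorMode r i (m - q) ↔ SectorMode r i m := by
  refine forall_congr' fun j => ?_
  rw [show (m - q) j - r j - residue i = m j - r j - residue i - q j by simp; ring]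
  exact dvd_sub_left (hq j)

namespace IsSolution

variable {U : Potential} {α k : ℂ} {a : Fin 2 → (Fin 2 → ℤ) → ℂ}

theorem poleCoeff_mul_eq_zero (hs : InSector 0 a) (z₀ κ : ℂ) {i : Fin 2} {m : Fin 2 → ℤ}
    (hm : ¬ SectorMode 0 i m) (q : Fin 2 → ℤ) : poleCoeff z₀ κ q * a i (m - q) = 0 := by
  by_cases hq : ∀ j, (3 : ℤ) ∣ q j
  · rw [hs i _ (mt (sectorMode_sub_iff_of_dvd hq 0 i m).mp hm), mul_zero]
  · rw [poleCoeff, if_neg hq, zero_mul]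

/-- Multiplying a solution by a function with simple poles at its zeros shifts `k`. -/
theorem conv_poleCoeff (ha : IsSolution U α k a) (hs : InSector 0 a) {z₀ κ : ℂ}
    (hz : ∀ i, series (a i) z₀ = 0) (hκ0 : κ ≠ 0) (hκ : ‖κ‖ ≤ 1 / 2) :
    IsSolution U α (k + κ) fun i => conv (poleCoeff z₀ κ) (a i) where
  bounded := by
    refine ⟨(∑' n, ‖a 0 n‖ + ∑' n, ‖a 1 n‖) * (1 + ‖κ‖⁻¹), fun i m => ?_⟩
    rw [conv_comm]
    refine (norm_conv_le (ha.summable_norm i) (norm_poleCoeff_le z₀ hκ) m).trans ?_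
    have h0 : ∀ i, 0 ≤ ∑' n, ‖a i n‖ := fun i => tsum_nonneg fun n => norm_nonneg _
    gcongr
    fin_cases i
    · exact le_add_of_nonneg_right (h0 1)
    · exact le_add_of_nonneg_left (h0 0)
  eq i m := by
    classical
    have hF := norm_poleCoeff_le z₀ hκ
    set F := poleCoeff z₀ κ with hFdef
    have hV := (U.rapidDecay_fourier i).summable_norm
    have hc : Summable fun n => ‖conv (U.fourier i) (a (i + 1)) n‖ :=
      (hasSum_conv hV (ha.summable_norm (i + 1))).summable.norm
    -- Multiplication by the singular function is pulled outside the potential term, so that `ha.eq`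
    -- applies at each mode m - q.
    rw [← conv_left_comm hV (ha.summable_norm (i + 1)) hF]
    have h1 := ((summable_conv_right hF (ha.summable_norm i) m).hasSum.mul_left
      (dbarSymbol m - (k + κ))).add ((summable_conv_right hF hc m).hasSum.mul_left α)
    -- (2 D_{z̄} - κ) maps the singular function to a multiple of the delta comb on z₀ + Γ/3, and
    -- its product with u must vanish. In the sector 0 the modes m - q with q ∈ 3ℤ² exhaust the
    -- modes of a i, so the sum is a character value times u_i(z₀) = 0.
    have h2 : HasSum (fun q => (if ∀ j, (3 : ℤ) ∣ q j then expChar (-dbarSymbol q) z₀ else 0)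
        * a i (m - q)) 0 := by
      by_cases hm : SectorMode 0 i m
      · have h := hasSum_series (ha.summable_norm i) z₀
        rw [hz i] at h
        have h' := ((Equiv.subLeft m).hasSum_iff.mpr h).mul_left (expChar (-dbarSymbol m) z₀)
        rw [mul_zero] at h'
        refine h'.congr_fun fun q => ?_
        simp only [Function.comp_apply, Equiv.subLeft_apply]
        split_ifs with hq
        · rw [dbarSymbol_sub, show -dbarSymbol q = -dbarSymbol m + (dbarSymbol m - dbarSymbol q) by
            ring, expChar_add_left]
          ring
        · rw [hs i (m - q)]
          · ring
          · intro h
            refine hq fun j => ?_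
            have := dvd_sub (hm j) (h j)
            simpa using this
      · refine hasSum_zero.congr_fun fun q => ?_
        split_ifs with hq
        · rw [hs i _ (mt (sectorMode_sub_iff_of_dvd hq 0 i m).mp hm), mul_zero]
        · rw [zero_mul]
    refine h1.unique (h2.congr_fun fun q => ?_)
    have h3 := ha.eq i (m - q)
    rw [dbarSymbol_sub] at h3
    rw [← dbarSymbol_sub_mul_poleCoeff z₀ hκ0 hκ, ← hFdef]
    linear_combination F q * h3

/-- For small κ the zero mode -κ⁻¹ of the singular function dominates: all its other coefficients
are at most 1, since the nonzero symbols on 3ℤ² have size at least 3/2 and |κ| ≤ 1/2. -/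
theorem conv_poleCoeff_ne_zero (ha : IsSolution U α k a) (z₀ : ℂ) {i : Fin 2} {m : Fin 2 → ℤ}
    {κ : ℂ} (hκ0 : κ ≠ 0) (hκ : ‖κ‖ ≤ 1 / 2)
    (hκ' : ‖κ‖ * (1 + ∑' n, ‖a i n‖) < ‖a i m‖) : conv (poleCoeff z₀ κ) (a i) m ≠ 0 := by
  classical
  intro h
  have hF := norm_poleCoeff_le z₀ hκ
  have h1 := (summable_conv_right hF (ha.summable_norm i) m).hasSum
  have h1' : HasSum (fun n => poleCoeff z₀ κ n * a i (m - n)) 0 := by rwa [← h]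
  -- Removing the term q = 0 from a vanishing sum leaves κ⁻¹ · a i m, which the bounded remaining
  -- coefficients cannot produce if |κ| is small.
  have h2 := h1'.update 0 0
  have h3 : Function.update (fun n => poleCoeff z₀ κ n * a i (m - n)) 0 0
      = fun n => Function.update (poleCoeff z₀ κ) 0 0 n * a i (m - n) := by
    funext n
    by_cases hn : n = 0
    · subst hn
      simp
    · simp [hn]
  rw [h3] at h2
  have h4 : conv (Function.update (poleCoeff z₀ κ) 0 0) (a i) m = κ⁻¹ * a i m := by
    rw [conv, h2.tsum_eq, poleCoeff_zero, sub_zero]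
    ring
  have h5 : ∀ n, ‖Function.update (poleCoeff z₀ κ) 0 0 n‖ ≤ 1 := by
    intro n
    by_cases hn : n = 0
    · subst hn
      simp
    · rw [Function.update_of_ne hn]
      exact norm_poleCoeff_le_one z₀ hκ hn
  have h6 := norm_conv_le (ha.summable_norm i) h5 m
  rw [conv_comm, h4, mul_one, norm_mul, norm_inv,
    inv_mul_le_iff₀ (norm_pos_iff.mpr hκ0)] at h6
  have := norm_nonneg κ
  nlinarith

end IsSolution

/-- The common zero exists only for k ∉ Γ*; it then yields a nonzero solution for every k + κ with κ
in an explicit punctured disc. -/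
theorem solvableSet_mem_nhds {U : Potential} {α k : ℂ} (hk : k ∈ solvableSet U α)
    (hk' : k ∉ dualLattice) : solvableSet U α ∈ nhds k := by
  have hk0 := hk
  obtain ⟨a, ha, hs, h0⟩ := hk
  obtain ⟨z₀, hz⟩ := ha.exists_common_zero hs hk'
  obtain ⟨i, m, him⟩ : ∃ i m, a i m ≠ 0 := by
    by_contra! h
    exact h0 (funext fun i => funext fun m => h i m)
  have hS : 0 ≤ ∑' n, ‖a i n‖ := tsum_nonneg fun n => norm_nonneg _
  have hS1 : 0 < 1 + ∑' n, ‖a i n‖ := by linarith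
  have hpos := norm_pos_iff.mpr him
  rw [Metric.mem_nhds_iff]
  refine ⟨min (1 / 2) (‖a i m‖ / (1 + ∑' n, ‖a i n‖)), by positivity, fun k' hk'' => ?_⟩
  by_cases hne : k' - k = 0
  · rwa [sub_eq_zero.mp hne]
  rw [Metric.mem_ball, dist_eq_norm, lt_min_iff, lt_div_iff₀ hS1] at hk''
  have hsol := ha.conv_poleCoeff hs hz hne hk''.1.le
  rw [add_sub_cancel] at hsol
  refine ⟨_, hsol, fun i m hm => ?_, fun h => ?_⟩
  · exact (tsum_congr (IsSolution.poleCoeff_mul_eq_zero hs z₀ (k' - k) hm)).trans tsum_zero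
  · exact ha.conv_poleCoeff_ne_zero z₀ hne hk''.1.le hk''.2 (congrFun (congrFun h i) m)

theorem countable_dualLattice : dualLattice.Countable := by
  have : dualLattice = Set.range dbarSymbol := by
    ext k
    rw [mem_dualLattice_iff]
    exact exists_congr fun n => eq_comm
  rw [this]
  exact Set.countable_range _

/-- If there is a nonzero solution for some `k ∉ Γ*`, then for every `k`. -/
theorem solvableSet_eq_univ {U : Potential} {α k₀ : ℂ} (hk₀ : k₀ ∈ solvableSet U α)
    (hk₀' : k₀ ∉ dualLattice) : solvableSet U α = Set.univ := by
  have hcl := isClosed_solvableSet U α hk₀'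
  -- The complement of the countable set Γ* is connected, and within it the solvable set is open,
  -- closed and contains k₀.
  have hsub : dualLatticeᶜ ⊆ interior (solvableSet U α) := by
    refine (countable_dualLattice.isConnected_compl_of_one_lt_rank
      (by simp)).isPreconnected.subset_of_closure_inter_subset
      isOpen_interior ⟨k₀, hk₀', mem_interior_iff_mem_nhds.mpr (solvableSet_mem_nhds hk₀ hk₀')⟩ ?_
    rintro k ⟨hk, hk'⟩
    have : k ∈ solvableSet U α := closure_minimal interior_subset hcl hk
    exact mem_interior_iff_mem_nhds.mpr (solvableSet_mem_nhds this hk')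
  -- Closedness in all of ℂ adds the remaining points of Γ*, where the openness argument is not
  -- available.
  have hdense : Dense (solvableSet U α) :=
    (countable_dualLattice.dense_compl ℂ).mono (hsub.trans interior_subset)
  rw [← hcl.closure_eq, hdense.closure_eq]

/-- For a magic parameter there is a nonzero solution in each sector, for each `k`. -/
theorem exists_isSolution_inSector {U : Potential} {α : ℂ} (hα : α ∈ magicSet U) (k : ℂ)
    (r : Fin 2 → ℤ) : ∃ a, IsSolution U α k a ∧ InSector r a ∧ a ≠ 0 := by
  obtain ⟨k₁, hk₁, a, ha, h0⟩ := exists_isSolution_of_mem_magicSet hα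
  obtain ⟨s, b, hb, hbs, hb0⟩ := ha.exists_inSector_zero h0
  have hk' : k₁ - dbarSymbol s ∉ dualLattice := by
    intro h
    have h' := sub_mem_dualLattice h
      (neg_mem_dualLattice ((mem_dualLattice_iff (dbarSymbol s)).mpr ⟨s, rfl⟩))
    rw [sub_neg_eq_add, sub_add_cancel] at h'
    exact hk₁ h'
  have huniv := solvableSet_eq_univ ⟨b, hb, hbs, hb0⟩ hk'
  obtain ⟨c, hc, hcs, hc0⟩ : k - dbarSymbol r ∈ solvableSet U α := by
    rw [huniv]
    exact Set.mem_univ _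
  -- A solution in the sector 0 for k - dbarSymbol r becomes one in the sector r for k.
  have hsh := hc.shift (-r)
  rw [dbarSymbol_neg, sub_neg_eq_add, sub_add_cancel] at hsh
  refine ⟨_, hsh, fun i m hm => hcs i _ fun h => hm fun j => ?_, fun h => hc0 ?_⟩
  · simpa [sub_eq_add_neg] using h j
  · funext i m
    have := congrFun (congrFun h i) (m + r)
    simpa using this

/-! ### The kernel of the Bloch Hamiltonian -/

theorem japanese_le (n : Fin 2 → ℤ) : japanese n ≤ 2 * wt n := by
  have h : ∀ j, (n j : ℝ) ^ 2 ≤ ‖n‖ ^ 2 := fun j => by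
    have := norm_le_pi_norm n j
    rw [Int.norm_eq_abs] at this
    rw [← sq_abs]
    gcongr
  rw [japanese]
  refine Real.sqrt_le_iff.mpr ⟨by have := wt_pos n; positivity, ?_⟩
  have := norm_nonneg n
  rw [wt]
  nlinarith [h 0, h 1]

theorem mem_sobolevH1_of_rapidDecay {u : L2} {a : (Fin 2 → ℤ) → ℂ} (ha : RapidDecay a)
    (hu : ∀ n, fourierBasis.repr u n = a n) : u ∈ sobolevH1 := by
  have h1 : Memℓp (fun n => (japanese n : ℂ) * fourierBasis.repr u n) 1 := by
    refine memℓp_gen ?_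
    have h := (ha.summable 1).mul_left 2
    refine Summable.of_nonneg_of_le (fun n => by positivity) (fun n => ?_) h
    have hj : ‖japanese n‖ = japanese n := Real.norm_of_nonneg (Real.sqrt_nonneg _)
    rw [ENNReal.toReal_one, Real.rpow_one, norm_mul, Complex.norm_real, hj, hu, pow_one,
      ← mul_assoc]
    exact mul_le_mul_of_nonneg_right (japanese_le n) (norm_nonneg _)
  exact h1.of_exponent_ge (by norm_num)

theorem repr_dbar (u : sobolevH1) (n : Fin 2 → ℤ) :
    fourierBasis.repr (dbar u) n = dbarSymbol n * fourierBasis.repr (u : L2) n := by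
  change fourierBasis.repr (fourierBasis.repr.symm _) n = _
  rw [LinearIsometryEquiv.apply_symm_apply]

theorem IsSolution.exists_L2 {U : Potential} {α k : ℂ} {a : Fin 2 → (Fin 2 → ℤ) → ℂ}
    (ha : IsSolution U α k a) : ∃ u : L2Two, (∀ i n, fourierBasis.repr (u i) n = a i n) ∧
      ∃ h : ∀ i, u i ∈ sobolevH1,
        ∀ i, dbar ⟨u i, h i⟩ + α • mulOp (U.comp i) (u (i + 1)) = k • u i := by
  obtain ⟨u, hu⟩ := exists_repr_eq_pi ha.summable_norm
  refine ⟨u, hu, fun i => mem_sobolevH1_of_rapidDecay (ha.rapidDecay i) (hu i), fun i =>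
    ext_repr fun m => ?_⟩
  simp only [map_add, map_smul, lp.coeFn_add, lp.coeFn_smul, Pi.add_apply, Pi.smul_apply,
    smul_eq_mul, U.repr_mulOp_comp, repr_dbar, hu]
  linear_combination ha.eq i m

theorem D_apply (U : Potential) (α : ℂ) (u : (D U α).domain) (i : Fin 2) :
    D U α u i = dbar ⟨(u : L2Two) i, u.2 i⟩ + α • mulOp (U.comp i) ((u : L2Two) (i + 1)) := by
  rw [← U.potentialOp_apply]
  rfl

theorem inner_star_dbar (u v : sobolevH1) :
    ⟪star (u : L2), dbar v⟫_ℂ = -⟪star (dbar u), (v : L2)⟫_ℂ := by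
  refine (inner_eq_tsum _ _).unique ((inner_eq_tsum _ _).neg.congr_fun fun n => ?_)
  simp only [repr_star, repr_dbar, Complex.conj_conj, dbarSymbol_neg]
  ring

theorem inner_star_sub (u v w : L2) : ⟪star (u - v), w⟫_ℂ = ⟪star u, w⟫_ℂ - ⟪star v, w⟫_ℂ := by
  refine (inner_eq_tsum _ _).unique
    (((inner_eq_tsum _ _).sub (inner_eq_tsum _ _)).congr_fun fun n => ?_)
  simp only [repr_star, Complex.conj_conj, map_sub, lp.coeFn_sub, Pi.sub_apply]
  ring

theorem inner_star_smul (c : ℂ) (u w : L2) : ⟪star (c • u), w⟫_ℂ = c * ⟪star u, w⟫_ℂ := by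
  refine (inner_eq_tsum _ _).unique (((inner_eq_tsum _ _).mul_left c).congr_fun fun n => ?_)
  simp only [repr_star, Complex.conj_conj, map_smul, lp.coeFn_smul, Pi.smul_apply, smul_eq_mul]
  ring

theorem inner_star_mulOp (f : C(ℂ, ℂ)) (u v : L2) :
    ⟪star u, mulOp f v⟫_ℂ = ⟪star (mulOp f u), v⟫_ℂ := by
  rw [L2.inner_def, L2.inner_def]
  refine integral_congr_ae ?_
  filter_upwards [coeFn_mulOp f u, coeFn_mulOp f v, Lp.coeFn_star u,
    Lp.coeFn_star (mulOp f u)] with x h1 h2 h3 h4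
  rw [h2, h3, h4, Pi.star_apply, Pi.star_apply, h1]
  simp only [RCLike.inner_apply, RCLike.star_def, Complex.conj_conj]
  ring

/-- The Hilbert space adjoint is characterized by its defining identity only for a dense domain; the
Fourier modes in each component already suffice. -/
theorem dense_D_domain (U : Potential) (α : ℂ) : Dense ((D U α).domain : Set L2Two) := by
  change Dense (sobolevH1Two : Set L2Two)
  rw [Submodule.dense_iff_topologicalClosure_eq_top, Submodule.topologicalClosure_eq_top_iff,
    Submodule.eq_bot_iff]
  intro y hy
  ext1 i
  refine ext_repr fun n => ?_
  have hb : fourierBasis n ∈ sobolevH1 := by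
    refine mem_sobolevH1_of_rapidDecay (a := fun m => if m = n then 1 else 0) (fun s => ?_)
      (repr_basis n)
    refine ⟨wt n ^ s, fun m => ?_⟩
    beta_reduce
    split_ifs with h
    · rw [h]
      simp
    · have := wt_pos n
      simp only [norm_zero, mul_zero]
      positivity
  have hmem : PiLp.single 2 i (fourierBasis n) ∈ sobolevH1Two := by
    intro j
    by_cases hj : j = i
    · subst hj
      simpa using hb
    · simp [hj]
  have h := (Submodule.mem_orthogonal _ _).mp hy _ hmem
  rw [PiLp.inner_apply, Fintype.sum_eq_single i fun j hj => by simp [hj]] at h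
  rw [fourierBasis.repr_apply_apply]
  simpa using h

/-- `(u₁, -u₀)`, complex conjugated. -/
def conjSwap (u : L2Two) : L2Two := WithLp.toLp 2 ![star (u 1), -star (u 0)]

/-- Solutions for `-k` give elements of the kernel of `D(α)* - k̄`. -/
theorem adjoint_conjSwap {U : Potential} {α k : ℂ} {u : L2Two} (h : ∀ i, u i ∈ sobolevH1)
    (hu : ∀ i, dbar ⟨u i, h i⟩ + α • mulOp (U.comp i) (u (i + 1)) = -k • u i) :
    ∃ hv : conjSwap u ∈ (D U α).adjoint.domain,
      (D U α).adjoint ⟨conjSwap u, hv⟩ = conj k • conjSwap u := by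
  have key : ∀ x : (D U α).domain, ⟪conj k • conjSwap u, (x : L2Two)⟫_ℂ
      = ⟪conjSwap u, D U α x⟫_ℂ := by
    intro x
    -- For the bilinear pairing ∫ uv the operator 2 D_{z̄} is antisymmetric and multiplication is
    -- symmetric. Exchanging the components with one sign therefore turns the equation for -k into
    -- the one for the adjoint.
    have e : ∀ i (y : sobolevH1), ⟪star (u i), dbar y⟫_ℂ
        = α * ⟪star (mulOp (U.comp i) (u (i + 1))), (y : L2)⟫_ℂ + k * ⟪star (u i), (y : L2)⟫_ℂ := by
      intro i y
      have h1 := inner_star_dbar ⟨u i, h i⟩ y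
      rw [eq_sub_of_add_eq (hu i)] at h1
      rw [h1, inner_star_sub, inner_star_smul, inner_star_smul]
      ring
    have e0 := e 0 ⟨(x : L2Two) 1, x.2 1⟩
    have e1 := e 1 ⟨(x : L2Two) 0, x.2 0⟩
    have f0 := inner_star_mulOp (U.comp 0) (u 1) ((x : L2Two) 1)
    have f1 := inner_star_mulOp (U.comp 1) (u 0) ((x : L2Two) 0)
    simp only [Fin.reduceAdd] at e0 e1
    rw [inner_smul_left, PiLp.inner_apply, PiLp.inner_apply, Fin.sum_univ_two, Fin.sum_univ_two,
      D_apply, D_apply]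
    simp only [conjSwap, Matrix.cons_val_zero, Matrix.cons_val_one, inner_neg_left,
      inner_add_right, inner_smul_right, Fin.reduceAdd, e0, e1, f0, f1]
    simp
    ring
  have hv := LinearPMap.mem_adjoint_domain_of_exists (T := D U α) (conjSwap u) ⟨_, key⟩
  exact ⟨hv, LinearPMap.adjoint_apply_eq (dense_D_domain U α) ⟨_, hv⟩ key⟩

theorem exists_mem_ker_blochHamiltonian {U : Potential} {α k : ℂ} {u v : L2Two}
    (hu : u ∈ (D U α).domain) (hu' : D U α ⟨u, hu⟩ = k • u)
    (hv : v ∈ (D U α).adjoint.domain) (hv' : (D U α).adjoint ⟨v, hv⟩ = conj k • v) :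
    ∃ w : LinearMap.ker (blochHamiltonian U α k).toFun,
      ((w : (blochHamiltonian U α k).domain) : WithLp 2 (L2Two × L2Two)) = WithLp.toLp 2 (u, v) := by
  refine ⟨⟨⟨WithLp.toLp 2 (u, v), ⟨hu, hv⟩⟩, ?_⟩, rfl⟩
  rw [LinearMap.mem_ker]
  change WithLp.toLp 2 ((D U α).adjoint ⟨v, hv⟩ - conj k • v, D U α ⟨u, hu⟩ - k • u) = 0
  rw [hu', hv', sub_self, sub_self]
  rfl

theorem inner_eq_zero_of_repr {u v : L2}
    (h : ∀ n, fourierBasis.repr u n = 0 ∨ fourierBasis.repr v n = 0) : ⟪u, v⟫_ℂ = 0 := by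
  refine (inner_eq_tsum u v).unique (hasSum_zero.congr_fun fun n => ?_)
  rcases h n with h | h <;> simp [h]

theorem repr_eq_zero_of_star_eq_zero {u : L2} (h : star u = 0) (n : Fin 2 → ℤ) :
    fourierBasis.repr u n = 0 := by
  have h1 := repr_star u (-n)
  rw [h, neg_neg] at h1
  simpa using h1.symm

/-- The sector with the given residues mod `3`. -/
def sectorOf (r : Fin 2 → Fin 3) (j : Fin 2) : ℤ := (r j : ℕ)

theorem eq_of_sectorMode {r s : Fin 2 → Fin 3} {i : Fin 2} {m : Fin 2 → ℤ}
    (hr : SectorMode (sectorOf r) i m) (hs : SectorMode (sectorOf s) i m) : r = s := by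
  funext j
  have h1 := hr j
  have h2 := hs j
  simp only [sectorOf] at h1 h2
  have h3 := (r j).2
  have h4 := (s j).2
  apply Fin.ext
  omega

theorem eq_zero_or_eq_zero_of_inSector {r s : Fin 2 → Fin 3} (hrs : r ≠ s)
    {a b : Fin 2 → (Fin 2 → ℤ) → ℂ} (ha : InSector (sectorOf r) a) (hb : InSector (sectorOf s) b)
    (i : Fin 2) (m : Fin 2 → ℤ) : a i m = 0 ∨ b i m = 0 := by
  by_cases h : SectorMode (sectorOf r) i m
  · exact Or.inr (hb i m fun h' => hrs (eq_of_sectorMode h h'))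
  · exact Or.inl (ha i m h)

/-- The Hamiltonian is off-diagonal, so its kernel is the sum of those of D(α) - k and D(α)* - k̄.
Each receives one vector per sector, from solutions at k and at -k respectively; different sectors
have disjoint Fourier supports, hence 2 · 9 orthogonal vectors. -/
theorem hasFlatBands_of_mem_magicSet {U : Potential} {α : ℂ} (hα : α ∈ magicSet U) :
    HasFlatBands U α 18 := by
  intro k
  choose a ha has ha0 using fun r : Fin 2 → Fin 3 => exists_isSolution_inSector hα k (sectorOf r)
  choose b hb hbs hb0 using
    fun r : Fin 2 → Fin 3 => exists_isSolution_inSector hα (-k) (sectorOf r)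
  choose u hu hus hueq using fun r => (ha r).exists_L2
  choose v hv hvs hveq using fun r => (hb r).exists_L2
  choose hw hweq using fun r => adjoint_conjSwap (hvs r) (hveq r)
  have hDu : ∀ r, D U α ⟨u r, hus r⟩ = k • u r := fun r => by
    ext1 i
    rw [D_apply]
    exact hueq r i
  have hu0 : ∀ r, u r ≠ 0 := fun r h => ha0 r (funext fun i => funext fun m => by
    rw [← hu r i m, h]
    simp)
  have hv0 : ∀ r, conjSwap (v r) ≠ 0 := fun r h => hb0 r (funext fun i => funext fun m => by
    have h0 : star (v r 1) = 0 := congrArg (fun x : L2Two => x 0) h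
    have h1 : -star (v r 0) = 0 := congrArg (fun x : L2Two => x 1) h
    rw [neg_eq_zero] at h1
    rw [← hv r i m]
    fin_cases i
    · exact repr_eq_zero_of_star_eq_zero h1 m
    · exact repr_eq_zero_of_star_eq_zero h0 m)
  have huu : ∀ r s, r ≠ s → ⟪u r, u s⟫_ℂ = 0 := fun r s hrs => by
    rw [PiLp.inner_apply]
    refine Finset.sum_eq_zero fun i _ => inner_eq_zero_of_repr fun n => ?_
    rw [hu, hu]
    exact eq_zero_or_eq_zero_of_inSector hrs (has r) (has s) i n
  have hvv : ∀ r s, r ≠ s → ⟪conjSwap (v r), conjSwap (v s)⟫_ℂ = 0 := fun r s hrs => by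
    have h : ∀ i, ⟪star (v r i), star (v s i)⟫_ℂ = 0 := fun i =>
      inner_eq_zero_of_repr fun n => by
        rw [repr_star, repr_star, hv, hv, map_eq_zero, map_eq_zero]
        exact eq_zero_or_eq_zero_of_inSector hrs (hbs r) (hbs s) i (-n)
    rw [PiLp.inner_apply, Fin.sum_univ_two]
    simp [conjSwap, h]
  choose x hx using fun r => exists_mem_ker_blochHamiltonian (hus r) (hDu r)
    (zero_mem (D U α).adjoint.domain) (((D U α).adjoint.map_zero).trans (smul_zero (conj k)).symm)
  choose y hy using fun r => exists_mem_ker_blochHamiltonian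
    (zero_mem (D U α).domain) (((D U α).map_zero).trans (smul_zero k).symm) (hw r) (hweq r)
  have hli : LinearIndependent ℂ (Sum.elim x y) := by
    -- Independence is tested in the ambient Hilbert space, where the vectors are nonzero and
    -- pairwise orthogonal.
    refine LinearIndependent.of_comp ((blochHamiltonian U α k).domain.subtype ∘ₗ
      (LinearMap.ker (blochHamiltonian U α k).toFun).subtype) ?_
    refine linearIndependent_of_ne_zero_of_inner_eq_zero (fun i => ?_) fun i j hij => ?_
    · rcases i with r | r
      · intro h
        have h' : WithLp.toLp 2 (u r, (0 : L2Two)) = 0 := (hx r).symm.trans h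
        exact hu0 r (congrArg (fun z : WithLp 2 (L2Two × L2Two) => z.fst) h')
      · intro h
        have h' : WithLp.toLp 2 ((0 : L2Two), conjSwap (v r)) = 0 := (hy r).symm.trans h
        exact hv0 r (congrArg (fun z : WithLp 2 (L2Two × L2Two) => z.snd) h')
    · rcases i with r | r <;> rcases j with s | s
      · have hrs : r ≠ s := fun h => hij (by rw [h])
        simp [hx, WithLp.prod_inner_apply, huu r s hrs]
      · simp [hx, hy, WithLp.prod_inner_apply]
      · simp [hx, hy, WithLp.prod_inner_apply]
      · have hrs : r ≠ s := fun h => hij (by rw [h])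
        simp [hy, WithLp.prod_inner_apply, hvv r s hrs]
  have hcard := hli.cardinal_le_rank
  have e : Cardinal.mk ((Fin 2 → Fin 3) ⊕ (Fin 2 → Fin 3)) = (18 : ℕ) := by
    rw [Cardinal.mk_fintype]
    simp
  rwa [e] at hcard

end TBG

end

theorem propositionl :
    (∀ N : ℕ, 16 ≤ N →
      TBG.traceNorm (TBG.restrictTo TBG.reducedL2 (TBG.truncError N)) ^ (1 / 6 : ℝ)
          ≤ ENNReal.ofReal (10.23 * (N : ℝ)⁻¹ * TBG.rho 1 N 8 ^ (1 / 6 : ℝ)) ∧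
      TBG.traceNorm (TBG.restrictTo TBG.reducedL2Two (TBG.diagOp (TBG.truncError N))) ^ (1 / 6 : ℝ)
          ≤ ENNReal.ofReal (10.23 * (N : ℝ)⁻¹ * TBG.rho 1 N 8 ^ (1 / 6 : ℝ)) ∧
      ‖TBG.diagOp (TBG.truncError N)‖ ≤ 6 ^ 8 * 2 * TBG.rho 0 N 8 * ((N : ℝ) ^ 8)⁻¹) ∧
    ∀ (U : TBG.Potential) (α : ℂ), α ∈ TBG.magicSet U → TBG.HasFlatBands U α 18 := by
  exact ⟨fun N hN => ⟨TBG.rpow_traceNorm_le hN (TBG.traceNorm_restrictTo_reducedL2_le hN),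
    TBG.rpow_traceNorm_le hN (TBG.traceNorm_restrictTo_reducedL2Two_le hN),
    (TBG.norm_diagOp_le _).trans (TBG.norm_truncError_le hN)⟩,
    fun U α hα => TBG.hasFlatBands_of_mem_magicSet hα⟩
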